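/- **Theorem 3.5 (Parameter Rays at Their Full Length).** For $\kappa\in\mathbb C$ let $E_\kappa(z)=\exp(z+\kappa)$, and let $I$ be the set of $\kappa\in\mathbb C$ with $|E_\kappa^{\circ n}(0)|\to\infty$ as $n\to\infty$. Let $F(t)=e^t-1$. An address is a sequence $s=(s_1,s_2,\dots)$ of integers, and $\sigma$ is the shift $\sigma s=(s_2,s_3,\dots)$. The address $s$ is exponentially bounded if there is an $x>0$ with $|s_{k+1}|\le F^{\circ k}(x)$ for all $k\ge 0$; then put $$t_s=\inf\Big\{x>0:\ \limsup_{n\to\infty}\frac{|s_n|}{F^{\circ(n-1)}(x)}=0\Big\},\qquad t_s^*=\sup_{n\ge1}F^{\circ(-n+1)}(|s_n|).$$ Dynamic rays are defined as follows. With $\mathrm{Log}$ the principal branch, let $L_{\kappa,j}(z)=\mathrm{Log}\,z-\kappa+2\pi i j$ for $j\in\mathbb Z$. For $s$ exponentially bounded and $\tau\ge t_s^*+2\log(|\kappa|+3)$ let $$\tilde g_s^\kappa(\tau)=\lim_{m\to\infty}L_{\kappa,s_1}\circ\cdots\circ L_{\kappa,s_m}\big(F^{\circ m}(\tau)\big).$$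 For $t>t_s$, the point $g_s^\kappa(t)$ is defined if there is a continuous curve $\gamma:[t,\infty)\to\mathbb C$ with $E_\kappa^{\circ n}(\gamma(t'))=\tilde g_{\sigma^n s}^\kappa(F^{\circ n}(t'))$ for all $t'\ge t$ and all $n\ge0$ with $F^{\circ n}(t')\ge t^*_{\sigma^n s}+2\log(|\kappa|+3)$; such a curve is unique, and $g_s^\kappa(t):=\gamma(t)$. Let $\mathcal D_s(t)$ be the set of all $\kappa\in\mathbb C$ for which $g_s^\kappa(t)$ is defined. A simple root of $\kappa\mapsto g_s^\kappa(t)$ is a $\kappa_0\in\mathcal D_s(t)$ with $g_s^{\kappa_0}(t)=0$ such that this map is defined and holomorphic in a neighborhood of $\kappa_0$ and its derivative at $\kappa_0$ is not $0$. Then for every exponentially bounded address $s$ there is a unique continuous curve $G_s:(t_s,\infty)\to I\subset\mathbb C$, called the parameter ray at address $s$, such that for all $t>t_s$ the parameter $\kappa_0=G_s(t)$ satisfies $g_s^{\kappa_0}(t)=0$ and is a simple root of the map $\kappa\mapsto g_s^\kappa(t)$. Conversely, if $t>t_s$, $\kappa\in\mathcal D_s(t)$ and $g_s^\kappa(t)=0$,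 then $\kappa=G_s(t)$. Every $G_s$ is injective, the parameter rays at different exponentially bounded addresses are disjoint, and for every exponentially bounded $s$ $$G_s(t)=t+2\pi i s_1+R_s(t)\quad\text{with}\quad |R_s(t)|=O(te^{-t})\ \text{ as } t\to\infty .$$ -/

import Mathlib

open Set Filter Topology Asymptotics

namespace ExpRays

noncomputable section

/-- The exponential map `E_κ(z) = exp (z + κ)`. -/
def E (κ z : ℂ) : ℂ := Complex.exp (z + κ)

/-- The set `I` of escaping parameters: those `κ` for which the singular orbit
`0, E_κ 0, E_κ (E_κ 0), …` converges to `∞`. -/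
def escapingParameters : Set ℂ :=
  {κ | Tendsto (fun n : ℕ => ‖(E κ)^[n] 0‖) atTop atTop}

/-- The model function `F(t) = e^t - 1`. -/
def F (t : ℝ) : ℝ := Real.exp t - 1

/-- The inverse of `F` on the non-negative reals. -/
def Finv (y : ℝ) : ℝ := Real.log (1 + y)

/-- External addresses `s₁ s₂ s₃ …` are integer sequences; `s n` is the entry with label `n + 1`. -/
abbrev Address := ℕ → ℤ

/-- The shift `s₁ s₂ s₃ … ↦ s₂ s₃ s₄ …`. -/
def shift (s : Address) : Address := fun k => s (k + 1)

/-- `s` is exponentially bounded: for some `x > 0`, `|s_{k+1}| ≤ F^k(x)` for all `k ≥ 0`. -/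
def ExpBounded (s : Address) : Prop :=
  ∃ x : ℝ, 0 < x ∧ ∀ k : ℕ, |(s k : ℝ)| ≤ F^[k] x

/-- The minimal potential `t_s = inf {x > 0 : limsup |s_n| / F^{n-1}(x) = 0}`; the quotients are
non-negative, so that their limsup is `0` exactly when they tend to `0`. -/
def minPotential (s : Address) : ℝ :=
  sInf {x : ℝ | 0 < x ∧ Tendsto (fun n : ℕ => |(s n : ℝ)| / F^[n] x) atTop (𝓝 0)}

/-- `t_s^* = sup_{n ≥ 1} F^{-(n-1)}(|s_n|)`, which is finite for exponentially bounded `s`. -/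
def supPotential (s : Address) : ℝ := ⨆ n : ℕ, Finv^[n] |(s n : ℝ)|

/-- The inverse branch `L_{κ,j}(z) = Log z - κ + 2πij`. -/
def L (κ : ℂ) (j : ℤ) (z : ℂ) : ℂ :=
  Complex.log z - κ + 2 * (Real.pi : ℂ) * Complex.I * (j : ℂ)

/-- `L_{κ,s₁} ∘ ⋯ ∘ L_{κ,sₙ} (F^n(t))`. -/
def approxRay (κ : ℂ) : ℕ → Address → ℝ → ℂ
  | 0, _, t => (t : ℂ)
  | n + 1, s, t => L κ (s 0) (approxRay κ n (shift s) (F t))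

/-- `t_s^* + 2 log (|κ| + 3)`: at and above this potential the dynamic ray of `E_κ` at address `s`
is the limit of `approxRay κ n s`. -/
def tailPotential (κ : ℂ) (s : Address) : ℝ := supPotential s + 2 * Real.log (‖κ‖ + 3)

/-- `γ`, on `[t, ∞)`, is the piece of potentials `≥ t` of the dynamic ray of `E_κ` at address `s`.
At potentials `t'` at least `tailPotential κ s`, it is the ray tail `lim_m approxRay κ m s t'`
(case `n = 0`). At the other potentials it is the continuous pull-back under `E_κ^n` of the ray
tail at address `σ^n s`: for every `t' > t_s` the potential `F^n(t')` is in the range of the tail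
at address `σ^n s` as soon as `n` is large. Since `E_κ : ℂ → ℂ ∖ {0}` is a covering, there is at
most one such curve if `s` is exponentially bounded and `t > t_s`, and there is none precisely if
for some `n ≥ 1` the ray at address `σ^n s` runs through the singular value `0` at a potential
`≥ F^n(t)`. -/
def IsRayPiece (κ : ℂ) (s : Address) (t : ℝ) (γ : ℝ → ℂ) : Prop :=
  ContinuousOn γ (Ici t) ∧
    ∀ n : ℕ, ∀ t' : ℝ, t ≤ t' → tailPotential κ (shift^[n] s) ≤ F^[n] t' →
      Tendsto (fun m : ℕ => approxRay κ m (shift^[n] s) (F^[n] t')) atTop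
        (𝓝 ((E κ)^[n] (γ t')))

/-- The set `D_s(t)` of parameters `κ` for which `g_s^κ(t)` is defined (for `t > t_s`). -/
def rayDomain (s : Address) (t : ℝ) : Set ℂ := {κ | ∃ γ : ℝ → ℂ, IsRayPiece κ s t γ}

open Classical in
/-- The point `g_s^κ(t)` of potential `t` on the dynamic ray of `E_κ` at address `s`. It is
meaningful for `κ ∈ rayDomain s t` only, and is `0` by convention elsewhere. -/
def dynamicRay (κ : ℂ) (s : Address) (t : ℝ) : ℂ :=
  if h : ∃ γ : ℝ → ℂ, IsRayPiece κ s t γ then h.choose t else 0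

/-- `κ₀` is a root of `κ ↦ g_s^κ(t)`, a map with domain `D_s(t)`. -/
def IsRayRoot (s : Address) (t : ℝ) (κ₀ : ℂ) : Prop :=
  κ₀ ∈ rayDomain s t ∧ dynamicRay κ₀ s t = 0

/-- `κ₀` is a simple root of `κ ↦ g_s^κ(t)`: it is a root, the map is defined and holomorphic
near `κ₀`, and its derivative does not vanish there. -/
def IsSimpleRayRoot (s : Address) (t : ℝ) (κ₀ : ℂ) : Prop :=
  IsRayRoot s t κ₀ ∧ rayDomain s t ∈ 𝓝 κ₀ ∧
    AnalyticAt ℂ (fun κ => dynamicRay κ s t) κ₀ ∧ deriv (fun κ => dynamicRay κ s t) κ₀ ≠ 0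

/-- `G`, on `(t_s, ∞)`, is a curve of escaping parameters such that `G t` is, for every `t > t_s`,
a simple root of `κ ↦ g_s^κ(t)`. -/
def IsParameterRay (s : Address) (G : ℝ → ℂ) : Prop :=
  ContinuousOn G (Ioi (minPotential s)) ∧
    MapsTo G (Ioi (minPotential s)) escapingParameters ∧
    ∀ t : ℝ, minPotential s < t → IsSimpleRayRoot s t (G t)

end

end ExpRays

namespace ExpRays

/-! ### The model function -/

/-! Roots are counted in the strips `|Im κ - 2πj| < π`. At a root the singular orbit escapes.
Escaping parameters avoid the lines `Im κ = (2j+1)π`, on which the singular orbit is real and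
bounded, so no root passes from one strip to another as `t` varies. For large `t`, dynamic rays are
limits of contracting pull-backs, and near `t + 2πis₁` one has `g_s^κ(t) = t + 2πis₁ - κ +
O(te^{-t})`. The strip `j = s₁` then contains exactly one root, a simple one close to `t + 2πis₁`,
and the other strips contain none. Connectedness of `(t_s, ∞)` carries this count to all potentials:
having exactly one root, a simple one, is an open condition on `t`, and so is its negation
(`HasUniqueSimpleRoot.eventually`, `eventually_not_hasUniqueSimpleRoot`).

Three facts make these conditions open. First, rays depend holomorphically on `κ` and continuously
on `t` (`hasLocalFamily`), so Hurwitz arguments apply: zeros persist, and a multiple zero does not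
turn into a single simple one. Second, limits of roots are roots (`isRayRoot_of_tendsto`). The
relation between the singular orbit and the ray tails passes to the limit, and the ray could only be
undefined there if a shifted ray met `0` at a larger potential. This is impossible, because the
orbit determines the potential (`eq_of_tailRay_eq`). Third, roots in a strip stay bounded for
bounded `t` (`exists_re_bound`).

The third fact is the heart of the proof. Suppose a root has `Re κ` huge compared with `|Im κ|` and
with all relevant address bounds (`IsFarRoot`). As long as its imaginary parts are moderate, the
singular orbit grows like iterated exponentials; a turn to the left would create an attracting
cycle. It cannot do so up to the level where the ray reaches its tail, so there is a first level `p
+ 1` with a large imaginary part. A horizontal ray from the orbit point at level `p` pulls back to a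
nearly horizontal curve from `0` to `∞`. The images of the dynamic ray cannot cross this curve: a
crossing would give a large imaginary part later on, where the address forbids it. So the images do
not wind around `0`, and their imaginary parts stay within `5π/2` of those prescribed by the
address. At the endpoint `0` of the ray this contradicts the choice of `p`.

The asymptotics come from the estimate for large `t`. Injectivity and disjointness hold because a
parameter determines its potential and address (`IsRayRoot.eq_and_eq`). -/

theorem F_strictMono : StrictMono F := fun a b h => by
  simpa [F] using h

theorem continuous_F : Continuous F := by unfold F; fun_prop

theorem le_F (t : ℝ) : t ≤ F t := by
  have := Real.add_one_le_exp t
  unfold F; linarith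

theorem F_pos {t : ℝ} (h : 0 < t) : 0 < F t := h.trans_le (le_F t)

theorem iterate_F_strictMono (n : ℕ) : StrictMono (F^[n]) := F_strictMono.iterate n

theorem continuous_iterate_F (n : ℕ) : Continuous (F^[n]) := continuous_F.iterate n

theorem iterate_F_le_succ (n : ℕ) (t : ℝ) : F^[n] t ≤ F^[n + 1] t := by
  rw [Function.iterate_succ_apply']; exact le_F _

theorem iterate_F_monotone (t : ℝ) : Monotone fun n : ℕ => F^[n] t :=
  monotone_nat_of_le_succ fun n => iterate_F_le_succ n t

theorem le_iterate_F (n : ℕ) (t : ℝ) : t ≤ F^[n] t := iterate_F_monotone t (Nat.zero_le n)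

theorem iterate_F_pos {t : ℝ} (h : 0 < t) (n : ℕ) : 0 < F^[n] t := h.trans_le (le_iterate_F n t)

theorem iterate_F_nonneg {t : ℝ} (h : 0 ≤ t) (n : ℕ) : 0 ≤ F^[n] t := h.trans (le_iterate_F n t)

theorem F_sub_ge {a b : ℝ} (hab : a ≤ b) : (1 + a) * (b - a) ≤ F b - F a := by
  have h1 : F b - F a = Real.exp a * (Real.exp (b - a) - 1) := by
    have : Real.exp b = Real.exp a * Real.exp (b - a) := by rw [← Real.exp_add]; ring_nf
    unfold F; rw [this]; ring
  have h2 := Real.add_one_le_exp (b - a)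
  have h3 := Real.add_one_le_exp a
  have h4 := Real.exp_pos a
  rw [h1]; nlinarith [mul_nonneg (sub_nonneg.2 hab) (sub_nonneg.2 h3)]

theorem iterate_F_sub_ge {a b : ℝ} (ha : 0 ≤ a) (hab : a ≤ b) (n : ℕ) :
    (1 + a) ^ n * (b - a) ≤ F^[n] b - F^[n] a := by
  induction n with
  | zero => simp
  | succ n ih =>
    rw [Function.iterate_succ_apply', Function.iterate_succ_apply']
    have h1 := F_sub_ge ((iterate_F_strictMono n).monotone hab)
    have h2 := le_iterate_F n a
    have h3 : 0 ≤ F^[n] b - F^[n] a := sub_nonneg.2 ((iterate_F_strictMono n).monotone hab)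
    calc (1 + a) ^ (n + 1) * (b - a) = (1 + a) * ((1 + a) ^ n * (b - a)) := by ring
      _ ≤ (1 + a) * (F^[n] b - F^[n] a) := by gcongr
      _ ≤ (1 + F^[n] a) * (F^[n] b - F^[n] a) := by gcongr
      _ ≤ _ := h1

/-- `F` stretches intervals to the right of `a` by a factor at least `1 + a > 1`. Hence two
potentials whose orbits stay at bounded distance are equal. -/
theorem tendsto_iterate_F_sub {a b : ℝ} (ha : 0 < a) (hab : a < b) :
    Tendsto (fun n : ℕ => F^[n] b - F^[n] a) atTop atTop := by
  refine tendsto_atTop_mono (fun n => iterate_F_sub_ge ha.le hab.le n) ?_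
  exact (tendsto_pow_atTop_atTop_of_one_lt (by linarith)).atTop_mul_const (by linarith)

theorem tendsto_iterate_F {t : ℝ} (ht : 0 < t) : Tendsto (fun n : ℕ => F^[n] t) atTop atTop := by
  refine tendsto_atTop_mono (fun n => ?_) (tendsto_iterate_F_sub (half_pos ht) (half_lt_self ht))
  have := iterate_F_pos (half_pos ht) n
  linarith

/-- Once the gap is at least `1`, the next exponentials differ by a factor at least `e > 2`. The
factor `2` leaves room for additive constants at later levels. -/
theorem eventually_two_mul_iterate_F_le {a b : ℝ} (ha : 0 < a) (hab : a < b) :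
    ∀ᶠ n : ℕ in atTop, 2 * F^[n] a ≤ F^[n] b := by
  obtain ⟨N, hN⟩ := eventually_atTop.1 ((tendsto_iterate_F_sub ha hab).eventually_ge_atTop 1)
  refine eventually_atTop.2 ⟨N + 1, fun n hn => ?_⟩
  obtain ⟨m, rfl⟩ : ∃ m, n = m + 1 := ⟨n - 1, by omega⟩
  have h := hN m (by omega)
  rw [Function.iterate_succ_apply', Function.iterate_succ_apply']
  have h1 : Real.exp (F^[m] b) = Real.exp (F^[m] a) * Real.exp (F^[m] b - F^[m] a) := by
    rw [← Real.exp_add]; ring_nf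
  have h2 := Real.add_one_le_exp (F^[m] b - F^[m] a)
  have h3 := Real.exp_pos (F^[m] a)
  unfold F
  unfold F at h h1 h2 h3
  nlinarith

theorem Finv_F (t : ℝ) : Finv (F t) = t := by simp [Finv, F]

theorem F_Finv {y : ℝ} (hy : -1 < y) : F (Finv y) = y := by
  unfold F Finv; rw [Real.exp_log (by linarith)]; ring

theorem Finv_nonneg {y : ℝ} (hy : 0 ≤ y) : 0 ≤ Finv y := Real.log_nonneg (by linarith)

theorem Finv_le_iff {y x : ℝ} (hy : 0 ≤ y) : Finv y ≤ x ↔ y ≤ F x := by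
  rw [← F_strictMono.le_iff_le, F_Finv (by linarith)]

theorem iterate_Finv_nonneg {y : ℝ} (hy : 0 ≤ y) (n : ℕ) : 0 ≤ Finv^[n] y := by
  induction n with
  | zero => simpa
  | succ n ih => rw [Function.iterate_succ_apply']; exact Finv_nonneg ih

/-- This identifies `supPotential s`, for exponentially bounded `s`, as the least `x` with `|s k| ≤
F^[k] x` for all `k`, the only form in which it is used. -/
theorem iterate_Finv_le_iff {y x : ℝ} (hy : 0 ≤ y) (n : ℕ) : Finv^[n] y ≤ x ↔ y ≤ F^[n] x := by
  induction n generalizing x with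
  | zero => simp
  | succ n ih =>
    rw [Function.iterate_succ_apply', Finv_le_iff (iterate_Finv_nonneg hy n), ih,
      Function.iterate_succ_apply]

/-! ### Addresses and their potentials -/

theorem shift_iterate_apply (s : Address) (n k : ℕ) : shift^[n] s k = s (n + k) := by
  induction n generalizing k with
  | zero => simp
  | succ n ih => rw [Function.iterate_succ_apply', shift, ih]; congr 1; omega

theorem shift_iterate_zero (s : Address) (n : ℕ) : shift^[n] s 0 = s n := by
  simp [shift_iterate_apply]

theorem ExpBounded.shift {s : Address} (h : ExpBounded s) : ExpBounded (shift s) := by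
  obtain ⟨x, hx, h⟩ := h
  exact ⟨F x, F_pos hx, fun k => by
    simpa [ExpRays.shift, Function.iterate_succ_apply] using h (k + 1)⟩

theorem ExpBounded.iterate {s : Address} (h : ExpBounded s) (n : ℕ) :
    ExpBounded (ExpRays.shift^[n] s) := by
  induction n with
  | zero => simpa
  | succ n ih => rw [Function.iterate_succ_apply']; exact ih.shift

theorem ExpBounded.bddAbove {s : Address} (h : ExpBounded s) :
    BddAbove (range fun n : ℕ => Finv^[n] |(s n : ℝ)|) := by
  obtain ⟨x, hx, h⟩ := h
  refine ⟨x, ?_⟩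
  rintro _ ⟨n, rfl⟩
  exact (iterate_Finv_le_iff (abs_nonneg _) n).2 (h n)

theorem supPotential_nonneg (s : Address) : 0 ≤ supPotential s :=
  Real.iSup_nonneg fun n => iterate_Finv_nonneg (abs_nonneg _) n

theorem ExpBounded.abs_le {s : Address} (h : ExpBounded s) (k : ℕ) :
    |(s k : ℝ)| ≤ F^[k] (supPotential s) :=
  (iterate_Finv_le_iff (abs_nonneg _) k).1 (le_ciSup h.bddAbove k)

theorem supPotential_le {s : Address} {x : ℝ} (h : ∀ k, |(s k : ℝ)| ≤ F^[k] x) :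
    supPotential s ≤ x :=
  ciSup_le fun n => (iterate_Finv_le_iff (abs_nonneg _) n).2 (h n)

theorem ExpBounded.supPotential_shift_le {s : Address} (h : ExpBounded s) :
    supPotential (ExpRays.shift s) ≤ F (supPotential s) :=
  supPotential_le fun k => by
    simpa [ExpRays.shift, Function.iterate_succ_apply] using h.abs_le (k + 1)

theorem ExpBounded.supPotential_iterate_le {s : Address} (h : ExpBounded s) (n : ℕ) :
    supPotential (ExpRays.shift^[n] s) ≤ F^[n] (supPotential s) := by
  refine supPotential_le fun k => ?_
  rw [shift_iterate_apply, ← Function.iterate_add_apply, add_comm k n]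
  exact h.abs_le _

/-- `t` exceeds the minimal potential of the exponentially bounded address `s`. -/
def Admissible (s : Address) (t : ℝ) : Prop :=
  ExpBounded s ∧ ∃ u : ℝ, 0 < u ∧ u < t ∧ ∀ᶠ n : ℕ in atTop, |(s n : ℝ)| ≤ F^[n] u

/-- If `x` bounds `s`, then `x + 1` belongs to the set: the quotient with index `n + 1` is at most
the exponential of minus the gap between the `n`-th iterates. Without this, `minPotential` could be
the default value `sInf ∅ = 0`. -/
theorem ExpBounded.nonempty_potentials {s : Address} (h : ExpBounded s) :
    {x : ℝ | 0 < x ∧ Tendsto (fun n : ℕ => |(s n : ℝ)| / F^[n] x) atTop (𝓝 0)}.Nonempty := by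
  obtain ⟨x, hx, h⟩ := h
  refine ⟨x + 1, by linarith, ?_⟩
  rw [← tendsto_add_atTop_iff_nat 1]
  have h1 : Tendsto (fun n : ℕ => Real.exp (-(F^[n] (x + 1) - F^[n] x))) atTop (𝓝 0) :=
    Real.tendsto_exp_neg_atTop_nhds_zero.comp (tendsto_iterate_F_sub hx (by linarith))
  refine squeeze_zero (fun n => by
    have := iterate_F_pos (show 0 < x + 1 by linarith) (n + 1)
    positivity) (fun n => ?_) h1
  have hp := iterate_F_pos (show 0 < x + 1 by linarith) (n + 1)
  rw [div_le_iff₀ hp]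
  refine (h (n + 1)).trans ?_
  rw [Function.iterate_succ_apply', Function.iterate_succ_apply']
  have h2 : Real.exp (-(F^[n] (x + 1) - F^[n] x)) * Real.exp (F^[n] (x + 1))
    = Real.exp (F^[n] x) := by rw [← Real.exp_add]; ring_nf
  have h3 : Real.exp (-(F^[n] (x + 1) - F^[n] x)) ≤ 1 := by
    rw [Real.exp_le_one_iff]
    have := (iterate_F_strictMono n).monotone (show x ≤ x + 1 by linarith)
    linarith
  unfold F
  unfold F at h2 h3
  linarith

theorem admissible_of_minPotential_lt {s : Address} (h : ExpBounded s) {t : ℝ}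
    (ht : minPotential s < t) : Admissible s t := by
  obtain ⟨u, ⟨hu0, hu⟩, hut⟩ := exists_lt_of_csInf_lt h.nonempty_potentials ht
  refine ⟨h, u, hu0, hut, ?_⟩
  filter_upwards [hu.eventually_le_const zero_lt_one] with n hn
  rwa [div_le_one (iterate_F_pos hu0 n)] at hn

namespace Admissible

variable {s : Address} {t : ℝ}

theorem pos (h : Admissible s t) : 0 < t := by
  obtain ⟨-, u, h0, h1, -⟩ := h; linarith

theorem mono (h : Admissible s t) {t' : ℝ} (ht : t ≤ t') : Admissible s t' := by
  obtain ⟨hs, u, h0, h1, h2⟩ := h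
  exact ⟨hs, u, h0, h1.trans_le ht, h2⟩

theorem exists_lt (h : Admissible s t) : ∃ t' < t, Admissible s t' := by
  obtain ⟨hs, u, h0, h1, h2⟩ := h
  exact ⟨(u + t) / 2, by linarith, hs, u, h0, by linarith, h2⟩

theorem shift (h : Admissible s t) : Admissible (ExpRays.shift s) (F t) := by
  obtain ⟨hs, u, h0, h1, h2⟩ := h
  refine ⟨hs.shift, F u, F_pos h0, F_strictMono h1, ?_⟩
  filter_upwards [(tendsto_add_atTop_nat 1).eventually h2] with n hn
  simpa [ExpRays.shift, Function.iterate_succ_apply] using hn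

theorem iterate (h : Admissible s t) (n : ℕ) : Admissible (ExpRays.shift^[n] s) (F^[n] t) := by
  induction n with
  | zero => simpa
  | succ n ih =>
    rw [Function.iterate_succ_apply', Function.iterate_succ_apply']; exact ih.shift

/-- From some level on, all entries obey the bound with `u`, so the supremum for the shifted address
does too. It is then at most half the current potential. -/
theorem exists_supPotential_le (h : Admissible s t) : ∃ u : ℝ, 0 < u ∧ u < t ∧
    ∃ N : ℕ, ∀ n ≥ N, supPotential (ExpRays.shift^[n] s) ≤ F^[n] u ∧ 2 * F^[n] u ≤ F^[n] t := by
  obtain ⟨hs, u, h0, h1, h2⟩ := h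
  refine ⟨u, h0, h1, ?_⟩
  obtain ⟨N, hN⟩ := eventually_atTop.1 h2
  obtain ⟨M, hM⟩ := eventually_atTop.1 (eventually_two_mul_iterate_F_le h0 h1)
  refine ⟨max N M, fun n hn => ⟨supPotential_le fun k => ?_, hM n (le_of_max_le_right hn)⟩⟩
  rw [shift_iterate_apply, ← Function.iterate_add_apply, add_comm k n]
  exact hN _ ((le_of_max_le_left hn).trans (by omega))

theorem eventually_supPotential_add_le (h : Admissible s t) (C : ℝ) :
    ∃ N : ℕ, ∀ n ≥ N, ∀ t' ≥ t, supPotential (ExpRays.shift^[n] s) + C ≤ F^[n] t' := by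
  obtain ⟨u, h0, h1, N, hN⟩ := h.exists_supPotential_le
  obtain ⟨M, hM⟩ := eventually_atTop.1 ((tendsto_iterate_F h0).eventually_ge_atTop C)
  refine ⟨max N M, fun n hn t' ht' => ?_⟩
  have a1 := hN n (le_of_max_le_left hn)
  have a2 := hM n (le_of_max_le_right hn)
  have a3 := (iterate_F_strictMono n).monotone ht'
  linarith

/-- At late levels the hypothesis gives `F^[n] u < C`, and the finitely many early levels are
bounded by `B`. Linearity in `C` matters: `C` will be logarithmic in `‖κ‖`, so these bounds are
small against `Re κ`. -/
theorem exists_supPotential_bound (h : Admissible s t) : ∃ B : ℝ, 0 ≤ B ∧ ∀ C : ℝ, 0 ≤ C →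
    ∀ t' ≥ t, ∀ n : ℕ, F^[n] t' < supPotential (ExpRays.shift^[n] s) + C →
      supPotential (ExpRays.shift^[n] s) ≤ B + C := by
  obtain ⟨u, h0, h1, N, hN⟩ := h.exists_supPotential_le
  refine ⟨F^[N] (supPotential s), iterate_F_nonneg (supPotential_nonneg s) N,
    fun C hC t' ht' n hn => ?_⟩
  have hB := iterate_F_nonneg (supPotential_nonneg s) N
  rcases le_total N n with hNn | hNn
  · have a1 := hN n hNn
    have a3 := (iterate_F_strictMono n).monotone ht'
    linarith
  · have a1 := h.1.supPotential_iterate_le n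
    have a2 := iterate_F_monotone (supPotential s) hNn
    simp only at a2
    linarith

end Admissible

/-! ### Ray tails -/

/-- An open condition on `(κ, τ)`, implied by `tailPotential κ s ≤ τ`, under which the ray tail of
`E_κ` at address `s` is defined at potential `τ`. -/
def InTail (κ : ℂ) (s : Address) (τ : ℝ) : Prop :=
  Real.exp (supPotential s) * (‖κ‖ + 29 / 10) ^ 2 < Real.exp τ

/-- Replacing `3` by `29 / 10` makes the inequality strict, which gives openness in `(κ, τ)`. -/
theorem inTail_of_tailPotential_le {κ : ℂ} {s : Address} {τ : ℝ} (h : tailPotential κ s ≤ τ) :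
    InTail κ s τ := by
  have hk := norm_nonneg κ
  have h1 : Real.exp (tailPotential κ s) = Real.exp (supPotential s) * (‖κ‖ + 3) ^ 2 := by
    rw [tailPotential, Real.exp_add, two_mul, Real.exp_add, Real.exp_log (by linarith), sq]
  have h2 := Real.exp_le_exp.2 h
  rw [h1] at h2
  have h3 := Real.exp_pos (supPotential s)
  unfold InTail
  refine lt_of_lt_of_le ?_ h2
  gcongr
  norm_num

theorem isOpen_setOf_inTail (s : Address) : IsOpen {p : ℂ × ℝ | InTail p.1 s p.2} := by
  unfold InTail
  exact isOpen_lt (by fun_prop) (by fun_prop)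

/-- The principal branch of the logarithm is `4 / r`-Lipschitz on the disk about `r > 0` of radius
`3 r / 4`. -/
theorem norm_log_sub_log_le {r : ℝ} (hr : 0 < r) {a b : ℂ} (ha : ‖a - r‖ ≤ 3 / 4 * r)
    (hb : ‖b - r‖ ≤ 3 / 4 * r) : ‖Complex.log a - Complex.log b‖ ≤ 4 / r * ‖a - b‖ := by
  have hre : ∀ z ∈ Metric.closedBall (r : ℂ) (3 / 4 * r), r / 4 ≤ z.re := by
    intro z hz
    rw [mem_closedBall_iff_norm] at hz
    have := (abs_le.1 ((Complex.abs_re_le_norm _).trans hz)).1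
    simp at this; linarith
  refine Convex.norm_image_sub_le_of_norm_hasDerivWithin_le (f := Complex.log)
    (f' := fun z => z⁻¹) (s := Metric.closedBall (r : ℂ) (3 / 4 * r)) (fun z hz => ?_)
    (fun z hz => ?_) (convex_closedBall _ _) (by rwa [mem_closedBall_iff_norm])
    (by rwa [mem_closedBall_iff_norm])
  · have : z ∈ Complex.slitPlane := Or.inl (by have := hre z hz; linarith)
    exact (Complex.hasDerivAt_log this).hasDerivWithinAt
  · rw [norm_inv, show 4 / r = (r / 4)⁻¹ by field_simp]
    exact inv_anti₀ (by linarith) ((hre z hz).trans (Complex.re_le_norm z))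

theorem log_sub_eq_log_one_add {τ : ℝ} {a : ℂ} (ha : a ≠ 0) :
    Complex.log a - τ = Complex.log (1 + (a - Real.exp τ) / Real.exp τ) := by
  have he := Real.exp_pos τ
  have he' : (Real.exp τ : ℂ) ≠ 0 := by exact_mod_cast he.ne'
  have h1 : a = Real.exp τ * (1 + (a - Real.exp τ) / Real.exp τ) := by field_simp; ring
  have h2 : (1 + (a - Real.exp τ) / Real.exp τ) ≠ 0 := by
    intro h; rw [h, mul_zero] at h1; exact ha h1
  conv_lhs => rw [h1, Complex.log_ofReal_mul he h2, Real.log_exp]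
  ring

theorem norm_log_sub_le_two {τ : ℝ} {a : ℂ} (ha : ‖a - Real.exp τ‖ ≤ 3 / 4 * Real.exp τ) :
    ‖Complex.log a - τ‖ ≤ 2 := by
  have he := Real.exp_pos τ
  have ha0 : a ≠ 0 := by
    rintro rfl
    rw [zero_sub, norm_neg, Complex.norm_real, Real.norm_of_nonneg he.le] at ha
    linarith
  rw [log_sub_eq_log_one_add ha0]
  set η := (a - Real.exp τ) / Real.exp τ with hη
  have h1 : ‖η‖ ≤ 3 / 4 := by
    rw [hη, norm_div, Complex.norm_real, Real.norm_of_nonneg he.le]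
    rw [div_le_iff₀ he]; exact ha
  refine (Complex.norm_log_one_add_le (by linarith)).trans ?_
  have h2 : (1 - ‖η‖)⁻¹ ≤ 4 := by
    rw [inv_le_comm₀ (by linarith) (by norm_num)]; linarith
  have h3 := norm_nonneg η
  have h5 : 0 ≤ (1 - ‖η‖)⁻¹ := inv_nonneg.2 (by linarith)
  have h4 : ‖η‖ ^ 2 ≤ (3 / 4) ^ 2 := by gcongr
  calc ‖η‖ ^ 2 * (1 - ‖η‖)⁻¹ / 2 + ‖η‖ ≤ (3 / 4) ^ 2 * 4 / 2 + 3 / 4 := by gcongr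
    _ ≤ 2 := by norm_num

theorem norm_log_sub_le {τ δ : ℝ} {a : ℂ} (ha : ‖a - Real.exp τ‖ ≤ δ)
    (hδ : δ ≤ 1 / 2 * Real.exp τ) : ‖Complex.log a - τ‖ ≤ 3 / 2 * (δ * Real.exp (-τ)) := by
  have he := Real.exp_pos τ
  have ha0 : a ≠ 0 := by
    rintro rfl
    rw [zero_sub, norm_neg, Complex.norm_real, Real.norm_of_nonneg he.le] at ha
    linarith
  rw [log_sub_eq_log_one_add ha0]
  set η := (a - Real.exp τ) / Real.exp τ with hη
  have h0 : ‖η‖ = ‖a - Real.exp τ‖ * Real.exp (-τ) := by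
    rw [hη, norm_div, Complex.norm_real, Real.norm_of_nonneg he.le, Real.exp_neg, div_eq_mul_inv]
  have h2 : ‖η‖ ≤ δ * Real.exp (-τ) := by rw [h0]; gcongr
  have h1 : ‖η‖ ≤ 1 / 2 := by
    refine h2.trans ?_
    rw [Real.exp_neg, ← div_eq_mul_inv, div_le_iff₀ he]; exact hδ
  refine (Complex.norm_log_one_add_half_le_self h1).trans ?_
  gcongr

namespace InTail

variable {κ : ℂ} {s : Address} {τ : ℝ}

theorem mono (h : InTail κ s τ) {τ' : ℝ} (hτ : τ ≤ τ') : InTail κ s τ' :=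
  lt_of_lt_of_le h (Real.exp_le_exp.2 hτ)

theorem eight_lt_exp (h : InTail κ s τ) : 8 < Real.exp τ := by
  refine lt_trans ?_ h
  have h1 := Real.one_le_exp (supPotential_nonneg s)
  have hk := norm_nonneg κ
  nlinarith

/-- With `K = ‖κ‖ + 29 / 10` and `x = supPotential s`, one has `e^x K² - 1 ≥ (e^x - 1) + (K² - 1)`,
and the two terms dominate the shifted supremum and `log K²`. -/
theorem shift (hs : ExpBounded s) (h : InTail κ s τ) : InTail κ (ExpRays.shift s) (F τ) := by
  have hk := norm_nonneg κ
  set K := ‖κ‖ + 29 / 10 with hK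
  have h1 := Real.one_le_exp (supPotential_nonneg s)
  have h2 : Real.exp (supPotential s) * K ^ 2 < Real.exp τ := h
  have h3 := hs.supPotential_shift_le
  have h4 := Real.log_le_sub_one_of_pos (show 0 < K ^ 2 by positivity)
  have h5 : Real.log (K ^ 2) + supPotential (ExpRays.shift s) < F τ := by
    have h7 : 1 ≤ K ^ 2 := by nlinarith
    unfold F at h3 ⊢
    nlinarith [mul_nonneg (sub_nonneg.2 h1) (sub_nonneg.2 h7)]
  have h6 := Real.exp_lt_exp.2 h5
  rw [Real.exp_add, Real.exp_log (by positivity)] at h6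
  unfold InTail
  rwa [mul_comm]

theorem iterate (hs : ExpBounded s) (h : InTail κ s τ) (n : ℕ) :
    InTail κ (ExpRays.shift^[n] s) (F^[n] τ) := by
  induction n with
  | zero => simpa
  | succ n ih =>
    rw [Function.iterate_succ_apply', Function.iterate_succ_apply']
    exact ih.shift (hs.iterate n)

/-- The left side bounds the distance of the next point from `e^τ`: `2` for the error of the
logarithm, `1` for the `-1` in `F`, the rest for the translation in the inverse branch. -/
theorem coeff_le (hs : ExpBounded s) (h : InTail κ s τ) :
    ‖κ‖ + 3 + 2 * Real.pi * |(s 1 : ℝ)| ≤ 3 / 4 * Real.exp τ := by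
  have hk := norm_nonneg κ
  have h1 := Real.one_le_exp (supPotential_nonneg s)
  have h2 : Real.exp (supPotential s) * (‖κ‖ + 29 / 10) ^ 2 < Real.exp τ := h
  have h3 : |(s 1 : ℝ)| ≤ Real.exp (supPotential s) - 1 := hs.abs_le 1
  have h4 := Real.pi_lt_d4
  have h5 := Real.pi_pos
  have h6 : 2 * Real.pi * |(s 1 : ℝ)| ≤ 6.2832 * (Real.exp (supPotential s) - 1) := by
    gcongr; linarith
  nlinarith [mul_nonneg (sub_nonneg.2 h1) hk, mul_nonneg (sub_nonneg.2 h1) (mul_nonneg hk hk)]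

/-- The two bounds feed each other: closeness to `e^τ` puts the logarithm within `2` of `τ`, which
is the closeness required one level up. The constants do not deteriorate with `m`. -/
theorem approxRay_estimates (hs : ExpBounded s) (h : InTail κ s τ) (m : ℕ) :
    ‖approxRay κ m (ExpRays.shift s) (F τ) - Real.exp τ‖ ≤ ‖κ‖ + 3 + 2 * Real.pi * |(s 1 : ℝ)| ∧
    ‖approxRay κ (m + 1) s τ - (τ - κ + 2 * (Real.pi : ℂ) * Complex.I * (s 0 : ℂ))‖ ≤ 2 := by
  induction m generalizing s τ with
  | zero =>
    have h1 : ‖approxRay κ 0 (ExpRays.shift s) (F τ) - Real.exp τ‖ ≤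
        ‖κ‖ + 3 + 2 * Real.pi * |(s 1 : ℝ)| := by
      have : approxRay κ 0 (ExpRays.shift s) (F τ) - Real.exp τ = -1 := by
        simp [approxRay, F]
      rw [this, norm_neg, norm_one]
      have := norm_nonneg κ
      have : 0 ≤ 2 * Real.pi * |(s 1 : ℝ)| := by positivity
      linarith
    refine ⟨h1, ?_⟩
    have := norm_log_sub_le_two (h1.trans (h.coeff_le hs))
    rw [approxRay, L]
    convert this using 2; ring
  | succ m ih =>
    have h1 : ‖approxRay κ (m + 1) (ExpRays.shift s) (F τ) - Real.exp τ‖ ≤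
        ‖κ‖ + 3 + 2 * Real.pi * |(s 1 : ℝ)| := by
      have h2 := (ih hs.shift (h.shift hs)).2
      set A := approxRay κ (m + 1) (ExpRays.shift s) (F τ)
      have h3 : A - Real.exp τ = (A - ((F τ : ℝ) - κ + 2 * (Real.pi : ℂ) * Complex.I *
          ((ExpRays.shift s) 0 : ℂ))) + (-κ + (-1) + 2 * (Real.pi : ℂ) * Complex.I * (s 1 : ℂ)) := by
        simp [F, ExpRays.shift]; ring
      rw [h3]
      refine (norm_add_le _ _).trans ?_
      have h4 : ‖(-κ + (-1) + 2 * (Real.pi : ℂ) * Complex.I * (s 1 : ℂ))‖ ≤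
          ‖κ‖ + 1 + 2 * Real.pi * |(s 1 : ℝ)| := by
        refine (norm_add₃_le).trans ?_
        simp [abs_of_pos Real.pi_pos]
      linarith
    refine ⟨h1, ?_⟩
    have := norm_log_sub_le_two (h1.trans (h.coeff_le hs))
    rw [approxRay, L]
    convert this using 2; ring

theorem norm_approxRay_sub_exp (hs : ExpBounded s) (h : InTail κ s τ) (m : ℕ) :
    ‖approxRay κ m (ExpRays.shift s) (F τ) - (Real.exp τ : ℝ)‖ ≤ 3 / 4 * Real.exp τ :=
  (h.approxRay_estimates hs m).1.trans (h.coeff_le hs)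

theorem re_approxRay_pos (hs : ExpBounded s) (h : InTail κ s τ) (m : ℕ) :
    0 < (approxRay κ m (ExpRays.shift s) (F τ)).re := by
  have h1 := (abs_le.1 ((Complex.abs_re_le_norm _).trans (h.norm_approxRay_sub_exp hs m))).1
  rw [Complex.sub_re, Complex.ofReal_re] at h1
  have := Real.exp_pos τ
  linarith

/-- On the disks in question the inverse branches contract by `4 / e^τ ≤ 1 / 2`, because `e^τ > 8`.
The innermost difference contributes at most `6`. -/
theorem norm_approxRay_succ_sub (hs : ExpBounded s) (h : InTail κ s τ) (m : ℕ) :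
    ‖approxRay κ (m + 2) s τ - approxRay κ (m + 1) s τ‖ ≤ 6 * (1 / 2) ^ m := by
  induction m generalizing s τ with
  | zero =>
    have he := Real.exp_pos τ
    have h0 := h.norm_approxRay_sub_exp hs 0
    have h1 := h.norm_approxRay_sub_exp hs 1
    have h2 := norm_log_sub_log_le he h1 h0
    have h3 : ‖approxRay κ 1 (ExpRays.shift s) (F τ) - approxRay κ 0 (ExpRays.shift s) (F τ)‖ ≤
        3 / 2 * Real.exp τ := by
      rw [← sub_sub_sub_cancel_right _ _ ((Real.exp τ : ℝ) : ℂ)]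
      refine (norm_sub_le _ _).trans ?_
      linarith
    rw [approxRay, approxRay.eq_2 κ s τ 0, L, L]
    have h4 : 4 / Real.exp τ * (3 / 2 * Real.exp τ) = 6 := by field_simp; norm_num
    calc _ = ‖Complex.log (approxRay κ 1 (ExpRays.shift s) (F τ)) -
          Complex.log (approxRay κ 0 (ExpRays.shift s) (F τ))‖ := by congr 1; ring
      _ ≤ _ := h2
      _ ≤ 4 / Real.exp τ * (3 / 2 * Real.exp τ) := by gcongr
      _ ≤ _ := by rw [h4]; norm_num
  | succ m ih =>
    have he := Real.exp_pos τ
    have h0 := h.norm_approxRay_sub_exp hs (m + 1)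
    have h1 := h.norm_approxRay_sub_exp hs (m + 2)
    have h2 := norm_log_sub_log_le he h1 h0
    have h3 := ih hs.shift (h.shift hs)
    rw [approxRay, approxRay.eq_2 κ s τ (m + 1), L, L]
    have h4 : 4 / Real.exp τ ≤ 1 / 2 := by
      rw [div_le_iff₀ he]; linarith [h.eight_lt_exp]
    calc _ = ‖Complex.log (approxRay κ (m + 2) (ExpRays.shift s) (F τ)) -
          Complex.log (approxRay κ (m + 1) (ExpRays.shift s) (F τ))‖ := by congr 1; ring
      _ ≤ _ := h2
      _ ≤ 1 / 2 * (6 * (1 / 2) ^ m) := by gcongr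
      _ = _ := by ring

end InTail

/-- The tail of the dynamic ray of `E_κ` at address `s`. -/
noncomputable def tailRay (κ : ℂ) (s : Address) (τ : ℝ) : ℂ :=
  limUnder atTop fun m => approxRay κ m s τ

namespace InTail

variable {κ : ℂ} {s : Address} {τ : ℝ}

theorem dist_approxRay_succ (hs : ExpBounded s) (h : InTail κ s τ) (m : ℕ) :
    dist (approxRay κ (m + 1) s τ) (approxRay κ (m + 1 + 1) s τ) ≤ 6 * (1 / 2) ^ m := by
  rw [dist_comm, dist_eq_norm]; exact h.norm_approxRay_succ_sub hs m

theorem tendsto_approxRay (hs : ExpBounded s) (h : InTail κ s τ) :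
    Tendsto (fun m => approxRay κ m s τ) atTop (𝓝 (tailRay κ s τ)) := by
  have hc := cauchySeq_of_le_geometric (1 / 2) 6 (by norm_num) (h.dist_approxRay_succ hs)
  obtain ⟨a, ha⟩ := cauchySeq_tendsto_of_complete hc
  have ha' : Tendsto (fun m => approxRay κ m s τ) atTop (𝓝 a) :=
    (tendsto_add_atTop_iff_nat 1).1 ha
  rwa [tailRay, ha'.limUnder_eq]

theorem dist_approxRay_tailRay (hs : ExpBounded s) (h : InTail κ s τ) (m : ℕ) :
    dist (approxRay κ (m + 1) s τ) (tailRay κ s τ) ≤ 12 * (1 / 2) ^ m := by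
  have := dist_le_of_le_geometric_of_tendsto (1 / 2) 6 (by norm_num) (h.dist_approxRay_succ hs)
    ((tendsto_add_atTop_iff_nat 1).2 (h.tendsto_approxRay hs)) m
  refine this.trans (le_of_eq ?_)
  ring

theorem norm_tailRay_shift_sub_exp (hs : ExpBounded s) (h : InTail κ s τ) :
    ‖tailRay κ (ExpRays.shift s) (F τ) - (Real.exp τ : ℝ)‖ ≤
      ‖κ‖ + 3 + 2 * Real.pi * |(s 1 : ℝ)| :=
  le_of_tendsto (((h.shift hs).tendsto_approxRay hs.shift).sub_const _).norm
    (Eventually.of_forall fun m => (h.approxRay_estimates hs m).1)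

theorem norm_tailRay_shift_sub_exp_le (hs : ExpBounded s) (h : InTail κ s τ) :
    ‖tailRay κ (ExpRays.shift s) (F τ) - (Real.exp τ : ℝ)‖ ≤ 3 / 4 * Real.exp τ :=
  (h.norm_tailRay_shift_sub_exp hs).trans (h.coeff_le hs)

theorem re_tailRay_shift_pos (hs : ExpBounded s) (h : InTail κ s τ) :
    0 < (tailRay κ (ExpRays.shift s) (F τ)).re := by
  have h1 := (abs_le.1 ((Complex.abs_re_le_norm _).trans (h.norm_tailRay_shift_sub_exp_le hs))).1
  rw [Complex.sub_re, Complex.ofReal_re] at h1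
  have := Real.exp_pos τ
  linarith

theorem tailRay_shift_ne_zero (hs : ExpBounded s) (h : InTail κ s τ) :
    tailRay κ (ExpRays.shift s) (F τ) ≠ 0 := fun h0 => by
  have := h.re_tailRay_shift_pos hs
  simp [h0] at this

theorem tailRay_eq (hs : ExpBounded s) (h : InTail κ s τ) :
    tailRay κ s τ = Complex.log (tailRay κ (ExpRays.shift s) (F τ)) - κ +
      2 * (Real.pi : ℂ) * Complex.I * (s 0 : ℂ) := by
  have h1 := (tendsto_add_atTop_iff_nat 1).2 (h.tendsto_approxRay hs)
  refine tendsto_nhds_unique h1 ?_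
  have h2 := ((h.shift hs).tendsto_approxRay hs.shift).clog (Or.inl (h.re_tailRay_shift_pos hs))
  exact (h2.sub_const κ).add_const _

theorem E_tailRay (hs : ExpBounded s) (h : InTail κ s τ) :
    E κ (tailRay κ s τ) = tailRay κ (ExpRays.shift s) (F τ) := by
  have h1 : tailRay κ s τ + κ = Complex.log (tailRay κ (ExpRays.shift s) (F τ)) +
      (s 0 : ℂ) * (2 * Real.pi * Complex.I) := by
    rw [h.tailRay_eq hs]; ring
  rw [E, h1, Complex.exp_add, Complex.exp_int_mul_two_pi_mul_I, mul_one,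
    Complex.exp_log (h.tailRay_shift_ne_zero hs)]

theorem norm_tailRay_sub_le_two (hs : ExpBounded s) (h : InTail κ s τ) :
    ‖tailRay κ s τ - (τ - κ + 2 * (Real.pi : ℂ) * Complex.I * (s 0 : ℂ))‖ ≤ 2 := by
  rw [h.tailRay_eq hs]
  convert norm_log_sub_le_two (h.norm_tailRay_shift_sub_exp_le hs) using 2; ring

theorem norm_tailRay_sub_le (hs : ExpBounded s) (h : InTail κ s τ)
    (hb : ‖κ‖ + 3 + 2 * Real.pi * |(s 1 : ℝ)| ≤ 1 / 2 * Real.exp τ) :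
    ‖tailRay κ s τ - (τ - κ + 2 * (Real.pi : ℂ) * Complex.I * (s 0 : ℂ))‖ ≤
      3 / 2 * ((‖κ‖ + 3 + 2 * Real.pi * |(s 1 : ℝ)|) * Real.exp (-τ)) := by
  rw [h.tailRay_eq hs]
  convert norm_log_sub_le (h.norm_tailRay_shift_sub_exp hs) hb using 2; ring

/-- The next point lies in the right half-plane, so its principal argument is below `π / 2` in
modulus. Thus the imaginary part on a tail reveals the first entry of the address. -/
theorem abs_im_tailRay_sub_lt (hs : ExpBounded s) (h : InTail κ s τ) :
    |(tailRay κ s τ + κ).im - 2 * Real.pi * s 0| < Real.pi / 2 := by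
  have h1 : (tailRay κ s τ + κ).im - 2 * Real.pi * s 0 =
      (tailRay κ (ExpRays.shift s) (F τ)).arg := by
    rw [h.tailRay_eq hs]
    simp [Complex.log_im]
    ring
  rw [h1]
  exact Complex.abs_arg_lt_pi_div_two_iff.2 (Or.inl (h.re_tailRay_shift_pos hs))

theorem E_iterate_tailRay (hs : ExpBounded s) (h : InTail κ s τ) (n : ℕ) :
    (E κ)^[n] (tailRay κ s τ) = tailRay κ (ExpRays.shift^[n] s) (F^[n] τ) := by
  induction n with
  | zero => simp
  | succ n ih =>
    rw [Function.iterate_succ_apply', ih, (h.iterate hs n).E_tailRay (hs.iterate n),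
      Function.iterate_succ_apply', Function.iterate_succ_apply']

end InTail

theorem continuousAt_approxRay {s : Address} (hs : ExpBounded s) {p : ℂ × ℝ}
    (h : InTail p.1 s p.2) (m : ℕ) :
    ContinuousAt (fun p : ℂ × ℝ => approxRay p.1 m s p.2) p := by
  induction m generalizing s p with
  | zero => simp only [approxRay]; fun_prop
  | succ m ih =>
    simp only [approxRay, L]
    have h1 : ContinuousAt (fun p : ℂ × ℝ => approxRay p.1 m (shift s) (F p.2)) p :=
      ContinuousAt.comp (f := fun p : ℂ × ℝ => (p.1, F p.2)) (ih hs.shift (p := (p.1, F p.2))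
        (h.shift hs)) (by
          have := continuous_F
          fun_prop)
    have h2 := h1.clog (Or.inl (h.re_approxRay_pos hs m))
    exact (h2.sub continuousAt_fst).add continuousAt_const

theorem differentiableAt_approxRay {s : Address} (hs : ExpBounded s) {κ : ℂ} {τ : ℝ}
    (h : InTail κ s τ) (m : ℕ) : DifferentiableAt ℂ (fun κ => approxRay κ m s τ) κ := by
  induction m generalizing s τ with
  | zero => simp only [approxRay]; fun_prop
  | succ m ih =>
    simp only [approxRay, L]
    have h2 := (ih hs.shift (h.shift hs)).clog (Or.inl (h.re_approxRay_pos hs m))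
    exact (h2.sub differentiableAt_id).add (differentiableAt_const _)

theorem tendstoUniformlyOn_approxRay {s : Address} (hs : ExpBounded s) :
    TendstoUniformlyOn (fun (m : ℕ) (p : ℂ × ℝ) => approxRay p.1 (m + 1) s p.2)
      (fun p => tailRay p.1 s p.2) atTop {p : ℂ × ℝ | InTail p.1 s p.2} := by
  rw [Metric.tendstoUniformlyOn_iff]
  intro ε hε
  have h1 : Tendsto (fun m : ℕ => (12 : ℝ) * (1 / 2) ^ m) atTop (𝓝 (12 * 0)) :=
    (tendsto_pow_atTop_nhds_zero_of_lt_one (by norm_num) (by norm_num)).const_mul _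
  rw [mul_zero] at h1
  filter_upwards [h1.eventually_lt_const hε] with m hm p hp
  rw [dist_comm]
  exact (InTail.dist_approxRay_tailRay hs hp m).trans_lt hm

theorem continuousOn_tailRay {s : Address} (hs : ExpBounded s) :
    ContinuousOn (fun p : ℂ × ℝ => tailRay p.1 s p.2) {p : ℂ × ℝ | InTail p.1 s p.2} :=
  (tendstoUniformlyOn_approxRay hs).continuousOn (Frequently.of_forall fun _ _ hp =>
    (continuousAt_approxRay hs hp _).continuousWithinAt)

theorem InTail.continuousAt_tailRay {s : Address} (hs : ExpBounded s) {κ : ℂ} {τ : ℝ}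
    (h : InTail κ s τ) : ContinuousAt (fun p : ℂ × ℝ => tailRay p.1 s p.2) (κ, τ) :=
  (continuousOn_tailRay hs).continuousAt ((isOpen_setOf_inTail s).mem_nhds h)

theorem isOpen_setOf_inTail_left (s : Address) (τ : ℝ) : IsOpen {κ : ℂ | InTail κ s τ} :=
  (isOpen_setOf_inTail s).preimage (by fun_prop : Continuous fun κ : ℂ => (κ, τ))

theorem differentiableOn_tailRay {s : Address} (hs : ExpBounded s) (τ : ℝ) :
    DifferentiableOn ℂ (fun κ => tailRay κ s τ) {κ : ℂ | InTail κ s τ} := by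
  have h1 : TendstoUniformlyOn (fun (m : ℕ) (κ : ℂ) => approxRay κ (m + 1) s τ)
      (fun κ => tailRay κ s τ) atTop {κ : ℂ | InTail κ s τ} :=
    (tendstoUniformlyOn_approxRay hs).comp (fun κ : ℂ => (κ, τ))
  refine h1.tendstoLocallyUniformlyOn.differentiableOn (Eventually.of_forall fun m κ hκ =>
    (differentiableAt_approxRay hs hκ _).differentiableWithinAt) (isOpen_setOf_inTail_left s τ)

/-! ### Uniqueness of lifts and of dynamic rays -/

theorem continuous_E (κ : ℂ) : Continuous (E κ) := by unfold E; fun_prop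

theorem eqOn_of_E_eqOn {κ : ℂ} {S : Set ℝ} (hS : IsPreconnected S) {a b : ℝ → ℂ}
    (ha : ContinuousOn a S) (hb : ContinuousOn b S) (h : ∀ x ∈ S, E κ (a x) = E κ (b x))
    {x₀ : ℝ} (hx₀ : x₀ ∈ S) (h₀ : a x₀ = b x₀) : EqOn a b S := by
  have := Complex.isCoveringMap_exp.eqOn_of_comp_eqOn hS (ha.add continuousOn_const)
    (hb.add (continuousOn_const (c := κ))) (fun x hx => Subtype.ext (h x hx)) hx₀
    (by simpa using h₀)
  intro x hx
  simpa using this hx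

theorem eqOn_of_iterate_E_eqOn {κ : ℂ} {S : Set ℝ} (hS : IsPreconnected S) {a b : ℝ → ℂ} (n : ℕ)
    (ha : ContinuousOn a S) (hb : ContinuousOn b S)
    (h : ∀ x ∈ S, (E κ)^[n] (a x) = (E κ)^[n] (b x))
    {x₀ : ℝ} (hx₀ : x₀ ∈ S) (h₀ : a x₀ = b x₀) : EqOn a b S := by
  induction n generalizing a b with
  | zero => exact h
  | succ n ih =>
    refine eqOn_of_E_eqOn (κ := κ) hS ha hb ?_ hx₀ h₀
    exact ih (a := fun x => E κ (a x)) (b := fun x => E κ (b x))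
      ((continuous_E κ).comp_continuousOn ha) ((continuous_E κ).comp_continuousOn hb) h
      (congrArg (E κ) h₀)

theorem continuous_tailPotential (s : Address) : Continuous fun κ : ℂ => tailPotential κ s := by
  unfold tailPotential
  have : ∀ κ : ℂ, ‖κ‖ + 3 ≠ 0 := fun κ => by have := norm_nonneg κ; positivity
  fun_prop (disch := assumption)

theorem tailPotential_le_of_norm_le {κ : ℂ} {R : ℝ} (h : ‖κ‖ ≤ R) (s : Address) :
    tailPotential κ s ≤ supPotential s + 2 * Real.log (R + 3) := by
  have := norm_nonneg κ
  unfold tailPotential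
  gcongr

theorem log_norm_add_three_pos (κ : ℂ) : 0 < Real.log (‖κ‖ + 3) :=
  Real.log_pos (by have := norm_nonneg κ; linarith)

theorem tailPotential_shift_le {s : Address} (hs : ExpBounded s) {κ : ℂ} {τ : ℝ}
    (h : tailPotential κ s ≤ τ) : tailPotential κ (shift s) ≤ F τ := by
  have h1 := hs.supPotential_shift_le
  have h2 := log_norm_add_three_pos κ
  have h3 := supPotential_nonneg s
  have h4 := F_sub_ge (a := supPotential s) (b := tailPotential κ s) (by
    unfold tailPotential; linarith)
  have h5 := F_strictMono.monotone h
  have h6 : tailPotential κ s - supPotential s = 2 * Real.log (‖κ‖ + 3) := by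
    unfold tailPotential; ring
  rw [h6] at h4
  have h7 : tailPotential κ (shift s) = supPotential (shift s) + 2 * Real.log (‖κ‖ + 3) := rfl
  nlinarith

theorem tailPotential_iterate_le {s : Address} (hs : ExpBounded s) {κ : ℂ} {τ : ℝ}
    (h : tailPotential κ s ≤ τ) (n : ℕ) : tailPotential κ (shift^[n] s) ≤ F^[n] τ := by
  induction n with
  | zero => simpa
  | succ n ih =>
    rw [Function.iterate_succ_apply', Function.iterate_succ_apply']
    exact tailPotential_shift_le (hs.iterate n) ih

theorem continuousOn_tailRay_right {s : Address} (hs : ExpBounded s) (κ : ℂ) :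
    ContinuousOn (tailRay κ s) (Ici (tailPotential κ s)) :=
  (continuousOn_tailRay hs).comp (f := fun τ : ℝ => (κ, τ)) (by fun_prop)
    fun _ hτ => inTail_of_tailPotential_le hτ

theorem Admissible.exists_tailPotential_le {s : Address} {t : ℝ} (h : Admissible s t) (R : ℝ) :
    ∃ N : ℕ, ∀ n ≥ N, ∀ t' ≥ t, ∀ κ : ℂ, ‖κ‖ ≤ R →
      tailPotential κ (ExpRays.shift^[n] s) < F^[n] t' := by
  obtain ⟨N, hN⟩ := h.eventually_supPotential_add_le (2 * Real.log (R + 3) + 1)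
  refine ⟨N, fun n hn t' ht' κ hκ => ?_⟩
  have h1 := tailPotential_le_of_norm_le hκ (ExpRays.shift^[n] s)
  have h2 := hN n hn t' ht'
  linarith

namespace IsRayPiece

variable {κ : ℂ} {s : Address} {t : ℝ} {γ γ' : ℝ → ℂ}

theorem mono (h : IsRayPiece κ s t γ) {t' : ℝ} (ht : t ≤ t') : IsRayPiece κ s t' γ :=
  ⟨h.1.mono (Ici_subset_Ici.2 ht), fun n τ hτ => h.2 n τ (ht.trans hτ)⟩

theorem iterate_E_eq (h : IsRayPiece κ s t γ) (hs : ExpBounded s) {n : ℕ} {τ : ℝ} (hτ : t ≤ τ)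
    (hn : tailPotential κ (shift^[n] s) ≤ F^[n] τ) :
    (E κ)^[n] (γ τ) = tailRay κ (shift^[n] s) (F^[n] τ) :=
  tendsto_nhds_unique (h.2 n τ hτ hn)
    ((inTail_of_tailPotential_le hn).tendsto_approxRay (hs.iterate n))

theorem eq_tailRay (h : IsRayPiece κ s t γ) (hs : ExpBounded s) {τ : ℝ} (hτ : t ≤ τ)
    (hn : tailPotential κ s ≤ τ) : γ τ = tailRay κ s τ :=
  h.iterate_E_eq hs (n := 0) hτ hn

theorem eqOn (h : IsRayPiece κ s t γ) (h' : IsRayPiece κ s t γ') (ha : Admissible s t) :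
    EqOn γ γ' (Ici t) := by
  obtain ⟨N, hN⟩ := ha.exists_tailPotential_le ‖κ‖
  have hτ : t ≤ max t (tailPotential κ s) := le_max_left _ _
  refine eqOn_of_iterate_E_eqOn (κ := κ) isPreconnected_Ici N h.1 h'.1 (fun x hx => ?_) hτ ?_
  · have := (hN N le_rfl x hx κ le_rfl).le
    rw [h.iterate_E_eq ha.1 hx this, h'.iterate_E_eq ha.1 hx this]
  · rw [h.eq_tailRay ha.1 hτ (le_max_right _ _), h'.eq_tailRay ha.1 hτ (le_max_right _ _)]

/-- `dynamicRay` chooses a curve separately for every potential. Uniqueness of pieces makes all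
these choices compatible. -/
theorem dynamicRay_eq (h : IsRayPiece κ s t γ) (ha : Admissible s t) {τ : ℝ} (hτ : t ≤ τ) :
    dynamicRay κ s τ = γ τ := by
  have hex : ∃ γ : ℝ → ℂ, IsRayPiece κ s τ γ := ⟨γ, h.mono hτ⟩
  rw [dynamicRay, dif_pos hex]
  exact hex.choose_spec.eqOn (h.mono hτ) (ha.mono hτ) self_mem_Ici

theorem shift (h : IsRayPiece κ s t γ) (ht : 0 < t) :
    IsRayPiece κ (ExpRays.shift s) (F t) fun τ => E κ (γ (Finv τ)) := by
  have hF : ∀ τ, F t ≤ τ → F (Finv τ) = τ := fun τ hτ =>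
    F_Finv (by have := F_pos ht; linarith)
  have hle : ∀ τ, F t ≤ τ → t ≤ Finv τ := fun τ hτ => by
    rwa [← F_strictMono.le_iff_le, hF τ hτ]
  refine ⟨(continuous_E κ).comp_continuousOn (h.1.comp ?_ fun τ hτ => hle τ hτ), ?_⟩
  · unfold Finv
    refine ContinuousOn.log (by fun_prop) fun τ hτ => ?_
    have := F_pos ht
    have : F t ≤ τ := hτ
    linarith
  · intro n τ hτ hn
    have h1 := h.2 (n + 1) (Finv τ) (hle τ hτ)
    rw [Function.iterate_succ_apply, Function.iterate_succ_apply, hF τ hτ] at h1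
    exact h1 hn

/-- A lift through `E_κ` of a piece of the ray at address `σ s` which is normalized at one point of
the ray tail is a piece of the ray at address `s`. -/
theorem of_shift (hs : ExpBounded s) {h : ℝ → ℂ} (hh : IsRayPiece κ (ExpRays.shift s) (F t) h)
    (hγ : ContinuousOn γ (Ici t)) (hE : ∀ τ, t ≤ τ → E κ (γ τ) = h (F τ)) {τ₀ : ℝ} (ht₀ : t ≤ τ₀)
    (hτ₀ : tailPotential κ s ≤ τ₀) (h₀ : γ τ₀ = tailRay κ s τ₀) : IsRayPiece κ s t γ := by
  refine ⟨hγ, fun n τ hτ hn => ?_⟩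
  cases n with
  | zero =>
    have h1 : EqOn γ (tailRay κ s) (Ici (max t (tailPotential κ s))) := by
      refine eqOn_of_E_eqOn (κ := κ) isPreconnected_Ici
        (hγ.mono (Ici_subset_Ici.2 (le_max_left _ _)))
        ((continuousOn_tailRay_right hs κ).mono (Ici_subset_Ici.2 (le_max_right _ _)))
        (fun x hx => ?_) (max_le ht₀ hτ₀) h₀
      have hx1 : t ≤ x := (le_max_left _ _).trans hx
      have hx2 : tailPotential κ s ≤ x := (le_max_right _ _).trans hx
      rw [hE x hx1, (inTail_of_tailPotential_le hx2).E_tailRay hs,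
        hh.eq_tailRay hs.shift (F_strictMono.monotone hx1) (tailPotential_shift_le hs hx2)]
    have h2 : γ τ = tailRay κ s τ := h1 (max_le hτ hn)
    simp only [Function.iterate_zero, id_eq] at hn ⊢
    rw [h2]
    exact (inTail_of_tailPotential_le hn).tendsto_approxRay hs
  | succ n =>
    rw [Function.iterate_succ_apply, Function.iterate_succ_apply] at hn
    rw [Function.iterate_succ_apply, Function.iterate_succ_apply, Function.iterate_succ_apply,
      hE τ hτ]
    exact hh.2 n (F τ) (F_strictMono.monotone hτ) hn

theorem of_tail (hs : ExpBounded s) (h : tailPotential κ s ≤ t) :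
    IsRayPiece κ s t (tailRay κ s) := by
  refine ⟨(continuousOn_tailRay_right hs κ).mono (Ici_subset_Ici.2 h), fun n τ hτ hn => ?_⟩
  rw [(inTail_of_tailPotential_le (h.trans hτ)).E_iterate_tailRay hs]
  exact (inTail_of_tailPotential_le hn).tendsto_approxRay (hs.iterate n)

end IsRayPiece

theorem isRayRoot_iff {s : Address} {t : ℝ} {κ : ℂ} (ha : Admissible s t) :
    IsRayRoot s t κ ↔ ∃ γ, IsRayPiece κ s t γ ∧ γ t = 0 := by
  constructor
  · rintro ⟨⟨γ, hγ⟩, h⟩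
    exact ⟨γ, hγ, by rwa [hγ.dynamicRay_eq ha le_rfl] at h⟩
  · rintro ⟨γ, hγ, h⟩
    exact ⟨⟨γ, hγ⟩, by rwa [hγ.dynamicRay_eq ha le_rfl]⟩

theorem IsRayRoot.iterate_E_zero {s : Address} {t : ℝ} {κ : ℂ} (h : IsRayRoot s t κ)
    (ha : Admissible s t) {n : ℕ} (hn : tailPotential κ (shift^[n] s) ≤ F^[n] t) :
    (E κ)^[n] 0 = tailRay κ (shift^[n] s) (F^[n] t) := by
  obtain ⟨γ, hγ, h0⟩ := (isRayRoot_iff ha).1 h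
  rw [← h0]
  exact hγ.iterate_E_eq ha.1 le_rfl hn

/-! ### Dynamic rays depend continuously on the potential and holomorphically on `κ` -/

/-- The two arguments lie in `(-π/2, π/2)`, so their difference lies in `(-π, π)` and no multiple of
`2πi` intervenes. -/
theorem div_mem_slitPlane {a b : ℂ} (ha : 0 < a.re) (hb : 0 < b.re) :
    a / b ∈ Complex.slitPlane ∧ Complex.log (a / b) = Complex.log a - Complex.log b := by
  have ha0 : a ≠ 0 := fun h => by simp [h] at ha
  have hb0 : b ≠ 0 := fun h => by simp [h] at hb
  have h1 := abs_lt.1 (Complex.abs_arg_lt_pi_div_two_iff.2 (Or.inl ha))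
  have h2 := abs_lt.1 (Complex.abs_arg_lt_pi_div_two_iff.2 (Or.inl hb))
  have h3 : Complex.log (a / b) = Complex.log a - Complex.log b := by
    have : a / b = Complex.exp (Complex.log a - Complex.log b) := by
      rw [Complex.exp_sub, Complex.exp_log ha0, Complex.exp_log hb0]
    rw [this, Complex.log_exp] <;> simp only [Complex.sub_im, Complex.log_im] <;> linarith
  refine ⟨Complex.mem_slitPlane_iff_arg.2 ⟨?_, div_ne_zero ha0 hb0⟩, h3⟩
  rw [← Complex.log_im, h3, Complex.sub_im, Complex.log_im, Complex.log_im]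
  intro h; linarith

/-- There are pieces of the rays of `E_κ` at address `s` for the parameters in a neighborhood of
`κ₀` and the potentials in a neighborhood of `[t₀, ∞)` which depend continuously on both, and
holomorphically on the parameter. -/
def HasLocalFamily (s : Address) (t₀ : ℝ) (κ₀ : ℂ) : Prop :=
  ∃ ε > 0, ∃ g : ℂ → ℝ → ℂ,
    ContinuousOn (fun p : ℂ × ℝ => g p.1 p.2) (Metric.ball κ₀ ε ×ˢ Ici (t₀ - ε)) ∧
    (∀ τ ≥ t₀ - ε, DifferentiableOn ℂ (fun κ => g κ τ) (Metric.ball κ₀ ε)) ∧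
    ∀ κ ∈ Metric.ball κ₀ ε, IsRayPiece κ s (t₀ - ε) (g κ)

theorem hasLocalFamily_of_tail {s : Address} (hs : ExpBounded s) {t₀ : ℝ} {κ₀ : ℂ}
    (h : tailPotential κ₀ s < t₀) : HasLocalFamily s t₀ κ₀ := by
  have h1 : ∀ᶠ ε in 𝓝[>] (0 : ℝ), ∀ κ ∈ Metric.ball κ₀ ε, tailPotential κ s < t₀ - ε := by
    have : ∀ᶠ p : ℂ × ℝ in 𝓝 (κ₀, 0), tailPotential p.1 s < t₀ - p.2 := by
      refine ContinuousAt.eventually_lt ?_ (by fun_prop) (by simpa)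
      exact ((continuous_tailPotential s).comp continuous_fst).continuousAt
    obtain ⟨δ, hδ, hδ'⟩ := Metric.eventually_nhds_iff_ball.1 this
    filter_upwards [Ioo_mem_nhdsGT hδ] with ε hε κ hκ
    refine hδ' (κ, ε) ?_
    rw [Metric.mem_ball, Prod.dist_eq, max_lt_iff]
    refine ⟨hκ.trans hε.2, ?_⟩
    simp [abs_of_pos hε.1, hε.2]
  obtain ⟨ε, hε, hε0⟩ := (h1.and self_mem_nhdsWithin).exists
  refine ⟨ε, hε0, fun κ => tailRay κ s, ?_, fun τ hτ => ?_, fun κ hκ => ?_⟩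
  · exact (continuousOn_tailRay hs).mono fun p hp =>
      inTail_of_tailPotential_le ((hε p.1 hp.1).le.trans hp.2)
  · exact (differentiableOn_tailRay hs τ).mono fun κ hκ =>
      inTail_of_tailPotential_le ((hε κ hκ).le.trans hτ)
  · exact IsRayPiece.of_tail hs (hε κ hκ).le

theorem HasLocalFamily.of_shift {s : Address} {t₀ : ℝ} {κ₀ : ℂ} (ha : Admissible s t₀)
    (hκ₀ : κ₀ ∈ rayDomain s t₀) (hl : HasLocalFamily (shift s) (F t₀) κ₀) :
    HasLocalFamily s t₀ κ₀ := by
  obtain ⟨γ, hγ⟩ := hκ₀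
  obtain ⟨ε₁, hε₁, h, hc, hd, hp⟩ := hl
  have hs := ha.1
  -- Beyond `t₂` the rays of all parameters within `1` of `κ₀` are given by their tails, so only the
  -- compact interval `[t₀, t₂]` and a little to its left need an argument.
  set t₂ := max (t₀ + 1) (supPotential s + 2 * Real.log (‖κ₀‖ + 1 + 3)) with ht₂
  have ht₂' : t₀ + 1 ≤ t₂ := le_max_left _ _
  have htail : ∀ κ ∈ Metric.ball κ₀ 1, tailPotential κ s ≤ t₂ := by
    intro κ hκ
    refine (tailPotential_le_of_norm_le (R := ‖κ₀‖ + 1) ?_ s).trans (le_max_right _ _)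
    rw [mem_ball_iff_norm] at hκ
    have := norm_le_norm_add_norm_sub' κ κ₀
    linarith
  have hF : ∀ᶠ τ in 𝓝 t₀, F t₀ - ε₁ < F τ :=
    continuous_F.continuousAt.eventually_const_lt (by linarith)
  obtain ⟨δ₁, hδ₁, hFδ⟩ := Metric.eventually_nhds_iff_ball.1 hF
  have hFge : ∀ τ, t₀ - δ₁ < τ → F t₀ - ε₁ < F τ := by
    intro τ hτ
    rcases le_total t₀ τ with h1 | h1
    · have := F_strictMono.monotone h1; linarith
    · refine hFδ τ ?_
      rw [Metric.mem_ball, Real.dist_eq, abs_lt]; constructor <;> linarith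
  have hbase : ∀ τ ≥ t₀, h κ₀ (F τ) = E κ₀ (γ τ) := by
    intro τ hτ
    have := ((hp κ₀ (Metric.mem_ball_self hε₁)).mono (by linarith)).eqOn (hγ.shift ha.pos) ha.shift
      (F_strictMono.monotone hτ)
    simpa [Finv_F] using this
  have hbase0 : ∀ τ ≥ t₀, h κ₀ (F τ) ≠ 0 := fun τ hτ => by
    rw [hbase τ hτ]; exact Complex.exp_ne_zero _
  have hcH : ∀ κ ∈ Metric.ball κ₀ ε₁, ∀ τ, t₀ - δ₁ < τ →
      ContinuousAt (fun p : ℂ × ℝ => h p.1 (F p.2)) (κ, τ) := by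
    intro κ hκ τ hτ
    have h1 : ContinuousAt (fun p : ℂ × ℝ => h p.1 p.2) (κ, F τ) := by
      refine hc.continuousAt (prod_mem_nhds (Metric.isOpen_ball.mem_nhds hκ) ?_)
      exact Ici_mem_nhds (hFge τ hτ)
    exact ContinuousAt.comp (f := fun p : ℂ × ℝ => (p.1, F p.2)) (x := (κ, τ)) h1 (by
      have := continuous_F
      fun_prop)
  have hcD : ∀ p : ℂ × ℝ, ContinuousAt (fun p : ℂ × ℝ => h κ₀ (F (max p.2 t₀))) p := by
    intro p
    exact ContinuousAt.comp (f := fun p : ℂ × ℝ => (κ₀, max p.2 t₀)) (x := p)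
      (hcH κ₀ (Metric.mem_ball_self hε₁) (max p.2 t₀) (by
        have := le_max_right p.2 t₀; linarith)) (by fun_prop)
  -- The lift for `κ` will be `γ + log Q - (κ - κ₀)`, with the principal logarithm, since `Q` will
  -- be close to `1` or a quotient of points of the right half-plane. As `γ` is a piece only on
  -- `[t₀, ∞)`, the reference curve is frozen to the left of `t₀`.
  set Q : ℂ → ℝ → ℂ := fun κ τ => h κ (F τ) / h κ₀ (F (max τ t₀)) with hQ
  have hcQ : ∀ κ ∈ Metric.ball κ₀ ε₁, ∀ τ, t₀ - δ₁ < τ →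
      ContinuousAt (fun p : ℂ × ℝ => Q p.1 p.2) (κ, τ) := fun κ hκ τ hτ =>
    (hcH κ hκ τ hτ).div (hcD _) (hbase0 _ (le_max_right _ _))
  have hQ1 : ∀ τ ≥ t₀, ∀ᶠ p : ℂ × ℝ in 𝓝 (κ₀, τ), Q p.1 p.2 ∈ Complex.slitPlane := by
    intro τ hτ
    have h1 := hcQ κ₀ (Metric.mem_ball_self hε₁) τ (by linarith)
    refine h1.eventually (Complex.isOpen_slitPlane.mem_nhds ?_)
    simp only [hQ, max_eq_left hτ]
    rw [div_self (hbase0 τ hτ)]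
    exact Complex.one_mem_slitPlane
  have hQ2 : ∀ᶠ κ in 𝓝 κ₀, ∀ τ ∈ Icc t₀ t₂, Q κ τ ∈ Complex.slitPlane :=
    isCompact_Icc.eventually_forall_of_forall_eventually fun τ hτ => hQ1 τ hτ.1
  obtain ⟨δ₂, hδ₂, hQδ⟩ := Metric.eventually_nhds_iff_ball.1 (hQ1 t₀ le_rfl)
  obtain ⟨δ₃, hδ₃, hQδ'⟩ := Metric.eventually_nhds_iff_ball.1 hQ2
  set ε := min (min (min ε₁ 1) (δ₁ / 2)) (min (δ₂ / 2) δ₃) with hε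
  have e1 : ε ≤ ε₁ := (min_le_left _ _).trans ((min_le_left _ _).trans (min_le_left _ _))
  have e2 : ε ≤ 1 := (min_le_left _ _).trans ((min_le_left _ _).trans (min_le_right _ _))
  have e3 : ε ≤ δ₁ / 2 := (min_le_left _ _).trans (min_le_right _ _)
  have e4 : ε ≤ δ₂ / 2 := (min_le_right _ _).trans (min_le_left _ _)
  have e5 : ε ≤ δ₃ := (min_le_right _ _).trans (min_le_right _ _)
  have e0 : 0 < ε := by simp only [hε, lt_min_iff]; refine ⟨⟨⟨?_, ?_⟩, ?_⟩, ?_, ?_⟩ <;> linarith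
  have hpos : ∀ κ ∈ Metric.ball κ₀ ε, ∀ τ ≥ t₂, h κ (F τ) = tailRay κ (shift s) (F τ) ∧
      0 < (h κ (F τ)).re := by
    intro κ hκ τ hτ
    have h1 := (htail κ (Metric.ball_subset_ball e2 hκ)).trans hτ
    have h2 := (hp κ (Metric.ball_subset_ball e1 hκ)).eq_tailRay hs.shift
      (τ := F τ) (hFge τ (by linarith)).le (tailPotential_shift_le hs h1)
    exact ⟨h2, h2 ▸ (inTail_of_tailPotential_le h1).re_tailRay_shift_pos hs⟩
  have hslit : ∀ κ ∈ Metric.ball κ₀ ε, ∀ τ ≥ t₀ - ε, Q κ τ ∈ Complex.slitPlane := by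
    intro κ hκ τ hτ
    rcases le_total τ t₀ with h1 | h1
    · refine hQδ (κ, τ) ?_
      rw [Metric.mem_ball, Prod.dist_eq, max_lt_iff]
      refine ⟨lt_of_lt_of_le hκ (by linarith), ?_⟩
      rw [Real.dist_eq, abs_lt]; constructor <;> linarith
    · rcases le_total τ t₂ with h2 | h2
      · exact hQδ' κ (Metric.ball_subset_ball e5 hκ) τ ⟨h1, h2⟩
      · simp only [hQ, max_eq_left h1]
        exact (div_mem_slitPlane (hpos κ hκ τ h2).2
          (hpos κ₀ (Metric.mem_ball_self e0) τ h2).2).1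
  have hcγ : Continuous fun τ : ℝ => γ (max τ t₀) := by
    refine hγ.1.comp_continuous (by fun_prop) fun τ => mem_Ici.2 (le_max_right _ _)
  have hgc : ContinuousOn (fun p : ℂ × ℝ => γ (max p.2 t₀) + Complex.log (Q p.1 p.2) - (p.1 - κ₀))
      (Metric.ball κ₀ ε ×ˢ Ici (t₀ - ε)) := by
    intro p hpm
    refine ContinuousAt.continuousWithinAt ?_
    have h1 := hcQ p.1 (Metric.ball_subset_ball e1 hpm.1) p.2 (by
      have : t₀ - ε ≤ p.2 := hpm.2
      linarith)
    have h2 := h1.clog (hslit p.1 hpm.1 p.2 hpm.2)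
    exact (((hcγ.comp continuous_snd).continuousAt).add h2).sub (by fun_prop)
  refine ⟨ε, e0, fun κ τ => γ (max τ t₀) + Complex.log (Q κ τ) - (κ - κ₀), hgc,
    fun τ hτ => ?_, fun κ hκ => ?_⟩
  · have h1 : DifferentiableOn ℂ (fun κ => Q κ τ) (Metric.ball κ₀ ε) :=
      ((hd (F τ) (hFge τ (by linarith)).le).mono (Metric.ball_subset_ball e1)).div_const _
    exact ((h1.clog fun κ hκ => hslit κ hκ τ hτ).const_add _).sub (by fun_prop)
  · have htt : t₀ - ε ≤ t₂ := by linarith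
    refine IsRayPiece.of_shift hs (h := h κ) ((hp κ (Metric.ball_subset_ball e1 hκ)).mono
      (hFge _ (by linarith)).le) ?_ ?_ (τ₀ := t₂) htt (htail κ (Metric.ball_subset_ball e2 hκ)) ?_
    · exact hgc.comp (f := fun τ : ℝ => (κ, τ)) (by fun_prop) fun τ hτ => ⟨hκ, hτ⟩
    · intro τ hτ
      have h1 : γ (max τ t₀) + Complex.log (Q κ τ) - (κ - κ₀) + κ =
        (γ (max τ t₀) + κ₀) + Complex.log (Q κ τ) := by ring
      have h2 := hbase (max τ t₀) (le_max_right _ _)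
      rw [E, h1, Complex.exp_add, Complex.exp_log
        (Complex.slitPlane_ne_zero (hslit κ hκ τ hτ)), ← E, ← h2]
      simp only [hQ]
      exact mul_div_cancel₀ _ (hbase0 _ (le_max_right _ _))
    · have h0 := hpos κ₀ (Metric.mem_ball_self e0) t₂ le_rfl
      have h1 := hpos κ hκ t₂ le_rfl
      have h2 := htail κ₀ (Metric.mem_ball_self one_pos)
      have h3 := htail κ (Metric.ball_subset_ball e2 hκ)
      have h4 : max t₂ t₀ = t₂ := max_eq_left (by linarith)
      simp only [hQ, h4]
      rw [(div_mem_slitPlane h1.2 h0.2).2, h1.1, h0.1,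
        hγ.eq_tailRay hs (by linarith) h2, (inTail_of_tailPotential_le h2).tailRay_eq hs,
        (inTail_of_tailPotential_le h3).tailRay_eq hs]
      ring

/-- Induction on the number of shifts after which the potential lies on the tail, where the family
is explicit; each pull-back is `HasLocalFamily.of_shift`. -/
theorem hasLocalFamily {s : Address} {t₀ : ℝ} {κ₀ : ℂ} (ha : Admissible s t₀)
    (hκ₀ : κ₀ ∈ rayDomain s t₀) : HasLocalFamily s t₀ κ₀ := by
  obtain ⟨N, hN⟩ := ha.exists_tailPotential_le ‖κ₀‖
  replace hN := hN N le_rfl t₀ le_rfl κ₀ le_rfl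
  induction N generalizing s t₀ with
  | zero => exact hasLocalFamily_of_tail ha.1 hN
  | succ N ih =>
    refine HasLocalFamily.of_shift ha hκ₀ (ih ha.shift ?_ hN)
    obtain ⟨γ, hγ⟩ := hκ₀
    exact ⟨_, hγ.shift ha.pos⟩

theorem exists_ball_dynamicRay {s : Address} {t₀ : ℝ} {κ₀ : ℂ} (ha : Admissible s t₀)
    (hκ₀ : κ₀ ∈ rayDomain s t₀) : ∃ ε > 0, Admissible s (t₀ - ε) ∧
      (∀ κ ∈ Metric.ball κ₀ ε, ∀ τ ≥ t₀ - ε, κ ∈ rayDomain s τ) ∧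
      ContinuousOn (fun p : ℂ × ℝ => dynamicRay p.1 s p.2)
        (Metric.ball κ₀ ε ×ˢ Ici (t₀ - ε)) ∧
      ∀ τ ≥ t₀ - ε, DifferentiableOn ℂ (fun κ => dynamicRay κ s τ) (Metric.ball κ₀ ε) := by
  obtain ⟨t', ht', ha'⟩ := ha.exists_lt
  obtain ⟨ε, hε, g, hc, hd, hp⟩ := hasLocalFamily ha hκ₀
  have e1 : min ε (t₀ - t') ≤ ε := min_le_left _ _
  have e2 : min ε (t₀ - t') ≤ t₀ - t' := min_le_right _ _
  have ha2 : Admissible s (t₀ - min ε (t₀ - t')) := ha'.mono (by linarith)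
  have heq : ∀ κ ∈ Metric.ball κ₀ (min ε (t₀ - t')), ∀ τ ≥ t₀ - min ε (t₀ - t'),
      dynamicRay κ s τ = g κ τ := fun κ hκ τ hτ =>
    ((hp κ (Metric.ball_subset_ball e1 hκ)).mono (by linarith)).dynamicRay_eq ha2 hτ
  refine ⟨min ε (t₀ - t'), lt_min hε (by linarith), ha2, fun κ hκ τ hτ => ?_, ?_, fun τ hτ => ?_⟩
  · exact ⟨g κ, (hp κ (Metric.ball_subset_ball e1 hκ)).mono (by linarith)⟩
  · refine (hc.mono (prod_mono (Metric.ball_subset_ball e1) (Ici_subset_Ici.2 (by linarith)))).congr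
      fun p hpm => heq p.1 hpm.1 p.2 hpm.2
  · exact ((hd τ (by linarith)).mono (Metric.ball_subset_ball e1)).congr
      fun κ hκ => heq κ hκ τ hτ

/-! ### The set of roots is closed -/

theorem isSimplyConnected_univ_real : IsSimplyConnected (univ : Set ℝ) := by
  have := (convex_univ (𝕜 := ℝ) (E := ℝ)).contractibleSpace univ_nonempty
  unfold IsSimplyConnected
  infer_instance

/-- A curve avoiding `0` has a continuous logarithm. Compared with the tail at one point it is off
by a multiple of `2πi`, which is subtracted. -/
theorem mem_rayDomain_of_shift {s : Address} {t : ℝ} {κ : ℂ} (hs : ExpBounded s) {h : ℝ → ℂ}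
    (hh : IsRayPiece κ (shift s) (F t) h) (h0 : ∀ τ ≥ F t, h τ ≠ 0) : κ ∈ rayDomain s t := by
  have hc : Continuous fun τ : ℝ => h (F (max τ t)) :=
    hh.1.comp_continuous (by have := continuous_F; fun_prop) fun τ =>
      F_strictMono.monotone (le_max_right _ _)
  obtain ⟨l, hl, hle⟩ := Complex.exists_continuousOn_eqOn_exp_comp (U := (univ : Set ℝ))
    (X := ℝ) isSimplyConnected_univ_real isOpen_univ hc.continuousOn (by
      rintro ⟨τ, -, hτ⟩
      exact h0 _ (F_strictMono.monotone (le_max_right τ t)) hτ)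
  set τ₀ := max t (tailPotential κ s) with hτ₀
  have e1 : t ≤ τ₀ := le_max_left _ _
  have e2 : tailPotential κ s ≤ τ₀ := le_max_right _ _
  have h1 : ∀ τ ≥ t, Complex.exp (l τ) = h (F τ) := fun τ hτ => by
    have := hle (mem_univ τ)
    simpa [max_eq_left hτ] using this
  have h2 : Complex.exp (l τ₀) = Complex.exp (tailRay κ s τ₀ + κ) := by
    rw [h1 τ₀ e1, hh.eq_tailRay hs.shift (F_strictMono.monotone e1) (tailPotential_shift_le hs e2),
      ← (inTail_of_tailPotential_le e2).E_tailRay hs, E]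
  obtain ⟨n, hn⟩ := Complex.exp_eq_exp_iff_exists_int.1 h2
  refine ⟨fun τ => l τ - κ - n * (2 * Real.pi * Complex.I), IsRayPiece.of_shift hs hh ?_ ?_ e1 e2 ?_⟩
  · exact ((hl.mono (subset_univ _)).sub continuousOn_const).sub continuousOn_const
  · intro τ hτ
    rw [E, ← h1 τ hτ, show l τ - κ - n * (2 * Real.pi * Complex.I) + κ =
      l τ - n * (2 * Real.pi * Complex.I) by ring, Complex.exp_sub,
      Complex.exp_int_mul_two_pi_mul_I, div_one]
  · simp only [hn]; ring

/-- Pulling back from a tail level by level can fail only when a curve to be lifted runs through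
`0`, and then `κ` is a root for that shifted address. -/
theorem mem_rayDomain_or_exists_isRayRoot {s : Address} {t : ℝ} (ha : Admissible s t) (κ : ℂ) :
    κ ∈ rayDomain s t ∨ ∃ j : ℕ, ∃ τ ≥ F^[j + 1] t, IsRayRoot (shift^[j + 1] s) τ κ := by
  obtain ⟨N, hN⟩ := ha.exists_tailPotential_le ‖κ‖
  replace hN := hN N le_rfl t le_rfl κ le_rfl
  induction N generalizing s t with
  | zero => exact Or.inl ⟨_, IsRayPiece.of_tail ha.1 hN.le⟩
  | succ N ih =>
    rcases ih ha.shift hN with ⟨h, hh⟩ | ⟨j, τ, hτ, hr⟩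
    · by_cases h0 : ∀ τ ≥ F t, h τ ≠ 0
      · exact Or.inl (mem_rayDomain_of_shift ha.1 hh h0)
      · push Not at h0
        obtain ⟨τ, hτ, h0⟩ := h0
        exact Or.inr ⟨0, τ, hτ, (isRayRoot_iff (ha.shift.mono hτ)).2 ⟨h, hh.mono hτ, h0⟩⟩
    · exact Or.inr ⟨j + 1, τ, hτ, hr⟩

theorem continuous_iterate_E_zero (n : ℕ) : Continuous fun κ : ℂ => (E κ)^[n] 0 := by
  induction n with
  | zero => simpa using continuous_const
  | succ n ih =>
    simp only [Function.iterate_succ_apply']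
    unfold E at ih ⊢
    fun_prop

theorem lt_iterate_F_succ {t : ℝ} (ht : 0 < t) (n : ℕ) : t < F^[n + 1] t := by
  refine (le_iterate_F n t).trans_lt ?_
  rw [Function.iterate_succ_apply']
  have := Real.add_one_lt_exp (iterate_F_pos ht n).ne'
  unfold F at *
  linarith

/-- If the tails of two rays agree along an orbit, then the potentials agree, and from some point on
the addresses do. -/
theorem eq_of_tailRay_eq {κ : ℂ} {s s' : Address} {t t' : ℝ} (hs : ExpBounded s)
    (hs' : ExpBounded s') (ht : 0 < t) (ht' : 0 < t') {N : ℕ}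
    (hN : ∀ n ≥ N, InTail κ (shift^[n] s) (F^[n] t) ∧ InTail κ (shift^[n] s') (F^[n] t') ∧
      tailRay κ (shift^[n] s) (F^[n] t) = tailRay κ (shift^[n] s') (F^[n] t')) :
    t = t' ∧ ∀ n ≥ N, s n = s' n := by
  -- A tail point is within `2` of its asymptotic position, so the two positions differ by at most
  -- `4`. The real part forces `t = t'` by expansion, and the imaginary part forces equal entries
  -- since `2π > 4`.
  have h1 : ∀ n ≥ N, ‖((F^[n] t - F^[n] t' : ℝ) : ℂ) +
      ((2 * Real.pi * (s n - s' n) : ℝ) : ℂ) * Complex.I‖ ≤ 4 := by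
    intro n hn
    obtain ⟨a1, a2, a3⟩ := hN n hn
    have b1 := a1.norm_tailRay_sub_le_two (hs.iterate n)
    have b2 := a2.norm_tailRay_sub_le_two (hs'.iterate n)
    rw [shift_iterate_zero, a3] at b1
    rw [shift_iterate_zero] at b2
    have := norm_sub_le_norm_sub_add_norm_sub
      ((F^[n] t : ℝ) - κ + 2 * (Real.pi : ℂ) * Complex.I * (s n : ℂ))
      (tailRay κ (shift^[n] s') (F^[n] t'))
      ((F^[n] t' : ℝ) - κ + 2 * (Real.pi : ℂ) * Complex.I * (s' n : ℂ))
    rw [norm_sub_rev] at b1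
    refine le_trans (le_of_eq ?_) (this.trans (by linarith))
    congr 1; push_cast; ring
  have key : ∀ {a b : ℝ}, 0 < a → a < b → (∀ n ≥ N, F^[n] b - F^[n] a ≤ 4) → False := by
    intro a b ha hab h
    obtain ⟨n, hn1, hn2⟩ := (((tendsto_iterate_F_sub ha hab).eventually_gt_atTop 4).and
      (eventually_ge_atTop N)).exists
    linarith [h n hn2]
  have hre : ∀ n ≥ N, |F^[n] t - F^[n] t'| ≤ 4 := fun n hn => by
    have := (Complex.abs_re_le_norm _).trans (h1 n hn)
    simpa only [Complex.add_re, Complex.ofReal_re, Complex.re_ofReal_mul, Complex.I_re, mul_zero,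
      add_zero] using this
  refine ⟨?_, fun n hn => ?_⟩
  · rcases lt_trichotomy t t' with h | h | h
    · exact (key ht h fun n hn => by linarith [(abs_le.1 (hre n hn)).1]).elim
    · exact h
    · exact (key ht' h fun n hn => by linarith [(abs_le.1 (hre n hn)).2]).elim
  · have h2 := (Complex.abs_im_le_norm _).trans (h1 n hn)
    simp only [Complex.add_im, Complex.ofReal_im, Complex.im_ofReal_mul, Complex.I_im, mul_one,
      zero_add] at h2
    by_contra hne
    have h3 : (1 : ℝ) ≤ |(s n : ℝ) - s' n| := by
      have : (1 : ℤ) ≤ |s n - s' n| := Int.one_le_abs (sub_ne_zero.2 hne)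
      exact_mod_cast this
    rw [abs_mul, abs_of_pos (by positivity)] at h2
    nlinarith [Real.pi_gt_three]

theorem tendsto_uncurry_comp {f : ℂ → ℝ → ℂ} {κ : ℂ} {τ : ℝ}
    (hf : ContinuousAt (fun p : ℂ × ℝ => f p.1 p.2) (κ, τ)) {ι : Type*} {l : Filter ι} {u : ι → ℂ}
    {v : ι → ℝ} (hu : Tendsto u l (𝓝 κ)) (hv : Tendsto v l (𝓝 τ)) :
    Tendsto (fun k => f (u k) (v k)) l (𝓝 (f κ τ)) :=
  (Tendsto.comp hf (hu.prodMk_nhds hv)).congr fun _ => rfl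

theorem InTail.tendsto_tailRay {s : Address} (hs : ExpBounded s) {κ : ℂ} {τ : ℝ}
    (h : InTail κ s τ) {ι : Type*} {l : Filter ι} {u : ι → ℂ} {v : ι → ℝ}
    (hu : Tendsto u l (𝓝 κ)) (hv : Tendsto v l (𝓝 τ)) :
    Tendsto (fun k => tailRay (u k) s (v k)) l (𝓝 (tailRay κ s τ)) :=
  tendsto_uncurry_comp (f := fun κ τ => tailRay κ s τ) (h.continuousAt_tailRay hs) hu hv

theorem isRayRoot_of_tendsto {s : Address} {t : ℝ} {κ : ℂ} (ha : Admissible s t) {u : ℕ → ℂ}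
    {v : ℕ → ℝ} (hu : Tendsto u atTop (𝓝 κ)) (hv : Tendsto v atTop (𝓝 t))
    (hr : ∀ k, IsRayRoot s (v k) (u k)) : IsRayRoot s t κ := by
  obtain ⟨t', ht', ha'⟩ := ha.exists_lt
  obtain ⟨N, hN⟩ := ha'.exists_tailPotential_le (‖κ‖ + 1)
  have hev : ∀ᶠ k in atTop, ‖u k‖ < ‖κ‖ + 1 ∧ t' < v k :=
    (hu.norm.eventually_lt_const (by linarith)).and (hv.eventually_const_lt ht')
  have hlim : ∀ n ≥ N, (E κ)^[n] 0 = tailRay κ (shift^[n] s) (F^[n] t) := by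
    intro n hn
    have h1 : Tendsto (fun k => (E (u k))^[n] 0) atTop (𝓝 ((E κ)^[n] 0)) :=
      ((continuous_iterate_E_zero n).tendsto κ).comp hu
    have hk := hN n hn t ht'.le κ (by linarith)
    have h2 : Tendsto (fun k => tailRay (u k) (shift^[n] s) (F^[n] (v k))) atTop
        (𝓝 (tailRay κ (shift^[n] s) (F^[n] t))) := by
      have h3 : Tendsto (fun k => F^[n] (v k)) atTop (𝓝 (F^[n] t)) :=
        ((continuous_iterate_F n).tendsto t).comp hv
      exact (inTail_of_tailPotential_le hk.le).tendsto_tailRay (ha.1.iterate n) hu h3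
    refine tendsto_nhds_unique h1 (h2.congr' ?_)
    filter_upwards [hev] with k hk
    exact ((hr k).iterate_E_zero (ha'.mono hk.2.le)
      (hN n hn (v k) hk.2.le (u k) hk.1.le).le).symm
  have hdom : κ ∈ rayDomain s t := by
    -- Otherwise a shifted ray meets `0` at a potential `τ ≥ F^[j + 1] t > t`, and the singular
    -- orbit would lie on tails with both orbits of potentials, from `t` and from `τ`.
    refine (mem_rayDomain_or_exists_isRayRoot ha κ).resolve_right ?_
    rintro ⟨j, τ, hτ, hroot⟩
    have ha2 : Admissible (shift^[j + 1] s) τ := (ha.iterate (j + 1)).mono hτ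
    obtain ⟨N', hN'⟩ := ha2.exists_tailPotential_le ‖κ‖
    have := (eq_of_tailRay_eq (κ := κ) (s := s) (s' := shift^[j + 1] s) (t := t) (t' := τ)
      (N := max N N') ha.1 ha2.1 ha.pos ha2.pos fun n hn => ?_).1
    · have h3 := lt_iterate_F_succ ha.pos j
      linarith
    · have h1 := hN n (le_of_max_le_left hn) t ht'.le κ (by linarith)
      have h2 := hN' n (le_of_max_le_right hn) τ le_rfl κ le_rfl
      exact ⟨inTail_of_tailPotential_le h1.le, inTail_of_tailPotential_le h2.le,
        (hlim n (le_of_max_le_left hn)).symm.trans (hroot.iterate_E_zero ha2 h2.le)⟩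
  refine ⟨hdom, ?_⟩
  obtain ⟨ε, hε, -, -, hc, -⟩ := exists_ball_dynamicRay ha hdom
  have h1 : ContinuousAt (fun p : ℂ × ℝ => dynamicRay p.1 s p.2) (κ, t) :=
    hc.continuousAt (prod_mem_nhds (Metric.ball_mem_nhds κ hε) (Ici_mem_nhds (by linarith)))
  refine tendsto_nhds_unique
    (tendsto_uncurry_comp (f := fun κ τ => dynamicRay κ s τ) h1 hu hv) ?_
  exact tendsto_const_nhds.congr fun k => (hr k).2.symm

/-! ### Parameters for which the singular orbit does not escape -/

theorem not_frequently_norm_le_of_escaping {κ : ℂ} (h : κ ∈ escapingParameters) (C : ℝ) :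
    ¬ ∃ᶠ n in atTop, ‖(E κ)^[n] 0‖ ≤ C := by
  have := (show Tendsto (fun n : ℕ => ‖(E κ)^[n] 0‖) atTop atTop from h).eventually_gt_atTop C
  simpa only [not_frequently, not_le] using this

theorem norm_E (κ z : ℂ) : ‖E κ z‖ = Real.exp (z.re + κ.re) := by
  rw [E, Complex.norm_exp, Complex.add_re]

/-- For `Re κ ≤ -1` the closed unit disk is mapped into itself. -/
theorem neg_one_lt_re_of_escaping {κ : ℂ} (h : κ ∈ escapingParameters) : -1 < κ.re := by
  by_contra! hκ
  refine not_frequently_norm_le_of_escaping h 1 (Frequently.of_forall fun n => ?_)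
  induction n with
  | zero => simp
  | succ n ih =>
    rw [Function.iterate_succ_apply', norm_E]
    have := (Complex.re_le_norm _).trans ih
    rw [Real.exp_le_one_iff]; linarith

/-- On these lines `E κ` maps the reals to the negative reals, and the singular orbit stays in
`[-e^{Re κ}, 0]`. -/
theorem im_ne_of_escaping {κ : ℂ} (h : κ ∈ escapingParameters) (j : ℤ) :
    κ.im ≠ Real.pi + j * (2 * Real.pi) := by
  intro hκ
  have hexp : ∀ r : ℝ, E κ r = ((-Real.exp (r + κ.re) : ℝ) : ℂ) := by
    intro r
    have h1 : (r : ℂ) + κ = ((r + κ.re : ℝ) : ℂ) + Real.pi * Complex.I +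
        j * (2 * Real.pi * Complex.I) := by
      apply Complex.ext <;> simp [hκ]
    rw [E, h1, Complex.exp_add, Complex.exp_add, Complex.exp_pi_mul_I,
      Complex.exp_int_mul_two_pi_mul_I]
    push_cast; ring
  have key : ∀ n : ℕ, ∃ r : ℝ, (E κ)^[n] 0 = r ∧ r ≤ 0 ∧ -Real.exp κ.re ≤ r := by
    intro n
    induction n with
    | zero => exact ⟨0, by simp, le_rfl, by have := Real.exp_pos κ.re; linarith⟩
    | succ n ih =>
      obtain ⟨r, hr, h0, h1⟩ := ih
      refine ⟨_, by rw [Function.iterate_succ_apply', hr, hexp], ?_, ?_⟩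
      · have := Real.exp_pos (r + κ.re); linarith
      · rw [neg_le_neg_iff, Real.exp_le_exp]; linarith
  refine not_frequently_norm_le_of_escaping h (Real.exp κ.re) (Frequently.of_forall fun n => ?_)
  obtain ⟨r, hr, h0, h1⟩ := key n
  rw [hr, Complex.norm_real, Real.norm_of_nonpos h0]; linarith

theorem norm_exp_sub_exp_le {a b : ℂ} (h : ‖a - b‖ ≤ 1) :
    ‖Complex.exp a - Complex.exp b‖ ≤ Real.exp (b.re + 1) * ‖a - b‖ := by
  have h1 : Complex.exp a - Complex.exp b = Complex.exp b * (Complex.exp (a - b) - 1) := by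
    rw [mul_sub, ← Complex.exp_add]; simp
  have h2 := Complex.norm_exp_sub_one_le h
  have h3 : (2 : ℝ) ≤ Real.exp 1 := by have := Real.add_one_le_exp 1; linarith
  rw [h1, norm_mul, Complex.norm_exp, Real.exp_add, mul_assoc]
  gcongr
  exact h2.trans (by gcongr)

/-- If the singular orbit comes so far to the left that it returns to a small disk about the
singular value which is mapped into itself, then it does not escape. -/
theorem re_orbit_pos_of_escaping {κ : ℂ} (h : κ ∈ escapingParameters) (p : ℕ)
    (hp : ∀ j < p, 0 ≤ ((E κ)^[j] 0 + κ).re) :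
    0 < ((E κ)^[p] 0 + κ).re + 1 + ∑ j ∈ Finset.range p, (((E κ)^[j] 0 + κ).re + 1) := by
  by_contra! hneg
  -- `e^{S m}` bounds the expansion of the first `m` steps. The derivative contributes `e^{Re}`, and
  -- the extra `1` pays for distortion on a unit disk.
  set S : ℕ → ℝ := fun m => ∑ j ∈ Finset.range m, (((E κ)^[j] 0 + κ).re + 1) with hS
  have hSmono : ∀ m ≤ p, S m ≤ S p := fun m hm =>
    Finset.sum_le_sum_of_subset_of_nonneg (Finset.range_mono hm) fun j hj _ => by
      have := hp j (Finset.mem_range.1 hj); linarith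
  have hstep : ∀ z : ℂ, ‖z‖ ≤ Real.exp (-S p) → ∀ m ≤ p,
      ‖(E κ)^[m] z - (E κ)^[m] 0‖ ≤ Real.exp (S m - S p) := by
    intro z hz m hm
    induction m with
    | zero => simpa [hS] using hz
    | succ m ih =>
      have ih := ih (by omega)
      have h1 : Real.exp (S m - S p) ≤ 1 := by
        rw [Real.exp_le_one_iff]; have := hSmono m (by omega); linarith
      rw [Function.iterate_succ_apply', Function.iterate_succ_apply', E, E]
      have h2 := norm_exp_sub_exp_le (a := (E κ)^[m] z + κ) (b := (E κ)^[m] 0 + κ)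
        (by rw [add_sub_add_right_eq_sub]; exact ih.trans h1)
      rw [add_sub_add_right_eq_sub] at h2
      refine h2.trans ?_
      have h3 : S (m + 1) - S p = (((E κ)^[m] 0 + κ).re + 1) + (S m - S p) := by
        simp only [hS, Finset.sum_range_succ]; ring
      rw [h3, Real.exp_add _ (S m - S p)]
      gcongr
  -- After `p` steps the disk lies within distance `1` of the orbit point, so `Re` of point plus `κ`
  -- is at most `-S p` by `hneg`, and the next exponential returns into the disk.
  have hret : ∀ z : ℂ, ‖z‖ ≤ Real.exp (-S p) → ‖(E κ)^[p + 1] z‖ ≤ Real.exp (-S p) := by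
    intro z hz
    have h1 := hstep z hz p le_rfl
    rw [sub_self, Real.exp_zero] at h1
    rw [Function.iterate_succ_apply', norm_E, Real.exp_le_exp]
    have h2 := (abs_le.1 ((Complex.abs_re_le_norm _).trans h1)).2
    rw [Complex.sub_re] at h2
    rw [Complex.add_re] at hneg
    change _ + 1 + S p ≤ 0 at hneg
    linarith
  refine not_frequently_norm_le_of_escaping h (Real.exp (-S p)) ?_
  have hmul : ∀ m : ℕ, ‖(E κ)^[m * (p + 1)] 0‖ ≤ Real.exp (-S p) := by
    intro m
    induction m with
    | zero => simpa using (Real.exp_pos _).le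
    | succ m ih =>
      rw [Nat.succ_mul, add_comm, Function.iterate_add_apply]
      exact hret _ ih
  rw [frequently_atTop]
  intro N
  exact ⟨N * (p + 1), Nat.le_mul_of_pos_right _ (by omega), hmul N⟩

/-! ### Growth of the singular orbit while its imaginary parts are moderate -/

theorem orbit_succ (κ : ℂ) (j : ℕ) :
    (E κ)^[j + 1] 0 = Complex.exp ((E κ)^[j] 0 + κ) := by
  rw [Function.iterate_succ_apply', E]

theorem half_add_le_iterate_F {b : ℝ} (hb : 1 ≤ b) (m : ℕ) : 1 + m / 2 ≤ F^[m] b := by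
  induction m with
  | zero => simpa
  | succ m ih =>
    rw [Function.iterate_succ_apply']
    have h0 : (0 : ℝ) ≤ m := by positivity
    have h1 := Real.quadratic_le_exp_of_nonneg (show 0 ≤ F^[m] b by linarith)
    unfold F at *
    push_cast
    nlinarith

/-- While `|Im (E^i 0 + κ)| ≤ 20 F^i(b)`, the real parts of the singular orbit grow like iterated
exponentials. -/
theorem orbit_growth {κ : ℂ} (h : κ ∈ escapingParameters) {b : ℝ} (hb : 1 ≤ b)
    (him : |κ.im| ≤ b) (hre : 100 * (b + 1) ≤ κ.re) (p : ℕ)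
    (hp : ∀ i ≤ p, |((E κ)^[i] 0 + κ).im| ≤ 20 * F^[i] b) :
    (∀ i ≤ p, κ.re ≤ ((E κ)^[i] 0 + κ).re ∧ 100 * (F^[i] b + 1) ≤ ((E κ)^[i] 0 + κ).re ∧
      ∑ j ∈ Finset.range (i + 1), (((E κ)^[j] 0 + κ).re + 1) ≤ 2 * (((E κ)^[i] 0 + κ).re + 1)) ∧
    ∀ i < p, Real.exp ((E κ)^[i] 0 + κ).re / 2 ≤ ((E κ)^[i + 1] 0 + κ).re := by
  have hstep : ∀ i < p, κ.re ≤ ((E κ)^[i] 0 + κ).re → 100 * (F^[i] b + 1) ≤ ((E κ)^[i] 0 + κ).re →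
      (∀ j < i + 1, 0 ≤ ((E κ)^[j] 0 + κ).re) →
      ∑ j ∈ Finset.range (i + 1), (((E κ)^[j] 0 + κ).re + 1) ≤ 2 * (((E κ)^[i] 0 + κ).re + 1) →
      Real.exp ((E κ)^[i] 0 + κ).re / 2 ≤ ((E κ)^[i + 1] 0 + κ).re ∧
      100 * Real.exp (F^[i] b) ≤ Real.exp ((E κ)^[i] 0 + κ).re / 2 := by
    intro i hi h1 h2 h3 h4
    have hpi := hp (i + 1) hi
    have hatt := re_orbit_pos_of_escaping h (i + 1) h3
    set w := (E κ)^[i] 0 + κ with hw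
    set w' := (E κ)^[i + 1] 0 + κ with hw'
    set u := F^[i] b with hu
    have hu1 : b ≤ u := le_iterate_F i b
    have e1 : Real.exp u * 200 ≤ Real.exp w.re := by
      have q := Real.quadratic_le_exp_of_nonneg (show (0 : ℝ) ≤ 100 by norm_num)
      calc Real.exp u * 200 ≤ Real.exp u * Real.exp 100 := by gcongr; linarith
        _ = Real.exp (u + 100) := (Real.exp_add _ _).symm
        _ ≤ Real.exp w.re := by gcongr; linarith
    have e2 := Real.quadratic_le_exp_of_nonneg (show 0 ≤ w.re by linarith)
    have e3 : ‖κ‖ ≤ 2 * w.re := by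
      have := Complex.norm_le_abs_re_add_abs_im κ
      rw [abs_of_nonneg (by linarith : 0 ≤ κ.re)] at this
      linarith
    have e4 : Real.exp w.re - ‖κ‖ ≤ ‖w'‖ := by
      rw [hw', orbit_succ, ← hw]
      have := norm_sub_norm_le (Complex.exp w) (-κ)
      rwa [norm_neg, Complex.norm_exp, sub_neg_eq_add] at this
    have e5 := Complex.norm_le_abs_re_add_abs_im w'
    have e6 : F^[i + 1] b = Real.exp u - 1 := by rw [Function.iterate_succ_apply']; rfl
    rw [e6] at hpi
    -- The modulus `e^{Re w}` must sit in the real part: the imaginary part is at most `20 e^u`, a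
    -- tenth of it by `e1`, and `κ` is negligible by `e2` and `e3`.
    have e7 : Real.exp w.re / 2 ≤ |w'.re| := by nlinarith
    refine ⟨?_, by linarith⟩
    rcases le_or_gt 0 w'.re with h5 | h5
    · rwa [abs_of_nonneg h5] at e7
    -- A real part below `-e^{Re w} / 2` would beat the accumulated expansion `2(Re w + 1)`,
    -- contrary to `hatt`.
    · rw [abs_of_neg h5] at e7
      nlinarith
  have hmain : ∀ i ≤ p, (∀ j < i + 1, 0 ≤ ((E κ)^[j] 0 + κ).re) ∧
      κ.re ≤ ((E κ)^[i] 0 + κ).re ∧ 100 * (F^[i] b + 1) ≤ ((E κ)^[i] 0 + κ).re ∧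
      ∑ j ∈ Finset.range (i + 1), (((E κ)^[j] 0 + κ).re + 1) ≤
        2 * (((E κ)^[i] 0 + κ).re + 1) := by
    intro i hi
    induction i with
    | zero =>
      simp only [zero_add, Nat.lt_one_iff, forall_eq, Function.iterate_zero, id_eq,
        Finset.range_one, Finset.sum_singleton, le_refl, true_and]
      refine ⟨by linarith, hre, by linarith⟩
    | succ i ih =>
      obtain ⟨h0, h1, h2, h3⟩ := ih (by omega)
      obtain ⟨h4, h5⟩ := hstep i (by omega) h1 h2 h0 h3
      have hpos := h0 i (by omega)
      have e2 := Real.quadratic_le_exp_of_nonneg hpos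
      have hub := le_iterate_F i b
      have h6 : 100 * (F^[i + 1] b + 1) ≤ ((E κ)^[i + 1] 0 + κ).re := by
        have : F^[i + 1] b + 1 = Real.exp (F^[i] b) := by
          rw [Function.iterate_succ_apply']; unfold F; ring
        rw [this]; linarith
      refine ⟨fun j hj => ?_, by nlinarith, h6, ?_⟩
      · rcases Nat.lt_succ_iff_lt_or_eq.1 hj with hj | rfl
        · exact h0 j hj
        · nlinarith
      · rw [Finset.sum_range_succ]
        nlinarith
  exact ⟨fun i hi => (hmain i hi).2, fun i hi =>
    (hstep i hi (hmain i hi.le).2.1 (hmain i hi.le).2.2.1 (hmain i hi.le).1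
      (hmain i hi.le).2.2.2).1⟩

/-! ### Monotonicity of ray tails -/

namespace InTail

variable {κ : ℂ} {s : Address} {τ : ℝ}

/-- The recursion for the derivative is `e^τ D / a` with `a` close to `e^τ`. As `e^{τ - supPotential
s}` at least doubles under the shift, `D` is off by at most `2η` and `a / e^τ` by `η`; dividing `3η`
by `3/4` reproduces `4η`. -/
theorem exists_hasDerivAt_approxRay (hκ : 17 ≤ ‖κ‖) (hs : ExpBounded s) (h : InTail κ s τ)
    (m : ℕ) : ∃ D : ℂ, HasDerivAt (fun τ : ℝ => approxRay κ m s τ) D τ ∧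
      ‖D - 1‖ ≤ 4 * (‖κ‖ + 11) / Real.exp (τ - supPotential s) := by
  induction m generalizing s τ with
  | zero =>
    refine ⟨1, ?_, by simp; positivity⟩
    simpa [approxRay] using (hasDerivAt_id τ).ofReal_comp
  | succ m ih =>
    obtain ⟨D, hD, hD1⟩ := ih hs.shift (h.shift hs)
    set a := approxRay κ m (ExpRays.shift s) (F τ) with ha
    have hare : 0 < a.re := h.re_approxRay_pos hs m
    have ha0 : a ≠ 0 := fun h0 => by simp [h0] at hare
    have he := Real.exp_pos τ
    have he' : (Real.exp τ : ℂ) ≠ 0 := by exact_mod_cast he.ne'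
    have hF : HasDerivAt F (Real.exp τ) τ := by
      unfold F; exact (Real.hasDerivAt_exp τ).sub_const 1
    have h1 : HasDerivAt (fun τ : ℝ => approxRay κ m (ExpRays.shift s) (F τ))
        (Real.exp τ • D) τ := HasDerivAt.scomp τ hD hF
    have h2 : HasDerivAt (fun τ : ℝ => approxRay κ (m + 1) s τ) ((Real.exp τ • D) / a) τ := by
      have := h1.clog_real (Or.inl hare)
      simpa only [approxRay, L] using (this.sub_const κ).add_const _
    refine ⟨_, h2, ?_⟩
    set Q := Real.exp (τ - supPotential s) with hQ
    have hQe : Real.exp τ = Real.exp (supPotential s) * Q := by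
      rw [hQ, ← Real.exp_add]; ring_nf
    have hsp := Real.one_le_exp (supPotential_nonneg s)
    have hQK : (‖κ‖ + 29 / 10) ^ 2 < Q := by
      have h3 : Real.exp (supPotential s) * (‖κ‖ + 29 / 10) ^ 2 < Real.exp τ := h
      rw [hQe] at h3
      exact lt_of_mul_lt_mul_left h3 (by linarith)
    have hQ0 : 0 < Q := Real.exp_pos _
    have hQ1 : 300 < Q := by nlinarith
    have hQ' : 2 * Q ≤ Real.exp (F τ - supPotential (ExpRays.shift s)) := by
      have h3 : Q - 1 ≤ F τ - supPotential (ExpRays.shift s) := by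
        have := hs.supPotential_shift_le
        unfold F at this ⊢
        rw [hQe]
        nlinarith [mul_nonneg (sub_nonneg.2 hsp) (show 0 ≤ Q - 1 by linarith)]
      have h4 := Real.quadratic_le_exp_of_nonneg (show 0 ≤ Q - 1 by linarith)
      refine le_trans ?_ (Real.exp_le_exp.2 h3)
      nlinarith
    set η := (‖κ‖ + 11) / Q with hη
    have hη1 : η ≤ 1 / 4 := by
      rw [hη, div_le_iff₀ hQ0]; nlinarith
    have hη0 : 0 < η := by positivity
    have hD2 : ‖D - 1‖ ≤ 2 * η := by
      refine hD1.trans ?_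
      rw [hη, div_le_iff₀ (Real.exp_pos _)]
      calc 4 * (‖κ‖ + 11) = 2 * ((‖κ‖ + 11) / Q) * (2 * Q) := by field_simp; norm_num
        _ ≤ _ := by gcongr
    have hρ : ‖a / Real.exp τ - 1‖ ≤ η := by
      have h3 := (h.approxRay_estimates hs m).1
      have h4 : |(s 1 : ℝ)| ≤ Real.exp (supPotential s) - 1 := hs.abs_le 1
      rw [div_sub_one he', norm_div, Complex.norm_real, Real.norm_of_nonneg he.le,
        div_le_iff₀ he]
      refine h3.trans ?_
      rw [hη, hQe]
      have h5 : (‖κ‖ + 11) / Q * (Real.exp (supPotential s) * Q) =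
        (‖κ‖ + 11) * Real.exp (supPotential s) := by field_simp
      rw [h5]
      have h6 : 2 * Real.pi * |(s 1 : ℝ)| ≤ 8 * (Real.exp (supPotential s) - 1) := by
        have := Real.pi_le_four
        gcongr; linarith
      nlinarith
    set ρ := a / Real.exp τ with hρd
    have hρ0 : ρ ≠ 0 := div_ne_zero ha0 he'
    have hρn : 3 / 4 ≤ ‖ρ‖ := by
      have := norm_sub_norm_le (1 : ℂ) (1 - ρ)
      rw [norm_one, sub_sub_cancel, norm_sub_rev] at this
      linarith
    have h7 : (Real.exp τ • D) / a - 1 = ((D - 1) - (ρ - 1)) / ρ := by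
      rw [hρd]; field_simp; simp; ring
    rw [h7, norm_div, div_le_iff₀ (by linarith)]
    have h8 : ‖D - 1 - (ρ - 1)‖ ≤ 3 * η := (norm_sub_le _ _).trans (by linarith)
    have h9 : 4 * (‖κ‖ + 11) / Q = 4 * η := by rw [hη]; ring
    rw [h9]
    nlinarith

theorem re_approxRay_sub_ge (hκ : 17 ≤ ‖κ‖) (hs : ExpBounded s) (h : InTail κ s τ) {τ' : ℝ}
    (hτ : τ ≤ τ') (m : ℕ) :
    1 / 2 * (τ' - τ) ≤ (approxRay κ m s τ').re - (approxRay κ m s τ).re := by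
  have hd : ∀ x ∈ Ici τ, ∃ D : ℝ, HasDerivAt (fun τ : ℝ => (approxRay κ m s τ).re) D x ∧
      1 / 2 ≤ D := by
    intro x hx
    obtain ⟨D, hD, hD1⟩ := (h.mono hx).exists_hasDerivAt_approxRay hκ hs m
    refine ⟨D.re, (Complex.reCLM.hasFDerivAt.comp_hasDerivAt x hD), ?_⟩
    have h1 : 4 * (‖κ‖ + 11) / Real.exp (x - supPotential s) ≤ 1 / 2 := by
      have h3 : Real.exp (supPotential s) * (‖κ‖ + 29 / 10) ^ 2 < Real.exp x := h.mono hx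
      rw [div_le_iff₀ (Real.exp_pos _)]
      have h4 : (‖κ‖ + 29 / 10) ^ 2 < Real.exp (x - supPotential s) := by
        rw [Real.exp_sub, lt_div_iff₀ (Real.exp_pos _), mul_comm]; exact h3
      nlinarith
    have h2 := (abs_le.1 ((Complex.abs_re_le_norm _).trans (hD1.trans h1))).1
    rw [Complex.sub_re, Complex.one_re] at h2
    linarith
  refine Convex.mul_sub_le_image_sub_of_le_deriv (convex_Ici τ)
    (fun x hx => ((hd x hx).choose_spec.1).continuousAt.continuousWithinAt) (fun x hx => ?_)
    (fun x hx => ?_) τ self_mem_Ici τ' hτ hτ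
  · exact ((hd x (interior_subset hx)).choose_spec.1).differentiableAt.differentiableWithinAt
  · rw [(hd x (interior_subset hx)).choose_spec.1.deriv]
    exact (hd x (interior_subset hx)).choose_spec.2

theorem re_tailRay_lt (hκ : 17 ≤ ‖κ‖) (hs : ExpBounded s) (h : InTail κ s τ) {τ' : ℝ}
    (hτ : τ < τ') : (tailRay κ s τ).re < (tailRay κ s τ').re := by
  have h1 : 1 / 2 * (τ' - τ) ≤ (tailRay κ s τ').re - (tailRay κ s τ).re :=
    ge_of_tendsto (((Complex.continuous_re.tendsto _).comp
      ((h.mono hτ.le).tendsto_approxRay hs)).sub ((Complex.continuous_re.tendsto _).comp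
      (h.tendsto_approxRay hs))) (Eventually.of_forall fun m =>
        h.re_approxRay_sub_ge hκ hs hτ.le m)
  linarith

end InTail

/-! ### Pulling back nearly horizontal curves -/

theorem abs_arg_le_abs_im_div_re {z : ℂ} (hz : 0 < z.re) : |z.arg| ≤ |z.im| / z.re := by
  have h1 := abs_lt.1 (Complex.abs_arg_lt_pi_div_two_iff.2 (Or.inl hz))
  have h2 := Complex.tan_arg z
  have h3 : |z.im| / z.re = |Real.tan z.arg| := by rw [h2, abs_div, abs_of_pos hz]
  rw [h3]
  rcases le_total 0 z.arg with h | h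
  · rw [abs_of_nonneg h]
    exact (Real.le_tan h h1.2).trans (le_abs_self _)
  · rw [abs_of_nonpos h]
    refine (Real.le_tan (neg_nonneg.2 h) (by linarith)).trans ?_
    rw [Real.tan_neg]
    exact neg_le_abs _

/-- `c`, on `[0, ∞)`, is a continuous curve from `c 0` to `∞` whose increments have positive real
part and slope at most `σ`. -/
structure IsFlatCurve (σ : ℝ) (c : ℝ → ℂ) : Prop where
  continuousOn : ContinuousOn c (Ici 0)
  re_lt : ∀ u ≥ 0, ∀ u' > u, 0 < (c u' - c u).re
  slope : ∀ u ≥ 0, ∀ u' > u, |(c u' - c u).im| ≤ σ * (c u' - c u).re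
  tendsto : Tendsto (fun u => (c u).re) atTop atTop

/-- The quotient `ζ` of two vectors of slope at most `σ` has slope at most `4σ`. Passing to `log (1
+ ζ)` preserves this, since its real part is at least `Re ζ / (1 + Re ζ)` and its imaginary part is
at most `|Im ζ| / (1 + Re ζ)` in modulus. -/
theorem log_slope {σ : ℝ} (hσ0 : 0 < σ) (hσ : σ ≤ 1 / 2) {p Δ : ℂ} (hp : 0 < p.re)
    (hp' : |p.im| ≤ σ * p.re) (hΔ : 0 < Δ.re) (hΔ' : |Δ.im| ≤ σ * Δ.re) :
    0 < (Complex.log (p + Δ) - Complex.log p).re ∧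
    |(Complex.log (p + Δ) - Complex.log p).im| ≤
      4 * σ * (Complex.log (p + Δ) - Complex.log p).re := by
  have hp0 : p ≠ 0 := fun h => by simp [h] at hp
  have hpd : 0 < (p + Δ).re := by rw [Complex.add_re]; linarith
  rw [← (div_mem_slitPlane hpd hp).2]
  obtain ⟨p1, p2⟩ := abs_le.1 hp'
  obtain ⟨d1, d2⟩ := abs_le.1 hΔ'
  set ζ := Δ / p with hζ
  have h1 : (p + Δ) / p = 1 + ζ := by rw [hζ]; field_simp
  rw [h1]
  have hn : 0 < Complex.normSq p := Complex.normSq_pos.2 hp0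
  have hre : ζ.re = (Δ.re * p.re + Δ.im * p.im) / Complex.normSq p := by
    rw [hζ, Complex.div_re]; ring
  have him : ζ.im = (Δ.im * p.re - Δ.re * p.im) / Complex.normSq p := by
    rw [hζ, Complex.div_im]; ring
  have hb1 : |Δ.im * p.im| ≤ 1 / 4 * (Δ.re * p.re) := by
    rw [abs_mul]
    calc |Δ.im| * |p.im| ≤ (σ * Δ.re) * (σ * p.re) := by gcongr
      _ = σ * σ * (Δ.re * p.re) := by ring
      _ ≤ (1 / 2) * (1 / 2) * (Δ.re * p.re) := by gcongr
      _ = _ := by ring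
  have hpos : 0 < Δ.re * p.re := mul_pos hΔ hp
  have hb2 : |Δ.im * p.re - Δ.re * p.im| ≤ 2 * σ * (Δ.re * p.re) := by
    refine (abs_sub _ _).trans ?_
    rw [abs_mul, abs_mul, abs_of_pos hp, abs_of_pos hΔ]
    nlinarith
  have hζre : 0 < ζ.re := by
    rw [hre]; refine div_pos ?_ hn
    linarith [(abs_le.1 hb1).1]
  have hζim : |ζ.im| ≤ 4 * σ * ζ.re := by
    rw [hre, him, abs_div, abs_of_pos hn, mul_div_assoc']
    gcongr
    have := (abs_le.1 hb1).1
    nlinarith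
  have h1re : (1 + ζ).re = 1 + ζ.re := by simp
  have h1im : (1 + ζ).im = ζ.im := by simp
  have hlog : ζ.re / (1 + ζ.re) ≤ (Complex.log (1 + ζ)).re := by
    rw [Complex.log_re]
    have h2 : 1 + ζ.re ≤ ‖1 + ζ‖ := h1re ▸ Complex.re_le_norm _
    have h3 := Real.one_sub_inv_le_log_of_pos (show 0 < 1 + ζ.re by linarith)
    have h4 := Real.log_le_log (by linarith) h2
    have h5 : ζ.re / (1 + ζ.re) = 1 - (1 + ζ.re)⁻¹ := by field_simp; ring
    linarith
  refine ⟨lt_of_lt_of_le (by positivity) hlog, ?_⟩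
  rw [Complex.log_im]
  refine (abs_arg_le_abs_im_div_re (by rw [h1re]; linarith)).trans ?_
  rw [h1re, h1im]
  calc |ζ.im| / (1 + ζ.re) ≤ (4 * σ * ζ.re) / (1 + ζ.re) := by gcongr
    _ = 4 * σ * (ζ.re / (1 + ζ.re)) := by ring
    _ ≤ _ := by gcongr

theorem IsFlatCurve.pullback {σ : ℝ} (hσ0 : 0 < σ) (hσ : σ ≤ 1 / 2) {c : ℝ → ℂ}
    (hc : IsFlatCurve σ c) {κ w : ℂ} (hv : 0 < (c 0 - κ).re)
    (hv' : |(c 0 - κ).im| ≤ σ * (c 0 - κ).re) (hw : Complex.exp w = c 0 - κ) :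
    ∃ c' : ℝ → ℂ, IsFlatCurve (4 * σ) c' ∧ c' 0 = w ∧ ∀ u ≥ 0, Complex.exp (c' u) = c u - κ := by
  have hcone : ∀ u ≥ 0, (c 0 - κ).re ≤ (c u - κ).re ∧ |(c u - κ).im| ≤ σ * (c u - κ).re := by
    intro u hu
    rcases eq_or_lt_of_le hu with rfl | hu
    · exact ⟨le_rfl, hv'⟩
    · have h1 := hc.re_lt 0 le_rfl u hu
      have h2 := hc.slope 0 le_rfl u hu
      have h3 : c u - κ = (c 0 - κ) + (c u - c 0) := by ring
      rw [h3, Complex.add_re, Complex.add_im]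
      refine ⟨by linarith, (abs_add_le _ _).trans ?_⟩
      rw [mul_add]
      exact add_le_add hv' h2
  have hpos : ∀ u ≥ 0, 0 < (c u - κ).re := fun u hu => hv.trans_le (hcone u hu).1
  have hdiff : ∀ u ≥ 0, ∀ u' > u, 0 < (Complex.log (c u' - κ) - Complex.log (c u - κ)).re ∧
      |(Complex.log (c u' - κ) - Complex.log (c u - κ)).im| ≤
        4 * σ * (Complex.log (c u' - κ) - Complex.log (c u - κ)).re := by
    intro u hu u' hu'
    have := log_slope hσ0 hσ (hpos u hu) (hcone u hu).2 (hc.re_lt u hu u' hu') (hc.slope u hu u' hu')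
    rwa [show c u - κ + (c u' - c u) = c u' - κ by ring] at this
  refine ⟨fun u => w + (Complex.log (c u - κ) - Complex.log (c 0 - κ)), ⟨?_, ?_, ?_, ?_⟩, by simp, ?_⟩
  · refine continuousOn_const.add (ContinuousOn.sub ?_ continuousOn_const)
    exact (hc.continuousOn.sub continuousOn_const).clog fun u hu => Or.inl (hpos u hu)
  · intro u hu u' hu'
    simpa [add_sub_add_left_eq_sub] using (hdiff u hu u' hu').1
  · intro u hu u' hu'
    have := (hdiff u hu u' hu').2
    simpa [add_sub_add_left_eq_sub] using this
  · have h1 : Tendsto (fun u => Real.log ((c u).re - κ.re)) atTop atTop :=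
      Real.tendsto_log_atTop.comp (tendsto_atTop_add_const_right _ _ hc.tendsto)
    have h2 : Tendsto (fun u => Real.log ((c u).re - κ.re) +
        (w.re - (Complex.log (c 0 - κ)).re)) atTop atTop := tendsto_atTop_add_const_right _ _ h1
    refine tendsto_atTop_mono' _ ?_ h2
    filter_upwards [eventually_ge_atTop 0] with u hu
    have h3 : Real.log ((c u).re - κ.re) ≤ (Complex.log (c u - κ)).re := by
      rw [Complex.log_re]
      refine Real.log_le_log (by simpa using hpos u hu) ?_
      simpa using Complex.re_le_norm (c u - κ)
    simp only [Complex.add_re, Complex.sub_re] at h3 ⊢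
    linarith
  · intro u hu
    have h1 : c u - κ ≠ 0 := fun h => by have := hpos u hu; simp [h] at this
    have h2 : c 0 - κ ≠ 0 := fun h => by simp [h] at hv
    rw [Complex.exp_add, Complex.exp_sub, Complex.exp_log h1, Complex.exp_log h2, hw]
    field_simp

/-- A curve from the singular value to `∞` whose image under an iterate is a horizontal ray. -/
theorem exists_flatCurve {κ : ℂ} (p : ℕ)
    (h : ∀ j, 1 ≤ j → j ≤ p → 0 < ((E κ)^[j] 0).re ∧
      |((E κ)^[j] 0).im| ≤ (1 / 4) ^ (j + 1) * ((E κ)^[j] 0).re) :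
    ∃ c : ℝ → ℂ, IsFlatCurve 1 c ∧ c 0 = κ ∧
      ∀ u ≥ 0, (E κ)^[p] (c u - κ) = (E κ)^[p] 0 + u := by
  -- Every pull-back costs a factor `4` in the slope, whence the allowance `(1 / 4) ^ (j + 1)` at
  -- level `j`; it matches the cones assumed for the orbit.
  suffices hs : ∀ d j : ℕ, j + d = p → ∃ c : ℝ → ℂ, IsFlatCurve ((1 / 4) ^ (j + 1)) c ∧
      c 0 = (E κ)^[j] 0 + κ ∧ ∀ u ≥ 0, (E κ)^[d] (c u - κ) = (E κ)^[p] 0 + u by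
    obtain ⟨c, hc, h0, h1⟩ := hs p 0 (zero_add p)
    refine ⟨c, ⟨hc.1, hc.2, fun u hu u' hu' => (hc.3 u hu u' hu').trans ?_, hc.4⟩, by simpa using h0,
      h1⟩
    have := hc.2 u hu u' hu'
    nlinarith
  intro d
  induction d with
  | zero =>
    intro j hj
    refine ⟨fun u => (E κ)^[j] 0 + κ + u, ⟨by fun_prop, ?_, ?_, ?_⟩, by simp, ?_⟩
    · intro u hu u' hu'
      simpa using hu'
    · intro u hu u' hu'
      have : (0 : ℝ) ≤ (1 / 4) ^ (j + 1) * (u' - u) := by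
        have : 0 < u' - u := sub_pos.2 hu'
        positivity
      simpa using this
    · simp only [Complex.add_re, Complex.ofReal_re]
      exact tendsto_atTop_add_const_left _ _ tendsto_id
    · intro u hu
      simp only [add_zero] at hj
      simp [hj]
      ring
  | succ d ih =>
    intro j hj
    obtain ⟨c, hc, h0, h1⟩ := ih (j + 1) (by omega)
    obtain ⟨h2, h3⟩ := h (j + 1) (by omega) (by omega)
    have hσ : ((1 : ℝ) / 4) ^ (j + 1 + 1) ≤ 1 / 2 := by
      calc ((1 : ℝ) / 4) ^ (j + 1 + 1) ≤ (1 / 4) ^ 1 :=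
            pow_le_pow_of_le_one (by norm_num) (by norm_num) (by omega)
        _ ≤ _ := by norm_num
    have hc0 : c 0 - κ = (E κ)^[j + 1] 0 := by rw [h0]; ring
    obtain ⟨c', hc', h0', h1'⟩ := hc.pullback (by positivity) hσ (κ := κ)
      (w := (E κ)^[j] 0 + κ) (by rwa [hc0]) (by rwa [hc0]) (by rw [hc0, orbit_succ])
    have h4 : 4 * ((1 : ℝ) / 4) ^ (j + 1 + 1) = (1 / 4) ^ (j + 1) := by rw [pow_succ _ (j + 1)]; ring
    rw [h4] at hc'
    refine ⟨c', hc', h0', fun u hu => ?_⟩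
    rw [Function.iterate_succ_apply]
    have : E κ (c' u - κ) = c u - κ := by rw [E, sub_add_cancel, h1' u hu]
    rw [this]
    exact h1 u hu

/-! ### Bounds on winding numbers -/

/-- A flat curve is a graph over its projection to the real axis. -/
theorem IsFlatCurve.exists_inverse {σ : ℝ} {c : ℝ → ℂ} (hc : IsFlatCurve σ c) :
    ∃ e : ℝ → ℝ, Continuous e ∧ e (c 0).re = 0 ∧
      ∀ x ≥ (c 0).re, 0 ≤ e x ∧ (c (e x)).re = x := by
  have hcc : Continuous fun u : ℝ => c (max u 0) :=
    hc.continuousOn.comp_continuous (by fun_prop) fun u => mem_Ici.2 (le_max_right _ _)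
  -- The real part is extended to negative `u` with slope `1`, which makes it a homeomorphism of the
  -- line.
  set r : ℝ → ℝ := fun u => (c (max u 0)).re + min u 0 with hr
  have hrc : Continuous r := (Complex.continuous_re.comp hcc).add (by fun_prop)
  have hmono : StrictMono r := by
    intro a b hab
    simp only [hr]
    rcases le_total b 0 with hb | hb
    · rw [max_eq_right hb, max_eq_right (hab.le.trans hb), min_eq_left hb,
        min_eq_left (hab.le.trans hb)]
      linarith
    · rw [max_eq_left hb, min_eq_right hb]
      rcases le_total a 0 with ha | ha
      · rw [max_eq_right ha, min_eq_left ha]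
        rcases eq_or_lt_of_le hb with rfl | hb
        · linarith
        · have := hc.re_lt 0 le_rfl b hb
          rw [Complex.sub_re] at this
          linarith
      · rw [max_eq_left ha, min_eq_right ha]
        have := hc.re_lt a ha b hab
        rw [Complex.sub_re] at this
        linarith
  have htop : Tendsto r atTop atTop := by
    refine hc.tendsto.congr' ?_
    filter_upwards [eventually_ge_atTop 0] with u hu
    simp [hr, hu]
  have hbot : Tendsto r atBot atBot := by
    refine (tendsto_atBot_add_const_left _ (c 0).re tendsto_id).congr' ?_
    filter_upwards [eventually_le_atBot 0] with u hu
    simp [hr, hu]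
  have hsurj := hrc.surjective htop hbot
  set e := hmono.orderIsoOfSurjective r hsurj
  have he : ∀ x, r (e.symm x) = x := fun x => e.apply_symm_apply x
  have hr0 : r 0 = (c 0).re := by simp [hr]
  refine ⟨e.symm, e.symm.continuous, hmono.injective (by rw [he, hr0]), fun x hx => ?_⟩
  have h0 : 0 ≤ e.symm x := by rwa [← hmono.le_iff_le, he, hr0]
  refine ⟨h0, ?_⟩
  have := he x
  simpa [hr, h0] using this

/-- If `v` avoids a flat curve that starts at `0`, and its argument `α` is small at one place, then
the argument cannot exceed `5π/2` at another place. -/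
theorem IsFlatCurve.arg_lt {σ : ℝ} {c : ℝ → ℂ} (hc : IsFlatCurve σ c) (hc0 : c 0 = 0)
    {S : Set ℝ} (hS : IsPreconnected S) {v : ℝ → ℂ} {α : ℝ → ℝ} (hv : ContinuousOn v S)
    (hα : ContinuousOn α S) (hva : ∀ τ ∈ S, v τ = ‖v τ‖ * Complex.exp (α τ * Complex.I))
    (hv0 : ∀ τ ∈ S, v τ ≠ 0) (hvc : ∀ τ ∈ S, ∀ u ≥ 0, v τ ≠ c u) {τ₁ : ℝ} (hτ₁ : τ₁ ∈ S)
    (h₁ : α τ₁ ≤ 3 / 2 * Real.pi) {τ : ℝ} (hτ : τ ∈ S) : α τ < 5 / 2 * Real.pi := by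
  by_contra! hge
  have hpi := Real.pi_pos
  obtain ⟨e, hec, he0, he⟩ := hc.exists_inverse
  rw [hc0, Complex.zero_re] at he0 he
  -- Clamping the argument to `[3π/2, 5π/2]` selects one lifted copy of the right half-plane, where
  -- the curve `c` is a graph.
  set β : ℝ → ℝ := fun τ => max (3 / 2 * Real.pi) (min (α τ) (5 / 2 * Real.pi)) with hβ
  have hβc : ContinuousOn β S := continuousOn_const.sup (hα.inf continuousOn_const)
  have hβ1 : ∀ τ, 3 / 2 * Real.pi ≤ β τ := fun τ => le_max_left _ _
  have hβ2 : ∀ τ, β τ ≤ 5 / 2 * Real.pi := fun τ => max_le (by linarith) (min_le_right _ _)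
  have hcos : ∀ τ, 0 ≤ Real.cos (β τ) := by
    intro τ
    have h := Real.cos_nonneg_of_mem_Icc (x := β τ - 2 * Real.pi)
      ⟨by linarith [hβ1 τ], by linarith [hβ2 τ]⟩
    rwa [Real.cos_sub_two_pi] at h
  set X : ℝ → ℝ := fun τ => ‖v τ‖ * Real.cos (β τ) with hX
  have hXc : ContinuousOn X S := hv.norm.mul (Real.continuous_cos.comp_continuousOn hβc)
  have hX0 : ∀ τ, 0 ≤ X τ := fun τ => mul_nonneg (norm_nonneg _) (hcos τ)
  -- `G` is the signed height above the graph of `c`: negative at `3π/2`, positive at `5π/2`. Its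
  -- zero in between is a point of `v` on `c`.
  set G : ℝ → ℝ := fun τ => ‖v τ‖ * Real.sin (β τ) - (c (e (X τ))).im with hG
  have hGc : ContinuousOn G S := by
    refine (hv.norm.mul (Real.continuous_sin.comp_continuousOn hβc)).sub ?_
    refine Complex.continuous_im.comp_continuousOn (hc.continuousOn.comp
      (hec.comp_continuousOn hXc) fun τ _ => (he _ (hX0 τ)).1)
  have hs1 : Real.sin (3 / 2 * Real.pi) = -1 := by
    rw [show 3 / 2 * Real.pi = Real.pi / 2 + Real.pi by ring, Real.sin_add_pi, Real.sin_pi_div_two]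
  have hc1 : Real.cos (3 / 2 * Real.pi) = 0 := by
    rw [show 3 / 2 * Real.pi = Real.pi / 2 + Real.pi by ring, Real.cos_add_pi, Real.cos_pi_div_two,
      neg_zero]
  have hs2 : Real.sin (5 / 2 * Real.pi) = 1 := by
    rw [show 5 / 2 * Real.pi = Real.pi / 2 + 2 * Real.pi by ring, Real.sin_add_two_pi,
      Real.sin_pi_div_two]
  have hc2 : Real.cos (5 / 2 * Real.pi) = 0 := by
    rw [show 5 / 2 * Real.pi = Real.pi / 2 + 2 * Real.pi by ring, Real.cos_add_two_pi,
      Real.cos_pi_div_two]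
  have hlow : ∀ τ, β τ = 3 / 2 * Real.pi → G τ = -‖v τ‖ := fun τ h => by
    simp only [hG, hX, h, hs1, hc1, mul_zero, he0, hc0, Complex.zero_im]; ring
  have hhigh : ∀ τ, β τ = 5 / 2 * Real.pi → G τ = ‖v τ‖ := fun τ h => by
    simp only [hG, hX, h, hs2, hc2, mul_zero, he0, hc0, Complex.zero_im]; ring
  have hb1 : β τ₁ = 3 / 2 * Real.pi := max_eq_left ((min_le_left _ _).trans h₁)
  have hb2 : β τ = 5 / 2 * Real.pi := by
    simp only [hβ, min_eq_right hge]
    exact max_eq_right (by linarith)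
  obtain ⟨τ₂, hτ₂, hz⟩ := hS.intermediate_value hτ₁ hτ hGc (show (0 : ℝ) ∈ Icc _ _ from
    ⟨by rw [hlow _ hb1]; linarith [norm_nonneg (v τ₁)], by rw [hhigh _ hb2]; exact norm_nonneg _⟩)
  have hn := norm_pos_iff.2 (hv0 τ₂ hτ₂)
  have hne1 : β τ₂ ≠ 3 / 2 * Real.pi := fun h => by rw [hlow _ h] at hz; linarith
  have hne2 : β τ₂ ≠ 5 / 2 * Real.pi := fun h => by rw [hhigh _ h] at hz; linarith
  have hβα : β τ₂ = α τ₂ := by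
    simp only [hβ] at hne1 hne2 ⊢
    rcases le_total (α τ₂) (5 / 2 * Real.pi) with h | h
    · rw [min_eq_left h] at hne1 ⊢
      rcases le_total (3 / 2 * Real.pi) (α τ₂) with h' | h'
      · exact max_eq_right h'
      · exact absurd (max_eq_left h') hne1
    · rw [min_eq_right h] at hne2
      exact absurd (max_eq_right (by linarith)) hne2
  refine hvc τ₂ hτ₂ (e (X τ₂)) (he _ (hX0 τ₂)).1 ?_
  rw [hva τ₂ hτ₂]
  apply Complex.ext
  · rw [(he _ (hX0 τ₂)).2, Complex.re_ofReal_mul, Complex.exp_ofReal_mul_I_re]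
    simp only [hX, hβα]
  · rw [Complex.im_ofReal_mul, Complex.exp_ofReal_mul_I_im, ← hβα]
    simp only [hG] at hz
    linarith

theorem IsFlatCurve.conj {σ : ℝ} {c : ℝ → ℂ} (hc : IsFlatCurve σ c) :
    IsFlatCurve σ fun u => (starRingEnd ℂ) (c u) where
  continuousOn := Complex.continuous_conj.comp_continuousOn hc.continuousOn
  re_lt u hu u' hu' := by rw [← map_sub, Complex.conj_re]; exact hc.re_lt u hu u' hu'
  slope u hu u' hu' := by
    rw [← map_sub, Complex.conj_re, Complex.conj_im, abs_neg]; exact hc.slope u hu u' hu'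
  tendsto := by simpa only [Complex.conj_re] using hc.tendsto

theorem IsFlatCurve.sub_const {σ : ℝ} {c : ℝ → ℂ} (hc : IsFlatCurve σ c) (a : ℂ) :
    IsFlatCurve σ fun u => c u - a where
  continuousOn := hc.continuousOn.sub continuousOn_const
  re_lt u hu u' hu' := by rw [sub_sub_sub_cancel_right]; exact hc.re_lt u hu u' hu'
  slope u hu u' hu' := by rw [sub_sub_sub_cancel_right]; exact hc.slope u hu u' hu'
  tendsto := by
    simp only [Complex.sub_re]
    exact tendsto_atTop_add_const_right _ (-a.re) hc.tendsto

theorem IsFlatCurve.abs_arg_lt {σ : ℝ} {c : ℝ → ℂ} (hc : IsFlatCurve σ c) (hc0 : c 0 = 0)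
    {S : Set ℝ} (hS : IsPreconnected S) {v : ℝ → ℂ} {α : ℝ → ℝ} (hv : ContinuousOn v S)
    (hα : ContinuousOn α S) (hva : ∀ τ ∈ S, v τ = ‖v τ‖ * Complex.exp (α τ * Complex.I))
    (hv0 : ∀ τ ∈ S, v τ ≠ 0) (hvc : ∀ τ ∈ S, ∀ u ≥ 0, v τ ≠ c u) {τ₁ : ℝ} (hτ₁ : τ₁ ∈ S)
    (h₁ : |α τ₁| ≤ 3 / 2 * Real.pi) {τ : ℝ} (hτ : τ ∈ S) : |α τ| < 5 / 2 * Real.pi := by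
  rw [abs_lt, neg_lt]
  refine ⟨?_, hc.arg_lt hc0 hS hv hα hva hv0 hvc hτ₁ (le_of_abs_le h₁) hτ⟩
  refine hc.conj.arg_lt (by simp [hc0]) hS (v := fun τ => (starRingEnd ℂ) (v τ))
    (α := fun τ => -α τ) (Complex.continuous_conj.comp_continuousOn hv) hα.neg (fun τ hτ => ?_)
    (fun τ hτ => by simpa using hv0 τ hτ)
    (fun τ hτ u hu h => hvc τ hτ u hu ((starRingEnd ℂ).injective h)) hτ₁
    (neg_le.1 (neg_le_of_abs_le h₁)) hτ
  conv_lhs => rw [hva τ hτ]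
  rw [map_mul, Complex.conj_ofReal, ← Complex.exp_conj]
  simp

/-- If the real part of `v` is injective, then `v` crosses the imaginary axis at most once, and its
argument does not vary much. -/
theorem abs_arg_lt_of_injOn_re {S : Set ℝ} (hS : IsPreconnected S) {v : ℝ → ℂ} {α : ℝ → ℝ}
    (hα : ContinuousOn α S) (hva : ∀ τ ∈ S, v τ = ‖v τ‖ * Complex.exp (α τ * Complex.I))
    (hv : InjOn (fun τ => (v τ).re) S) {τ₁ : ℝ} (hτ₁ : τ₁ ∈ S) (h₁ : |α τ₁| < 1 / 2 * Real.pi)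
    {τ : ℝ} (hτ : τ ∈ S) : |α τ| < 3 / 2 * Real.pi := by
  by_contra! hge
  have hpi := Real.pi_pos
  have habs : ContinuousOn (fun τ => |α τ|) S := hα.abs
  obtain ⟨a, ha, ha'⟩ := hS.intermediate_value hτ₁ hτ habs
    (show 1 / 2 * Real.pi ∈ Icc _ _ from ⟨h₁.le, by linarith⟩)
  obtain ⟨b, hb, hb'⟩ := hS.intermediate_value hτ₁ hτ habs
    (show 3 / 2 * Real.pi ∈ Icc _ _ from ⟨by linarith, hge⟩)
  have hre : ∀ τ ∈ S, (v τ).re = ‖v τ‖ * Real.cos |α τ| := fun τ hτ => by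
    conv_lhs => rw [hva τ hτ]
    rw [Complex.re_ofReal_mul, Complex.exp_ofReal_mul_I_re, Real.cos_abs]
  have hc1 : Real.cos (1 / 2 * Real.pi) = 0 := by
    rw [one_div, inv_mul_eq_div, Real.cos_pi_div_two]
  have hc2 : Real.cos (3 / 2 * Real.pi) = 0 := by
    rw [show 3 / 2 * Real.pi = Real.pi / 2 + Real.pi by ring, Real.cos_add_pi, Real.cos_pi_div_two,
      neg_zero]
  simp only at ha' hb'
  have hab : a = b := hv ha hb (by
    simp only
    rw [hre a ha, hre b hb, ha', hb', hc1, hc2, mul_zero, mul_zero])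
  rw [hab, hb'] at ha'
  linarith

/-! ### An a priori bound for the roots -/

theorem IsRayRoot.mem_escapingParameters {s : Address} {t : ℝ} {κ : ℂ} (h : IsRayRoot s t κ)
    (ha : Admissible s t) : κ ∈ escapingParameters := by
  obtain ⟨N, hN⟩ := ha.exists_tailPotential_le ‖κ‖
  refine tendsto_atTop_mono' _ ?_ (tendsto_atTop_add_const_right _ (-κ.re - 2)
    (tendsto_iterate_F ha.pos))
  filter_upwards [eventually_ge_atTop N] with n hn
  have h1 := (hN n hn t le_rfl κ le_rfl).le
  rw [h.iterate_E_zero ha h1]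
  have h2 := (inTail_of_tailPotential_le h1).norm_tailRay_sub_le_two (ha.1.iterate n)
  have h3 := (abs_le.1 ((Complex.abs_re_le_norm _).trans h2)).1
  have h4 := Complex.re_le_norm (tailRay κ (shift^[n] s) (F^[n] t))
  simp at h3
  linarith

theorem tailPotential_le_of_le {κ : ℂ} {s : Address} {t : ℝ} (hs : ExpBounded s) {n i : ℕ}
    (hn : tailPotential κ (shift^[n] s) ≤ F^[n] t) (hi : n ≤ i) {τ : ℝ} (hτ : t ≤ τ) :
    tailPotential κ (shift^[i] s) ≤ F^[i] τ := by
  obtain ⟨m, rfl⟩ := Nat.exists_eq_add_of_le' hi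
  rw [Function.iterate_add_apply, Function.iterate_add_apply]
  exact tailPotential_iterate_le (hs.iterate n)
    (hn.trans ((iterate_F_strictMono n).monotone hτ)) m

/-- The data of a root `κ` with large real part for which `n` is the first level at which the ray
piece consists of points on the ray tail. -/
structure IsFarRoot (κ : ℂ) (s : Address) (t : ℝ) (γ : ℝ → ℂ) (b : ℝ) (n : ℕ) : Prop where
  admissible : Admissible s t
  escaping : κ ∈ escapingParameters
  piece : IsRayPiece κ s t γ
  root : γ t = 0
  one_le : 1 ≤ b
  im_le : |κ.im| ≤ b
  le_re : 100 * (b + 1) ≤ κ.re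
  tail : tailPotential κ (shift^[n] s) ≤ F^[n] t
  supPotential_le : ∀ i < n, supPotential (shift^[i] s) ≤ b
  pos : 0 < n
  potential_le : F^[n] t ≤ F (2 * b)

namespace IsFarRoot

variable {κ : ℂ} {s : Address} {t : ℝ} {γ : ℝ → ℂ} {b : ℝ} {n : ℕ}

theorem abs_address_le (h : IsFarRoot κ s t γ b n) {i : ℕ} (hi : i < n) (k : ℕ) :
    |(s (i + k) : ℝ)| ≤ F^[k] b := by
  have h1 := (h.admissible.1.iterate i).abs_le k
  rw [shift_iterate_apply] at h1
  exact h1.trans ((iterate_F_strictMono k).monotone (h.supPotential_le i hi))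

/-- If all imaginary parts up to level `n` were moderate, growth would give `Re (E^n(0) + κ) ≥ e^{Re
κ} / 2`, whereas the tail point `E^n(0)` allows at most `F^n(t) + 2 ≤ e^{2b} + 1`. -/
theorem exists_large_im (h : IsFarRoot κ s t γ b n) :
    ∃ p, 20 * F^[p + 1] b < |((E κ)^[p + 1] 0 + κ).im| ∧
      ∀ i ≤ p, |((E κ)^[i] 0 + κ).im| ≤ 20 * F^[i] b := by
  classical
  have hb := h.one_le
  have hex : ∃ k, k ≤ n ∧ 20 * F^[k] b < |((E κ)^[k] 0 + κ).im| := by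
    by_contra! hall
    obtain ⟨m, hm⟩ : ∃ m, n = m + 1 := ⟨n - 1, by have := h.pos; omega⟩
    obtain ⟨h1, h2⟩ := orbit_growth h.escaping hb h.im_le h.le_re n hall
    have h3 := h2 m (by omega)
    have h4 := (h1 m (by omega)).1
    have h5 : (E κ)^[n] 0 = tailRay κ (shift^[n] s) (F^[n] t) := by
      rw [← h.root]; exact h.piece.iterate_E_eq h.admissible.1 le_rfl h.tail
    have h6 := (inTail_of_tailPotential_le h.tail).norm_tailRay_sub_le_two (h.admissible.1.iterate n)
    have h7 := (abs_le.1 ((Complex.abs_re_le_norm _).trans h6)).2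
    rw [← hm, h5] at h3
    simp at h7 h3
    have h8 : Real.exp (2 * b) * 100 ≤ Real.exp ((E κ)^[m] 0 + κ).re := by
      have q := Real.add_one_le_exp (99 : ℝ)
      calc Real.exp (2 * b) * 100 ≤ Real.exp (2 * b) * Real.exp 99 := by gcongr; linarith
        _ = Real.exp (2 * b + 99) := (Real.exp_add _ _).symm
        _ ≤ _ := by gcongr; linarith [h.le_re]
    have h9 := h.potential_le
    have hF : F (2 * b) = Real.exp (2 * b) - 1 := rfl
    rw [Complex.add_re] at h8
    have h10 := Real.add_one_le_exp (2 * b)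
    linarith
  obtain ⟨hk1, hk2⟩ := Nat.find_spec hex
  have hk3 : ∀ i < Nat.find hex, |((E κ)^[i] 0 + κ).im| ≤ 20 * F^[i] b := by
    intro i hi
    have := Nat.find_min hex hi
    push Not at this
    exact this (by omega)
  cases hfind : Nat.find hex with
  | zero =>
    rw [hfind] at hk2
    simp at hk2
    have := h.im_le
    linarith
  | succ p =>
    rw [hfind] at hk1 hk2 hk3
    exact ⟨p, hk2, fun i hi => hk3 i (by omega)⟩

/-- With `u = F^i(b)` and `y` the real part at level `i`, the next real part is at least `e^y / 4`,
and the imaginary part is at most `21 e^u`. Since `y ≥ 100(u + 1)` and `u ≥ 1 + i/2`, the factor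
`4^{i+2}` is absorbed. -/
theorem orbit_cone (h : IsFarRoot κ s t γ b n) {p : ℕ}
    (hp : ∀ i ≤ p, |((E κ)^[i] 0 + κ).im| ≤ 20 * F^[i] b) (j : ℕ) (hj : 1 ≤ j) (hjp : j ≤ p) :
    0 < ((E κ)^[j] 0).re ∧ |((E κ)^[j] 0).im| ≤ (1 / 4) ^ (j + 1) * ((E κ)^[j] 0).re := by
  obtain ⟨h1, h2⟩ := orbit_growth h.escaping h.one_le h.im_le h.le_re p hp
  obtain ⟨i, rfl⟩ : ∃ i, j = i + 1 := ⟨j - 1, by omega⟩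
  obtain ⟨h3, h4, -⟩ := h1 i (by omega)
  have h5 := h2 i (by omega)
  have h6 := hp (i + 1) hjp
  have hb := h.one_le
  have him := h.im_le
  set y := ((E κ)^[i] 0 + κ).re with hy
  set u := F^[i] b with hu
  have hu1 : 1 + (i : ℝ) / 2 ≤ u := half_add_le_iterate_F hb i
  have hbu : b ≤ u := le_iterate_F i b
  have hF : F^[i + 1] b = Real.exp u - 1 := by rw [Function.iterate_succ_apply']; rfl
  have hy0 := Real.quadratic_le_exp_of_nonneg (show 0 ≤ y by linarith)
  have hre : Real.exp y / 4 ≤ ((E κ)^[i + 1] 0).re := by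
    rw [Complex.add_re] at h5
    nlinarith
  have hexp0 := Real.exp_pos y
  refine ⟨by linarith, ?_⟩
  have him' : |((E κ)^[i + 1] 0).im| ≤ 21 * Real.exp u := by
    have e1 : ((E κ)^[i + 1] 0).im = ((E κ)^[i + 1] 0 + κ).im - κ.im := by simp
    rw [e1]
    refine (abs_sub _ _).trans ?_
    have := Real.add_one_le_exp u
    rw [hF] at h6
    linarith
  have h4e : (4 : ℝ) ^ (i + 1 + 1) ≤ Real.exp (2 * (i + 2)) := by
    have : (4 : ℝ) ≤ Real.exp 2 := by
      have := Real.quadratic_le_exp_of_nonneg (show (0 : ℝ) ≤ 2 by norm_num)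
      linarith
    calc (4 : ℝ) ^ (i + 1 + 1) ≤ Real.exp 2 ^ (i + 1 + 1) := by gcongr
      _ = _ := by rw [← Real.exp_nat_mul]; push_cast; ring_nf
  have h84 : (84 : ℝ) ≤ Real.exp 14 := by
    have := Real.quadratic_le_exp_of_nonneg (show (0 : ℝ) ≤ 14 by norm_num)
    linarith
  have hbig : (4 : ℝ) ^ (i + 1 + 1) * (84 * Real.exp u) ≤ Real.exp y := by
    calc (4 : ℝ) ^ (i + 1 + 1) * (84 * Real.exp u)
        ≤ Real.exp (2 * (i + 2)) * (Real.exp 14 * Real.exp u) := by gcongr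
      _ = Real.exp (2 * (i + 2) + (14 + u)) := by rw [Real.exp_add, Real.exp_add 14]
      _ ≤ _ := by gcongr; linarith
  have hq : ((1 : ℝ) / 4) ^ (i + 1 + 1) * 4 ^ (i + 1 + 1) = 1 := by
    rw [← mul_pow]; norm_num
  have hq0 : 0 < ((1 : ℝ) / 4) ^ (i + 1 + 1) := by positivity
  calc _ ≤ 21 * Real.exp u := him'
    _ = (((1 : ℝ) / 4) ^ (i + 1 + 1) * 4 ^ (i + 1 + 1)) * (84 * Real.exp u) / 4 := by
        rw [hq]; ring
    _ = ((1 : ℝ) / 4) ^ (i + 1 + 1) * (4 ^ (i + 1 + 1) * (84 * Real.exp u) / 4) := by ring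
    _ ≤ ((1 : ℝ) / 4) ^ (i + 1 + 1) * ((E κ)^[i + 1] 0).re := by
        gcongr; linarith

/-- The imaginary parts on all images of the ray piece are close to those on the ray tails. -/
theorem abs_im_sub_lt (h : IsFarRoot κ s t γ b n) {p : ℕ}
    (hp1 : 20 * F^[p + 1] b < |((E κ)^[p + 1] 0 + κ).im|)
    (hp : ∀ i ≤ p, |((E κ)^[i] 0 + κ).im| ≤ 20 * F^[i] b) (i : ℕ) :
    ∀ τ ≥ t, |((E κ)^[i] (γ τ) + κ).im - 2 * Real.pi * s i| < 5 / 2 * Real.pi := by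
  have hs := h.admissible.1
  have hpi := Real.pi_pos
  have hb := h.one_le
  obtain ⟨c, hc, hc0, hcE⟩ := exists_flatCurve p (h.orbit_cone hp)
  have htail : ∀ (i : ℕ) (τ : ℝ), t ≤ τ → tailPotential κ (shift^[i] s) ≤ F^[i] τ →
      |((E κ)^[i] (γ τ) + κ).im - 2 * Real.pi * s i| < 1 / 2 * Real.pi := by
    intro i τ hτ hi
    rw [h.piece.iterate_E_eq hs hτ hi]
    have := (inTail_of_tailPotential_le hi).abs_im_tailRay_sub_lt (hs.iterate i)
    rw [shift_iterate_zero] at this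
    linarith
  -- Downward induction on the level: the bound at level `i` uses the bound at the later level `i +
  -- p + 2`.
  suffices hsuf : ∀ d i : ℕ, n ≤ i + d → ∀ τ ≥ t,
      |((E κ)^[i] (γ τ) + κ).im - 2 * Real.pi * s i| < 5 / 2 * Real.pi from
    hsuf n i (Nat.le_add_left _ _)
  intro d
  induction d with
  | zero =>
    intro i hi τ hτ
    have := htail i τ hτ (tailPotential_le_of_le hs h.tail hi hτ)
    linarith
  | succ d ih =>
    intro i hi τ hτ
    rcases le_or_gt n i with hni | hni
    · have := htail i τ hτ (tailPotential_le_of_le hs h.tail hni hτ)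
      linarith
    have hEc : ∀ m : ℕ, ContinuousOn (fun τ => (E κ)^[m] (γ τ)) (Ici t) := fun m =>
      ((continuous_E κ).iterate m).comp_continuousOn h.piece.1
    set v : ℝ → ℂ := fun τ => (E κ)^[i + 1] (γ τ) with hv
    set α : ℝ → ℝ := fun τ => ((E κ)^[i] (γ τ) + κ).im - 2 * Real.pi * s i with hα
    have hvexp : ∀ τ, v τ = Complex.exp ((E κ)^[i] (γ τ) + κ) := fun τ => by
      simp only [hv]
      rw [Function.iterate_succ_apply', E]
    have hαc : ContinuousOn α (Ici t) :=
      (Complex.continuous_im.comp_continuousOn ((hEc i).add continuousOn_const)).sub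
        continuousOn_const
    have hva : ∀ τ ∈ Ici t, v τ = ‖v τ‖ * Complex.exp (α τ * Complex.I) := by
      intro τ _
      have h1 : ((α τ : ℝ) : ℂ) * Complex.I = (((E κ)^[i] (γ τ) + κ).im : ℂ) * Complex.I -
          (s i : ℂ) * (2 * Real.pi * Complex.I) := by
        simp only [hα]; push_cast; ring
      rw [h1, Complex.exp_sub, Complex.exp_int_mul_two_pi_mul_I, div_one, hvexp,
        Complex.norm_exp, Complex.ofReal_exp, ← Complex.exp_add, Complex.re_add_im]
    have hv0 : ∀ τ ∈ Ici t, v τ ≠ 0 := fun τ _ => by rw [hvexp]; exact Complex.exp_ne_zero _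
    set τ₁ := max t (tailPotential κ (shift^[i] s)) with hτ₁
    have hτ₁t : t ≤ τ₁ := le_max_left _ _
    have hα₁ : |α τ₁| < 1 / 2 * Real.pi :=
      htail i τ₁ hτ₁t ((le_max_right _ _).trans (le_iterate_F i τ₁))
    rcases Nat.lt_or_ge (i + 1) n with hin | hin
    -- If `v` met the flat curve, `p + 1` further steps would lead to `e^u E^{p+1}(0)`, whose
    -- imaginary part is too large for `ih` and the address bound. So `v` cannot wind around `0`.
    · refine (hc.sub_const κ).abs_arg_lt (by simp [hc0]) isPreconnected_Ici (hEc (i + 1)) hαc hva hv0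
        (fun τ hτ u hu hcu => ?_) hτ₁t (by linarith) hτ
      have h1 : (E κ)^[p] (v τ) = (E κ)^[p] 0 + u := by
        rw [show v τ = c u - κ from hcu, hcE u hu]
      have h2 : (E κ)^[(p + 1) + (i + 1)] (γ τ) = Real.exp u * (E κ)^[p + 1] 0 := by
        rw [Function.iterate_add_apply]
        change (E κ)^[p + 1] (v τ) = _
        rw [Function.iterate_succ_apply', h1, orbit_succ, E, Complex.ofReal_exp, ← Complex.exp_add]
        congr 1; ring
      have h3 := ih ((i + 1) + (p + 1)) (by omega) τ hτ
      rw [add_comm (i + 1) (p + 1), h2, Complex.add_im, Complex.im_ofReal_mul] at h3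
      have h4 := h.abs_address_le hin (p + 1)
      rw [add_comm (i + 1) (p + 1)] at h4
      set f := F^[p + 1] b
      have hbf : b ≤ f := le_iterate_F (p + 1) b
      have h5 : |((E κ)^[p + 1] 0).im| ≤ |Real.exp u * ((E κ)^[p + 1] 0).im| := by
        rw [abs_mul, Real.abs_exp]
        exact le_mul_of_one_le_left (abs_nonneg _) (Real.one_le_exp hu)
      have h6 : |((E κ)^[p + 1] 0 + κ).im| ≤ |((E κ)^[p + 1] 0).im| + |κ.im| := by
        rw [Complex.add_im]; exact abs_add_le _ _
      have h7 : |Real.exp u * ((E κ)^[p + 1] 0).im| ≤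
          |Real.exp u * ((E κ)^[p + 1] 0).im + κ.im - 2 * Real.pi * s (p + 1 + (i + 1))| + |κ.im| +
            |2 * Real.pi * s (p + 1 + (i + 1))| := by
        have := abs_add_three (Real.exp u * ((E κ)^[p + 1] 0).im + κ.im -
          2 * Real.pi * s (p + 1 + (i + 1))) (-κ.im) (2 * Real.pi * s (p + 1 + (i + 1)))
        rw [abs_neg] at this
        refine le_trans (le_of_eq ?_) this
        congr 1; ring
      have h8 : |2 * Real.pi * (s (p + 1 + (i + 1)) : ℝ)| ≤ 2 * 3.15 * f := by
        rw [abs_mul, abs_of_pos (by positivity)]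
        have := Real.pi_lt_d2
        gcongr
      have h9 := h.im_le
      have := Real.pi_lt_d2
      linarith
    -- At this level the address bound is not available. Instead `v` is a ray tail, whose real part
    -- increases with the potential.
    · have hin' : i + 1 = n := by omega
      have hκ : 17 ≤ ‖κ‖ := by
        have := Complex.re_le_norm κ
        linarith [h.le_re]
      have hvt : ∀ τ ∈ Ici t, v τ = tailRay κ (shift^[n] s) (F^[n] τ) := by
        intro τ hτ
        simp only [hv, hin']
        exact h.piece.iterate_E_eq hs hτ (tailPotential_le_of_le hs h.tail le_rfl hτ)
      have hinj : StrictMonoOn (fun τ => (v τ).re) (Ici t) := by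
        intro τ hτ τ' hτ' hlt
        simp only
        rw [hvt τ hτ, hvt τ' hτ']
        exact (inTail_of_tailPotential_le (tailPotential_le_of_le hs h.tail le_rfl hτ)).re_tailRay_lt
          hκ (hs.iterate n) (iterate_F_strictMono n hlt)
      have := abs_arg_lt_of_injOn_re isPreconnected_Ici hαc hva hinj.injOn hτ₁t hα₁ hτ
      exact this.trans (by linarith)

/-- At the endpoint `γ t = 0` and level `p + 1`, the imaginary part is at most `2πF^{p+1}(b) + 5π/2
< 20F^{p+1}(b)`, against the choice of `p`. -/
theorem false (h : IsFarRoot κ s t γ b n) : False := by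
  obtain ⟨p, hp1, hp⟩ := h.exists_large_im
  have h1 := h.abs_im_sub_lt hp1 hp (p + 1) t le_rfl
  rw [h.root] at h1
  have h2 := h.abs_address_le h.pos (p + 1)
  rw [zero_add] at h2
  have hb := h.one_le
  set f := F^[p + 1] b
  have hbf : b ≤ f := le_iterate_F (p + 1) b
  have h3 : |((E κ)^[p + 1] 0 + κ).im| ≤ |((E κ)^[p + 1] 0 + κ).im - 2 * Real.pi * s (p + 1)| +
      |2 * Real.pi * s (p + 1)| := by
    have := abs_add_le (((E κ)^[p + 1] 0 + κ).im - 2 * Real.pi * s (p + 1))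
      (2 * Real.pi * s (p + 1))
    rwa [sub_add_cancel] at this
  have h4 : |2 * Real.pi * (s (p + 1) : ℝ)| ≤ 2 * 3.15 * f := by
    have := Real.pi_pos
    rw [abs_mul, abs_of_pos (by positivity)]
    have := Real.pi_lt_d2
    gcongr
  have := Real.pi_lt_d2
  linarith

end IsFarRoot

theorem exists_re_bound {s : Address} {t₁ : ℝ} (ha : Admissible s t₁) (M : ℝ) :
    ∃ X : ℝ, ∀ t ≥ t₁, ∀ κ : ℂ, IsRayRoot s t κ → |κ.im| ≤ M →
      κ.re ≤ X ∨ tailPotential κ s ≤ t := by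
  obtain ⟨B, hB0, hB⟩ := ha.exists_supPotential_bound
  -- Chosen so that `Re κ > X` implies `100(b + 1) ≤ Re κ` for `b = B + |M| + 1 + C`. The tangent of
  -- `log` at `1000` bounds `100 C` by `Re κ / 5` plus constants, and `5 / 4` absorbs that fifth.
  refine ⟨(100 * (B + |M| + 2) + (|M| + 3) / 5 + 200 * Real.log 1000) * (5 / 4),
    fun t ht κ hκ hM => ?_⟩
  by_contra! hcon
  obtain ⟨hre, hnt⟩ := hcon
  have hat := ha.mono ht
  obtain ⟨γ, hγ, h0⟩ := (isRayRoot_iff hat).1 hκ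
  have hM0 := abs_nonneg M
  have hMM := le_abs_self M
  have hlogpos : 0 < Real.log 1000 := Real.log_pos (by norm_num)
  have hκre : 0 < κ.re := lt_trans (by positivity) hre
  set C := 2 * Real.log (‖κ‖ + 3) with hC
  have hC0 : 0 < C := by have := log_norm_add_three_pos κ; linarith
  have hlog : 100 * C ≤ (κ.re + |M| + 3) / 5 + 200 * Real.log 1000 := by
    have hn : 0 < ‖κ‖ + 3 := by have := norm_nonneg κ; linarith
    have h1 := Real.log_le_sub_one_of_pos (show 0 < (‖κ‖ + 3) / 1000 by positivity)
    rw [Real.log_div hn.ne' (by norm_num)] at h1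
    have h2 := Complex.norm_le_abs_re_add_abs_im κ
    rw [abs_of_pos hκre] at h2
    linarith
  classical
  have hex : ∃ n, tailPotential κ (shift^[n] s) ≤ F^[n] t := by
    obtain ⟨N, hN⟩ := hat.exists_tailPotential_le ‖κ‖
    exact ⟨N, (hN N le_rfl t le_rfl κ le_rfl).le⟩
  have hmin : ∀ i < Nat.find hex, F^[i] t < supPotential (shift^[i] s) + C := fun i hi =>
    not_le.1 (Nat.find_min hex hi)
  have hsup : ∀ i < Nat.find hex, supPotential (shift^[i] s) ≤ B + C := fun i hi =>
    hB C hC0.le t ht i (hmin i hi)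
  have hpos : 0 < Nat.find hex := by
    rw [Nat.pos_iff_ne_zero, Ne, Nat.find_eq_zero]
    exact not_le.2 hnt
  refine IsFarRoot.false (κ := κ) (s := s) (t := t) (γ := γ) (b := B + |M| + 1 + C)
    (n := Nat.find hex) ⟨hat, hκ.mem_escapingParameters hat, hγ, h0, by linarith, by linarith,
      by linarith, Nat.find_spec hex, fun i hi => by linarith [hsup i hi], hpos, ?_⟩
  obtain ⟨m, hm⟩ : ∃ m, Nat.find hex = m + 1 := ⟨Nat.find hex - 1, by omega⟩
  rw [hm, Function.iterate_succ_apply']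
  refine F_strictMono.monotone ?_
  have h1 := hmin m (by omega)
  have h2 := hsup m (by omega)
  linarith

/-! ### Zeros of holomorphic functions depending continuously on a parameter -/

/-- The minimum modulus principle. -/
theorem le_norm_of_forall_sphere {g : ℂ → ℂ} {z : ℂ} {r δ : ℝ} (hr : 0 < r) (hδ : 0 < δ)
    (hg : DifferentiableOn ℂ g (Metric.closedBall z r))
    (h0 : ∀ w ∈ Metric.closedBall z r, g w ≠ 0) (hs : ∀ w ∈ Metric.sphere z r, δ ≤ ‖g w‖)
    {w : ℂ} (hw : w ∈ Metric.closedBall z r) : δ ≤ ‖g w‖ := by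
  have hd : DifferentiableOn ℂ (fun w => (g w)⁻¹) (Metric.closedBall z r) := hg.inv h0
  have hcl : closure (Metric.ball z r) = Metric.closedBall z r := closure_ball z hr.ne'
  have h1 := Complex.norm_le_of_forall_mem_frontier_norm_le (f := fun w => (g w)⁻¹) (C := δ⁻¹)
    (U := Metric.ball z r) Metric.isBounded_ball (hd.diffContOnCl_ball subset_rfl) (fun w hw => by
      rw [frontier_ball z hr.ne'] at hw
      rw [norm_inv]
      exact inv_anti₀ hδ (hs w hw)) (hcl ▸ hw)
  rw [norm_inv] at h1
  exact (inv_le_inv₀ (norm_pos_iff.2 (h0 w hw)) hδ).1 h1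

/-- `f κ τ` is defined for `κ` near `κ₀` and `τ` near `t₀`, continuous in both variables and
holomorphic in `κ`. -/
structure IsLocalFamily (f : ℂ → ℝ → ℂ) (κ₀ : ℂ) (t₀ ε : ℝ) : Prop where
  pos : 0 < ε
  cont : ContinuousOn (fun p : ℂ × ℝ => f p.1 p.2) (Metric.ball κ₀ ε ×ˢ Ici (t₀ - ε))
  diff : ∀ τ ≥ t₀ - ε, DifferentiableOn ℂ (fun κ => f κ τ) (Metric.ball κ₀ ε)

namespace IsLocalFamily

variable {f : ℂ → ℝ → ℂ} {κ₀ : ℂ} {t₀ ε : ℝ}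

theorem continuousAt (h : IsLocalFamily f κ₀ t₀ ε) {κ : ℂ} (hκ : κ ∈ Metric.ball κ₀ ε) :
    ContinuousAt (fun p : ℂ × ℝ => f p.1 p.2) (κ, t₀) :=
  h.cont.continuousAt (prod_mem_nhds (Metric.isOpen_ball.mem_nhds hκ)
    (Ici_mem_nhds (by linarith [h.pos])))

theorem eventually_diff (h : IsLocalFamily f κ₀ t₀ ε) :
    ∀ᶠ τ in 𝓝 t₀, DifferentiableOn ℂ (fun κ => f κ τ) (Metric.ball κ₀ ε) := by
  filter_upwards [Ici_mem_nhds (show t₀ - ε < t₀ by linarith [h.pos])] with τ hτ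
  exact h.diff τ hτ

theorem tendstoLocallyUniformlyOn (h : IsLocalFamily f κ₀ t₀ ε) :
    TendstoLocallyUniformlyOn (fun τ κ => f κ τ) (fun κ => f κ t₀) (𝓝 t₀) (Metric.ball κ₀ ε) := by
  rw [Metric.tendstoLocallyUniformlyOn_iff]
  intro η hη κ hκ
  have h1 := Metric.continuousAt_iff'.1 (h.continuousAt hκ) (η / 2) (by linarith)
  rw [nhds_prod_eq] at h1
  obtain ⟨U, hU, V, hV, hUV⟩ := mem_prod_iff.1 h1
  refine ⟨U, mem_nhdsWithin_of_mem_nhds hU, ?_⟩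
  filter_upwards [hV] with τ hτ y hy
  have a1 := hUV (mk_mem_prod hy hτ)
  have a2 := hUV (mk_mem_prod hy (mem_of_mem_nhds hV))
  exact (dist_triangle_right _ _ (f κ t₀)).trans_lt ((add_lt_add a2 a1).trans_eq (add_halves η))

/-- Joint continuity gives locally uniform convergence in `κ` as `τ → t₀`, which for holomorphic
functions passes to derivatives. -/
theorem continuousAt_deriv (h : IsLocalFamily f κ₀ t₀ ε) :
    ContinuousAt (fun p : ℂ × ℝ => deriv (fun κ => f κ p.2) p.1) (κ₀, t₀) := by
  have h1 := h.tendstoLocallyUniformlyOn.deriv h.eventually_diff Metric.isOpen_ball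
  rw [Metric.tendstoLocallyUniformlyOn_iff] at h1
  rw [Metric.continuousAt_iff']
  intro η hη
  have hmem := Metric.mem_ball_self (x := κ₀) h.pos
  obtain ⟨U, hU, hU'⟩ := h1 (η / 2) (by linarith) κ₀ hmem
  rw [Metric.isOpen_ball.nhdsWithin_eq hmem] at hU
  have hd : ContinuousAt (deriv fun κ => f κ t₀) κ₀ :=
    ((h.diff t₀ (by linarith [h.pos])).deriv Metric.isOpen_ball).continuousOn.continuousAt
      (Metric.isOpen_ball.mem_nhds hmem)
  have h2 := Metric.continuousAt_iff'.1 hd (η / 2) (by linarith)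
  rw [nhds_prod_eq]
  filter_upwards [prod_mem_prod (inter_mem hU h2) hU'] with p hp
  have a1 : dist (deriv (fun κ => f κ t₀) p.1) (deriv (fun κ => f κ p.2) p.1) < η / 2 :=
    hp.2 p.1 hp.1.1
  have a2 : dist (deriv (fun κ => f κ t₀) p.1) (deriv (fun κ => f κ t₀) κ₀) < η / 2 := hp.1.2
  rw [dist_comm] at a1
  exact (dist_triangle _ (deriv (fun κ => f κ t₀) p.1) _).trans_lt
    ((add_lt_add a1 a2).trans_eq (add_halves η))

theorem exists_sphere (h : IsLocalFamily f κ₀ t₀ ε)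
    (hz : ¬ ∀ᶠ κ in 𝓝 κ₀, f κ t₀ = 0) {r : ℝ} (hr : 0 < r) :
    ∃ r' > 0, r' < r ∧ r' < ε ∧ ∃ δ > 0, ∀ κ ∈ Metric.sphere κ₀ r', δ ≤ ‖f κ t₀‖ := by
  have hmem := Metric.mem_ball_self (x := κ₀) h.pos
  have han : AnalyticAt ℂ (fun κ => f κ t₀) κ₀ :=
    (h.diff t₀ (by linarith [h.pos])).analyticAt (Metric.isOpen_ball.mem_nhds hmem)
  have h1 := han.eventually_eq_zero_or_eventually_ne_zero.resolve_left hz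
  rw [eventually_nhdsWithin_iff] at h1
  obtain ⟨ρ, hρ, hρ'⟩ := Metric.eventually_nhds_iff_ball.1 h1
  set r' := min (min r ε) ρ / 2 with hr'
  have hp : 0 < min (min r ε) ρ := lt_min (lt_min hr h.pos) hρ
  have e1 : min (min r ε) ρ ≤ r := (min_le_left _ _).trans (min_le_left _ _)
  have e2 : min (min r ε) ρ ≤ ε := (min_le_left _ _).trans (min_le_right _ _)
  have e3 : min (min r ε) ρ ≤ ρ := min_le_right _ _
  have hsub : Metric.sphere κ₀ r' ⊆ Metric.ball κ₀ ε := fun κ hκ => by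
    rw [mem_sphere_iff_norm] at hκ
    rw [mem_ball_iff_norm, hκ]; linarith
  have hne : (Metric.sphere κ₀ r').Nonempty := NormedSpace.sphere_nonempty.2 (by linarith)
  obtain ⟨m, hm, hmin⟩ := (isCompact_sphere κ₀ r').exists_isMinOn hne
    ((h.diff t₀ (by linarith [h.pos])).continuousOn.mono hsub).norm
  refine ⟨r', by linarith, by linarith, by linarith, ‖f m t₀‖, norm_pos_iff.2 (hρ' m ?_ ?_),
    fun κ hκ => hmin hκ⟩
  · rw [mem_sphere_iff_norm] at hm
    rw [mem_ball_iff_norm, hm]; linarith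
  · rintro rfl
    rw [mem_sphere_iff_norm, sub_self, norm_zero] at hm
    linarith

theorem eventually_sphere (h : IsLocalFamily f κ₀ t₀ ε) {r δ : ℝ} (hrε : r < ε)
    (hδ : 0 < δ) (hs : ∀ κ ∈ Metric.sphere κ₀ r, δ ≤ ‖f κ t₀‖) :
    ∀ᶠ τ in 𝓝 t₀, ∀ κ ∈ Metric.sphere κ₀ r, δ / 2 ≤ ‖f κ τ‖ := by
  have h1 := (isCompact_sphere κ₀ r).eventually_forall_of_forall_eventually (x₀ := t₀)
    (P := fun τ κ => δ / 2 ≤ ‖f κ τ‖) (fun κ hκ => by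
      have hc := (h.continuousAt (κ := κ) (by
        rw [mem_sphere_iff_norm] at hκ
        rw [mem_ball_iff_norm, hκ]; exact hrε)).norm
      have h2 := hc.eventually_const_lt (show δ / 2 < ‖f κ t₀‖ by linarith [hs κ hκ])
      have h3 : Tendsto (fun p : ℝ × ℂ => (p.2, p.1)) (𝓝 (t₀, κ)) (𝓝 (κ, t₀)) :=
        continuous_swap.tendsto (t₀, κ)
      filter_upwards [h3.eventually h2] with p hp using hp.le)
  exact h1

/-- Hurwitz: zeros persist. -/
theorem eventually_exists_zero (h : IsLocalFamily f κ₀ t₀ ε) (h0 : f κ₀ t₀ = 0)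
    (hz : ¬ ∀ᶠ κ in 𝓝 κ₀, f κ t₀ = 0) {r : ℝ} (hr : 0 < r) :
    ∀ᶠ τ in 𝓝 t₀, ∃ κ ∈ Metric.ball κ₀ r, f κ τ = 0 := by
  obtain ⟨r', hr'0, hr'r, hr'ε, δ, hδ, hs⟩ := h.exists_sphere hz hr
  have hmem := Metric.mem_ball_self (x := κ₀) h.pos
  have hc0 : Tendsto (fun τ => ‖f κ₀ τ‖) (𝓝 t₀) (𝓝 ‖f κ₀ t₀‖) :=
    (tendsto_uncurry_comp (f := f) (h.continuousAt hmem) tendsto_const_nhds tendsto_id).norm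
  rw [h0, norm_zero] at hc0
  filter_upwards [h.eventually_sphere hr'ε hδ hs, h.eventually_diff,
    hc0.eventually_lt_const (show (0 : ℝ) < δ / 2 by linarith)] with τ h1 h2 h3
  -- Without zeros in the disk, the minimum modulus principle would bound the value at the centre
  -- from below by `δ / 2`, while this value tends to `0`.
  by_contra! hno
  have := le_norm_of_forall_sphere hr'0 (by linarith : 0 < δ / 2)
    (h2.mono (Metric.closedBall_subset_ball hr'ε))
    (fun w hw => hno w (Metric.closedBall_subset_ball hr'r hw)) h1
    (Metric.mem_closedBall_self hr'0.le)
  linarith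

/-- Near a simple zero the functions are injective for all nearby parameters. -/
theorem eventually_injOn (h : IsLocalFamily f κ₀ t₀ ε) (hd : deriv (fun κ => f κ t₀) κ₀ ≠ 0) :
    ∃ r > 0, ∀ᶠ τ in 𝓝 t₀, InjOn (fun κ => f κ τ) (Metric.ball κ₀ r) ∧
      ∀ κ ∈ Metric.ball κ₀ r, deriv (fun κ => f κ τ) κ ≠ 0 := by
  set a := deriv (fun κ => f κ t₀) κ₀ with ha
  have ha0 : 0 < ‖a‖ := norm_pos_iff.2 hd
  have h1 := Metric.continuousAt_iff'.1 h.continuousAt_deriv (‖a‖ / 2) (by linarith)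
  rw [nhds_prod_eq] at h1
  obtain ⟨U, hU, V, hV, hUV⟩ := mem_prod_iff.1 h1
  obtain ⟨ρ, hρ, hρU⟩ := Metric.mem_nhds_iff.1 hU
  refine ⟨min ρ ε, lt_min hρ h.pos, ?_⟩
  filter_upwards [hV, h.eventually_diff] with τ hτ hdiff
  have hbd : ∀ κ ∈ Metric.ball κ₀ (min ρ ε), ‖deriv (fun κ => f κ τ) κ - a‖ < ‖a‖ / 2 := by
    intro κ hκ
    have := hUV (mk_mem_prod (hρU (Metric.ball_subset_ball (min_le_left _ _) hκ)) hτ)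
    rwa [mem_ofPred_eq, dist_eq_norm] at this
  have hdat : ∀ κ ∈ Metric.ball κ₀ (min ρ ε), DifferentiableAt ℂ (fun κ => f κ τ) κ := fun κ hκ =>
    hdiff.differentiableAt (Metric.isOpen_ball.mem_nhds
      (Metric.ball_subset_ball (min_le_right _ _) hκ))
  refine ⟨fun κ₁ hκ₁ κ₂ hκ₂ heq => ?_, fun κ hκ h0 => ?_⟩
  -- The map differs from the linear map `a κ` by a function with Lipschitz constant `‖a‖ / 2`,
  -- hence is injective.
  · have h2 := Convex.norm_image_sub_le_of_norm_hasDerivWithin_le (f := fun κ => f κ τ - a * κ)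
      (f' := fun κ => deriv (fun κ => f κ τ) κ - a) (C := ‖a‖ / 2) (fun κ hκ =>
        ((hdat κ hκ).hasDerivAt.sub (by
          simpa using (hasDerivAt_id κ).const_mul a)).hasDerivWithinAt)
      (fun κ hκ => (hbd κ hκ).le) (convex_ball κ₀ (min ρ ε)) hκ₂ hκ₁
    simp only at heq
    have h3 : f κ₁ τ - a * κ₁ - (f κ₂ τ - a * κ₂) = -(a * (κ₁ - κ₂)) := by rw [heq]; ring
    rw [h3, norm_neg, norm_mul] at h2
    have h4 : ‖κ₁ - κ₂‖ ≤ 0 := by nlinarith [norm_nonneg (κ₁ - κ₂)]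
    exact sub_eq_zero.1 (norm_le_zero_iff.1 h4)
  · have := hbd κ hκ
    rw [h0, zero_sub, norm_neg] at this
    linarith

/-- A multiple zero does not come from a single simple zero. -/
theorem eventually_multiple_zero (h : IsLocalFamily f κ₀ t₀ ε) (h0 : f κ₀ t₀ = 0)
    (hz : ¬ ∀ᶠ κ in 𝓝 κ₀, f κ t₀ = 0) (hd : deriv (fun κ => f κ t₀) κ₀ = 0) {r : ℝ} (hr : 0 < r) :
    ∀ᶠ τ in 𝓝 t₀, ∃ κ₁ ∈ Metric.ball κ₀ r, f κ₁ τ = 0 ∧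
      (deriv (fun κ => f κ τ) κ₁ = 0 ∨ ∃ κ₂ ∈ Metric.ball κ₀ r, κ₂ ≠ κ₁ ∧ f κ₂ τ = 0) := by
  obtain ⟨r', hr'0, hr'r, hr'ε, δ, hδ, hs⟩ := h.exists_sphere hz hr
  -- If `κ₁` were the only zero and simple, `f / (κ - κ₁)` would have no zero and be at least `η` on
  -- the circle, hence at `κ₁`, where it is the derivative. But derivatives nearby are smaller than
  -- `η`.
  set η := δ / 2 / (2 * r') with hη
  have hη0 : 0 < η := by positivity
  have h1 := Metric.continuousAt_iff'.1 h.continuousAt_deriv η hη0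
  rw [nhds_prod_eq] at h1
  obtain ⟨U, hU, V, hV, hUV⟩ := mem_prod_iff.1 h1
  obtain ⟨ρ, hρ, hρU⟩ := Metric.mem_nhds_iff.1 hU
  filter_upwards [hV, h.eventually_diff, h.eventually_sphere hr'ε hδ hs,
    h.eventually_exists_zero h0 hz (lt_min hρ hr'0)] with τ hτ hdiff hsph hzero
  obtain ⟨κ₁, hκ₁, hf₁⟩ := hzero
  have hκ₁ρ := Metric.ball_subset_ball (min_le_left _ _) hκ₁
  have hκ₁r' := Metric.ball_subset_ball (min_le_right _ _) hκ₁
  refine ⟨κ₁, Metric.ball_subset_ball hr'r.le hκ₁r', hf₁, ?_⟩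
  by_contra! hcon
  obtain ⟨hd1, huniq⟩ := hcon
  set g := dslope (fun κ => f κ τ) κ₁ with hg
  have hκ₁ε : κ₁ ∈ Metric.ball κ₀ ε := Metric.ball_subset_ball hr'ε.le hκ₁r'
  have hgd : DifferentiableOn ℂ g (Metric.ball κ₀ ε) :=
    (Complex.differentiableOn_dslope (Metric.isOpen_ball.mem_nhds hκ₁ε)).2 hdiff
  have hgne : ∀ κ, κ ≠ κ₁ → g κ = (κ - κ₁)⁻¹ * f κ τ := by
    intro κ hκ
    rw [hg, dslope_of_ne _ hκ, slope_def_module, hf₁, sub_zero, smul_eq_mul]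
  have hg0 : ∀ κ ∈ Metric.closedBall κ₀ r', g κ ≠ 0 := by
    intro κ hκ
    rcases eq_or_ne κ κ₁ with rfl | hne
    · rwa [hg, dslope_same]
    · rw [hgne κ hne]
      exact mul_ne_zero (inv_ne_zero (sub_ne_zero.2 hne))
        (huniq κ (Metric.closedBall_subset_ball hr'r hκ) hne)
  have hgs : ∀ κ ∈ Metric.sphere κ₀ r', η ≤ ‖g κ‖ := by
    intro κ hκ
    have hne : κ ≠ κ₁ := by
      rintro rfl
      rw [mem_sphere_iff_norm] at hκ
      rw [mem_ball_iff_norm, hκ] at hκ₁r'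
      exact lt_irrefl _ hκ₁r'
    have hdist : ‖κ - κ₁‖ ≤ 2 * r' := by
      rw [← sub_sub_sub_cancel_right κ κ₁ κ₀]
      rw [mem_sphere_iff_norm] at hκ
      rw [mem_ball_iff_norm] at hκ₁r'
      exact (norm_sub_le _ _).trans (by linarith)
    rw [hgne κ hne, norm_mul, norm_inv, hη, div_eq_inv_mul]
    have := hsph κ hκ
    have h2 : 0 < ‖κ - κ₁‖ := norm_pos_iff.2 (sub_ne_zero.2 hne)
    gcongr
  have hle := le_norm_of_forall_sphere hr'0 hη0 (hgd.mono (Metric.closedBall_subset_ball hr'ε)) hg0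
    hgs (Metric.ball_subset_closedBall hκ₁r')
  rw [hg, dslope_same] at hle
  have hlt := hUV (mk_mem_prod (hρU hκ₁ρ) hτ)
  simp only [mem_ofPred_eq, hd, dist_zero_right] at hlt
  linarith

end IsLocalFamily

/-! ### Roots in horizontal strips -/

/-- The open strip of height `2π` around the line `Im κ = 2πj`. -/
def strip (j : ℤ) : Set ℂ := {κ | |κ.im - 2 * Real.pi * j| < Real.pi}

theorem isOpen_strip (j : ℤ) : IsOpen (strip j) :=
  isOpen_lt (by fun_prop) continuous_const

/-- The boundary lines contain no escaping parameters, so limits of roots in a strip that are roots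
themselves remain in the open strip. -/
theorem mem_strip_of_abs_le {κ : ℂ} (h : κ ∈ escapingParameters) {j : ℤ}
    (hj : |κ.im - 2 * Real.pi * j| ≤ Real.pi) : κ ∈ strip j := by
  refine lt_of_le_of_ne hj fun heq => ?_
  rcases eq_or_eq_neg_of_abs_eq heq with h1 | h1
  · exact im_ne_of_escaping h j (by linarith)
  · exact im_ne_of_escaping h (j - 1) (by push_cast; linarith)

theorem exists_mem_strip {κ : ℂ} (h : κ ∈ escapingParameters) : ∃ j : ℤ, κ ∈ strip j := by
  have hpi := Real.pi_pos
  refine ⟨round (κ.im / (2 * Real.pi)), mem_strip_of_abs_le h ?_⟩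
  have h1 := abs_sub_round (κ.im / (2 * Real.pi))
  have h2 : κ.im - 2 * Real.pi * (round (κ.im / (2 * Real.pi)) : ℝ) =
      2 * Real.pi * (κ.im / (2 * Real.pi) - round (κ.im / (2 * Real.pi))) := by
    field_simp
  rw [h2, abs_mul, abs_of_pos (by positivity : 0 < 2 * Real.pi)]
  nlinarith

theorem abs_im_le_of_mem_strip {κ : ℂ} {j : ℤ} (h : κ ∈ strip j) :
    |κ.im| ≤ Real.pi + 2 * Real.pi * |(j : ℝ)| := by
  have h1 : |κ.im - 2 * Real.pi * j| < Real.pi := h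
  have h2 := abs_sub_abs_le_abs_sub κ.im (2 * Real.pi * j)
  rw [abs_mul, abs_of_pos (by positivity : 0 < 2 * Real.pi)] at h2
  linarith

theorem isLocalFamily_dynamicRay {s : Address} {t₀ : ℝ} {κ₀ : ℂ} (ha : Admissible s t₀)
    (hκ₀ : κ₀ ∈ rayDomain s t₀) : ∃ ε, IsLocalFamily (fun κ τ => dynamicRay κ s τ) κ₀ t₀ ε ∧
      ∀ κ ∈ Metric.ball κ₀ ε, ∀ τ ≥ t₀ - ε, κ ∈ rayDomain s τ := by
  obtain ⟨ε, hε, -, hdom, hc, hd⟩ := exists_ball_dynamicRay ha hκ₀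
  exact ⟨ε, ⟨hε, hc, hd⟩, hdom⟩

/-- A root is an isolated zero. -/
theorem IsRayRoot.not_eventually_zero {s : Address} {t : ℝ} {κ₀ : ℂ} (hr : IsRayRoot s t κ₀)
    (ha : Admissible s t) : ¬ ∀ᶠ κ in 𝓝 κ₀, dynamicRay κ s t = 0 := by
  intro hev
  -- The interior of the set of roots is closed by the identity theorem, as limits of roots are
  -- roots and so lie in the domain. Being clopen and nonempty it would be the whole plane, but `-2`
  -- is not an escaping parameter.
  set Z : Set ℂ := {κ | ∀ᶠ κ' in 𝓝 κ, IsRayRoot s t κ'} with hZ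
  have hopen : IsOpen Z := by
    rw [isOpen_iff_mem_nhds]
    exact fun κ hκ => eventually_eventually_nhds.2 hκ
  have hclosed : IsClosed Z := by
    rw [← closure_subset_iff_isClosed]
    intro κ hκ
    obtain ⟨u, hu, hlim⟩ := mem_closure_iff_seq_limit.1 hκ
    have hroot : IsRayRoot s t κ :=
      isRayRoot_of_tendsto ha hlim tendsto_const_nhds fun k => (hu k).self_of_nhds
    obtain ⟨ε, hf, hdom⟩ := isLocalFamily_dynamicRay ha hroot.1
    obtain ⟨κ', hκ'b, hκ'Z⟩ := mem_closure_iff.1 hκ _ Metric.isOpen_ball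
      (Metric.mem_ball_self hf.pos)
    have han : AnalyticOnNhd ℂ (fun κ => dynamicRay κ s t) (Metric.ball κ ε) :=
      (hf.diff t (by linarith [hf.pos])).analyticOnNhd Metric.isOpen_ball
    have hzero := han.eqOn_zero_of_preconnected_of_eventuallyEq_zero
      (convex_ball κ ε).isPreconnected hκ'b (hκ'Z.mono fun κ h => h.2)
    filter_upwards [Metric.ball_mem_nhds κ hf.pos] with κ₁ hκ₁
    exact ⟨hdom κ₁ hκ₁ t (by linarith [hf.pos]), hzero hκ₁⟩
  have hne : Z.Nonempty := by
    obtain ⟨ε, hf, hdom⟩ := isLocalFamily_dynamicRay ha hr.1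
    refine ⟨κ₀, ?_⟩
    filter_upwards [hev, Metric.ball_mem_nhds κ₀ hf.pos] with κ h1 h2
    exact ⟨hdom κ h2 t (by linarith [hf.pos]), h1⟩
  have huniv := IsClopen.eq_univ ⟨hclosed, hopen⟩ hne
  have hmem : (-2 : ℂ) ∈ Z := huniv ▸ mem_univ _
  have := neg_one_lt_re_of_escaping (hmem.self_of_nhds.mem_escapingParameters ha)
  norm_num at this

theorem IsRayRoot.tailRay_eq_zero {s : Address} {t : ℝ} {κ : ℂ} (hr : IsRayRoot s t κ)
    (ha : Admissible s t) (h : tailPotential κ s ≤ t) : tailRay κ s t = 0 := by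
  rw [← hr.2, (IsRayPiece.of_tail ha.1 h).dynamicRay_eq ha le_rfl]

theorem IsRayRoot.norm_sub_le_two {s : Address} {t : ℝ} {κ : ℂ} (hr : IsRayRoot s t κ)
    (ha : Admissible s t) (h : tailPotential κ s ≤ t) :
    ‖κ - (t + 2 * (Real.pi : ℂ) * Complex.I * (s 0 : ℂ))‖ ≤ 2 := by
  have h1 := (inTail_of_tailPotential_le h).norm_tailRay_sub_le_two ha.1
  rw [hr.tailRay_eq_zero ha h] at h1
  convert h1 using 2
  ring

/-- Either the a priori bound applies, or the root already lies on the tail and is within `2` of `t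
+ 2πis₁`. -/
theorem exists_norm_le_of_isRayRoot {s : Address} {t₁ : ℝ} (ha : Admissible s t₁) (j : ℤ) (T : ℝ) :
    ∃ R, ∀ t ∈ Icc t₁ T, ∀ κ ∈ strip j, IsRayRoot s t κ → ‖κ‖ ≤ R := by
  obtain ⟨X, hX⟩ := exists_re_bound ha (Real.pi + 2 * Real.pi * |(j : ℝ)|)
  refine ⟨max (max X (T + 2)) 1 + (Real.pi + 2 * Real.pi * |(j : ℝ)|), fun t ht κ hκ hr => ?_⟩
  have him := abs_im_le_of_mem_strip hκ
  have hat := ha.mono ht.1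
  have hre := neg_one_lt_re_of_escaping (hr.mem_escapingParameters hat)
  have hre' : κ.re ≤ max X (T + 2) := by
    rcases hX t ht.1 κ hr him with h | h
    · exact h.trans (le_max_left _ _)
    · have h1 := (Complex.abs_re_le_norm _).trans (hr.norm_sub_le_two hat h)
      have h2 := (abs_le.1 h1).2
      simp at h2
      exact (show κ.re ≤ T + 2 by linarith [ht.2]).trans (le_max_right _ _)
  have habs : |κ.re| ≤ max (max X (T + 2)) 1 :=
    abs_le.2 ⟨by linarith [le_max_right (max X (T + 2)) 1], hre'.trans (le_max_left _ _)⟩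
  linarith [Complex.norm_le_abs_re_add_abs_im κ]

/-- The roots in a strip depend upper semicontinuously on the potential. -/
theorem eventually_isRayRoot_mem {s : Address} {t₀ : ℝ} (ha : Admissible s t₀) {j : ℤ} {O : Set ℂ}
    (hO : IsOpen O) (h : ∀ κ ∈ strip j, IsRayRoot s t₀ κ → κ ∈ O) :
    ∀ᶠ τ in 𝓝 t₀, ∀ κ ∈ strip j, IsRayRoot s τ κ → κ ∈ O := by
  obtain ⟨t₁, ht₁, ha₁⟩ := ha.exists_lt
  obtain ⟨R, hR⟩ := exists_norm_le_of_isRayRoot ha₁ j (t₀ + 1)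
  by_contra hcon
  have hfr : ∃ᶠ τ in 𝓝 t₀, τ ∈ Icc t₁ (t₀ + 1) ∧ ∃ κ ∈ strip j, IsRayRoot s τ κ ∧ κ ∉ O := by
    refine ((not_eventually.1 hcon).and_eventually
      (Icc_mem_nhds ht₁ (lt_add_one t₀))).mono fun τ hτ => ⟨hτ.2, ?_⟩
    have := hτ.1
    push Not at this
    exact this
  obtain ⟨v, hv, hv'⟩ := exists_seq_forall_of_frequently hfr
  choose hI u hu hroot hout using hv'
  obtain ⟨κ, -, φ, hφ, hlim⟩ := tendsto_subseq_of_bounded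
    (Metric.isBounded_closedBall (x := (0 : ℂ)) (r := R)) (x := u) fun n => by
      rw [mem_closedBall_zero_iff]
      exact hR (v n) (hI n) (u n) (hu n) (hroot n)
  have hκ : IsRayRoot s t₀ κ := isRayRoot_of_tendsto ha hlim (hv.comp hφ.tendsto_atTop)
    fun k => hroot (φ k)
  have hstrip : κ ∈ strip j := by
    refine mem_strip_of_abs_le (hκ.mem_escapingParameters ha) ?_
    have hc : Continuous fun κ : ℂ => |κ.im - 2 * Real.pi * j| := by fun_prop
    exact le_of_tendsto ((hc.tendsto κ).comp hlim)
      (Eventually.of_forall fun k => (show |_| < _ from hu (φ k)).le)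
  obtain ⟨k, hk⟩ := (hlim.eventually (hO.mem_nhds (h κ hstrip hκ))).exists
  exact hout (φ k) hk

theorem IsRayRoot.eventually_exists {s : Address} {t₀ : ℝ} {κ₀ : ℂ} (hr : IsRayRoot s t₀ κ₀)
    (ha : Admissible s t₀) {U : Set ℂ} (hU : U ∈ 𝓝 κ₀) :
    ∀ᶠ τ in 𝓝 t₀, ∃ κ ∈ U, IsRayRoot s τ κ := by
  obtain ⟨ε, hf, hdom⟩ := isLocalFamily_dynamicRay ha hr.1
  obtain ⟨r, hr0, hrU⟩ := Metric.mem_nhds_iff.1 hU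
  filter_upwards [hf.eventually_exists_zero hr.2 (hr.not_eventually_zero ha) (lt_min hr0 hf.pos),
    Ici_mem_nhds (show t₀ - ε < t₀ by linarith [hf.pos])] with τ ⟨κ, hκ, h0⟩ hτ
  exact ⟨κ, hrU (Metric.ball_subset_ball (min_le_left _ _) hκ),
    hdom κ (Metric.ball_subset_ball (min_le_right _ _) hκ) τ hτ, h0⟩

/-- There is exactly one root in the strip, and it is simple. -/
def HasUniqueSimpleRoot (s : Address) (j : ℤ) (t : ℝ) : Prop :=
  ∃ κ₀ ∈ strip j, IsRayRoot s t κ₀ ∧ deriv (fun κ => dynamicRay κ s t) κ₀ ≠ 0 ∧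
    ∀ κ ∈ strip j, IsRayRoot s t κ → κ = κ₀

theorem HasUniqueSimpleRoot.eventually {s : Address} {j : ℤ} {t₀ : ℝ}
    (h : HasUniqueSimpleRoot s j t₀) (ha : Admissible s t₀) :
    ∀ᶠ τ in 𝓝 t₀, HasUniqueSimpleRoot s j τ := by
  obtain ⟨κ₀, hκ₀, hr, hd, huniq⟩ := h
  obtain ⟨ε, hf, hdom⟩ := isLocalFamily_dynamicRay ha hr.1
  obtain ⟨r, hr0, hinj⟩ := hf.eventually_injOn hd
  filter_upwards [hinj, hr.eventually_exists ha
      (inter_mem (Metric.ball_mem_nhds κ₀ hr0) ((isOpen_strip j).mem_nhds hκ₀)),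
    eventually_isRayRoot_mem ha (Metric.isOpen_ball (x := κ₀) (ε := r)) (j := j)
      fun κ hκ hκr => by rw [huniq κ hκ hκr]; exact Metric.mem_ball_self hr0]
    with τ ⟨h1, h2⟩ ⟨κ, hκ, hκr⟩ h3
  exact ⟨κ, hκ.2, hκr, h2 κ hκ.1, fun κ' hκ' hr' => h1 (h3 κ' hκ' hr') hκ.1
    (hr'.2.trans hκr.2.symm)⟩

/-- Failure has three forms: no root, which persists by semicontinuity; a multiple root, which stays
multiple or splits; two distinct roots, which both persist. -/
theorem eventually_not_hasUniqueSimpleRoot {s : Address} {j : ℤ} {t₀ : ℝ}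
    (h : ¬ HasUniqueSimpleRoot s j t₀) (ha : Admissible s t₀) :
    ∀ᶠ τ in 𝓝 t₀, ¬ HasUniqueSimpleRoot s j τ := by
  by_cases hex : ∃ κ₀ ∈ strip j, IsRayRoot s t₀ κ₀
  · obtain ⟨κ₀, hκ₀, hr⟩ := hex
    have hnhds := (isOpen_strip j).mem_nhds hκ₀
    by_cases hd : deriv (fun κ => dynamicRay κ s t₀) κ₀ = 0
    · obtain ⟨ε, hf, hdom⟩ := isLocalFamily_dynamicRay ha hr.1
      obtain ⟨r, hr0, hrU⟩ := Metric.mem_nhds_iff.1 hnhds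
      filter_upwards [hf.eventually_multiple_zero hr.2 (hr.not_eventually_zero ha) hd
        (lt_min hr0 hf.pos), Ici_mem_nhds (show t₀ - ε < t₀ by linarith [hf.pos])]
        with τ ⟨κ₁, hκ₁, h0, hor⟩ hτ ⟨κ, hκ, _, hκd, huniq⟩
      have hroot : ∀ κ' ∈ Metric.ball κ₀ (min r ε), dynamicRay κ' s τ = 0 → κ' = κ :=
        fun κ' hκ' h0' => huniq κ' (hrU (Metric.ball_subset_ball (min_le_left _ _) hκ'))
          ⟨hdom κ' (Metric.ball_subset_ball (min_le_right _ _) hκ') τ hτ, h0'⟩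
      rcases hor with hd1 | ⟨κ₂, hκ₂, hne, h0'⟩
      · rw [hroot κ₁ hκ₁ h0] at hd1
        exact hκd hd1
      · exact hne ((hroot κ₂ hκ₂ h0').trans (hroot κ₁ hκ₁ h0).symm)
    · have : ∃ κ₁ ∈ strip j, IsRayRoot s t₀ κ₁ ∧ κ₁ ≠ κ₀ := by
        by_contra! hno
        exact h ⟨κ₀, hκ₀, hr, hd, hno⟩
      obtain ⟨κ₁, hκ₁, hr₁, hne⟩ := this
      obtain ⟨U, V, hU, hV, hκ₁U, hκ₀V, hdisj⟩ := t2_separation hne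
      filter_upwards [hr.eventually_exists ha (inter_mem hnhds (hV.mem_nhds hκ₀V)),
        hr₁.eventually_exists ha (inter_mem ((isOpen_strip j).mem_nhds hκ₁) (hU.mem_nhds hκ₁U))]
        with τ ⟨a, ha, har⟩ ⟨b, hb, hbr⟩ ⟨κ, _, _, _, huniq⟩
      have hab : a = b := (huniq a ha.1 har).trans (huniq b hb.1 hbr).symm
      exact disjoint_left.1 hdisj hb.2 (hab ▸ ha.2)
  · filter_upwards [eventually_isRayRoot_mem ha isOpen_empty (j := j)
      fun κ hκ hr => hex ⟨κ, hκ, hr⟩] with τ hτ ⟨κ, hκ, hr, _⟩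
    exact hτ κ hκ hr

/-- Continuity in the potential: a property that is open and closed on a half-line and holds at
large potentials holds everywhere. -/
theorem forall_of_eventually_atTop {a : ℝ} {P : ℝ → Prop}
    (h1 : ∀ t > a, P t → ∀ᶠ τ in 𝓝 t, P τ) (h2 : ∀ t > a, ¬ P t → ∀ᶠ τ in 𝓝 t, ¬ P τ)
    (h3 : ∀ᶠ t in atTop, P t) {t : ℝ} (ht : a < t) : P t := by
  classical
  obtain ⟨t', hP, ht'⟩ := (h3.and (eventually_gt_atTop a)).exists
  have hc : ContinuousOn (fun t => decide (P t)) (Ioi a) := fun x hx => by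
    refine ContinuousAt.continuousWithinAt (tendsto_const_nhds.congr' ?_)
    by_cases hPx : P x
    · filter_upwards [h1 x hx hPx] with τ hτ
      simp [hPx, hτ]
    · filter_upwards [h2 x hx hPx] with τ hτ
      simp [hPx, hτ]
  have := isPreconnected_Ioi.constant hc ht ht'
  simpa [hP] using this

/-! ### Roots of large potential -/

/-- By `exists_re_bound` a root not yet on its tail lies in a bounded part of the strip, where the
tail begins at a bounded potential. -/
theorem eventually_tailPotential_le {s : Address} (hs : ExpBounded s) (j : ℤ) :
    ∀ᶠ t in atTop, ∀ κ ∈ strip j, IsRayRoot s t κ → tailPotential κ s ≤ t := by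
  have ha := admissible_of_minPotential_lt hs (lt_add_one (minPotential s))
  obtain ⟨X, hX⟩ := exists_re_bound ha (Real.pi + 2 * Real.pi * |(j : ℝ)|)
  set R := max X 1 + (Real.pi + 2 * Real.pi * |(j : ℝ)|) with hR
  filter_upwards [eventually_ge_atTop (minPotential s + 1),
    eventually_ge_atTop (supPotential s + 2 * Real.log (R + 3))] with t h1 h2 κ hκ hr
  have him := abs_im_le_of_mem_strip hκ
  refine (hX t h1 κ hr him).elim (fun h => ?_) id
  have hre := neg_one_lt_re_of_escaping (hr.mem_escapingParameters (ha.mono h1))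
  have habs : |κ.re| ≤ max X 1 :=
    abs_le.2 ⟨by linarith [le_max_right X 1], h.trans (le_max_left _ _)⟩
  exact (tailPotential_le_of_norm_le
    (by linarith [Complex.norm_le_abs_re_add_abs_im κ]) s).trans h2

/-- `Im κ` is within `π/2` of `2πs₁` and within `π` of `2πj`, so the integers differ by less than
`1`. -/
theorem IsRayRoot.eq_of_mem_strip {s : Address} {t : ℝ} {κ : ℂ} (hr : IsRayRoot s t κ)
    (ha : Admissible s t) (h : tailPotential κ s ≤ t) {j : ℤ} (hj : κ ∈ strip j) : j = s 0 := by
  have h1 := (inTail_of_tailPotential_le h).abs_im_tailRay_sub_lt ha.1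
  rw [hr.tailRay_eq_zero ha h, zero_add] at h1
  have h2 : |κ.im - 2 * Real.pi * j| < Real.pi := hj
  have hpi := Real.pi_pos
  rw [abs_lt] at h1 h2
  have h3 : (j : ℝ) - s 0 < 1 := by nlinarith
  have h4 : (s 0 : ℝ) - j < 1 := by nlinarith
  have h5 : j - s 0 < 1 := by exact_mod_cast h3
  have h6 : s 0 - j < 1 := by exact_mod_cast h4
  omega

theorem tendsto_mul_exp_neg : Tendsto (fun t : ℝ => t * Real.exp (-t)) atTop (𝓝 0) := by
  simpa using Real.tendsto_pow_mul_exp_neg_atTop_nhds_zero 1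

theorem tendsto_sub_two_mul_log (a b : ℝ) :
    Tendsto (fun t : ℝ => t - (a + 2 * Real.log (t + b))) atTop atTop := by
  have h1 : Tendsto (fun t : ℝ => t + b) atTop atTop := tendsto_atTop_add_const_right _ b tendsto_id
  have h2 : ∀ᶠ t : ℝ in atTop, Real.log (t + b) ≤ 1 / 4 * (t + b) := by
    filter_upwards [h1.eventually ((Real.isLittleO_log_id_atTop).bound
      (show (0 : ℝ) < 1 / 4 by norm_num)), eventually_ge_atTop (-b)] with t ht htb
    have h0 : 0 ≤ t + b := by linarith
    simp only [id, Real.norm_eq_abs, abs_of_nonneg h0] at ht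
    exact (le_abs_self _).trans ht
  have h3 : Tendsto (fun t : ℝ => 1 / 2 * t + (-a - 1 / 2 * b)) atTop atTop :=
    tendsto_atTop_add_const_right _ _ (tendsto_id.const_mul_atTop (by norm_num))
  refine tendsto_atTop_mono' _ ?_ h3
  filter_upwards [h2] with t ht
  linarith

/-- At large potentials the ray tail is close to `κ ↦ t + 2πis₁ - κ` on a disk of radius `2`. -/
theorem eventually_norm_tailRay_sub_le {s : Address} (hs : ExpBounded s) : ∃ C : ℝ,
    ∀ᶠ t : ℝ in atTop, C * (t * Real.exp (-t)) ≤ 1 / 8 ∧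
      ∀ κ ∈ Metric.closedBall ((t : ℂ) + 2 * (Real.pi : ℂ) * Complex.I * (s 0 : ℂ)) 2,
        tailPotential κ s < t ∧
        ‖tailRay κ s t - (t + 2 * (Real.pi : ℂ) * Complex.I * (s 0 : ℂ) - κ)‖ ≤
          C * (t * Real.exp (-t)) := by
  set A := 5 + 2 * Real.pi * |(s 0 : ℝ)| + 2 * Real.pi * |(s 1 : ℝ)| with hA
  have hpi := Real.pi_pos
  have hA0 : 0 < A := by positivity
  -- `3 / 2` is the constant of `norm_log_sub_le`, and `(1 + A) t` bounds the coefficient `‖κ‖ + 3 +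
  -- 2π|s₂|` on the disk for `t ≥ 1`.
  refine ⟨3 / 2 * (1 + A), ?_⟩
  have hlim := tendsto_mul_exp_neg.const_mul (3 / 2 * (1 + A))
  rw [mul_zero] at hlim
  filter_upwards [hlim.eventually_le_const (show (0 : ℝ) < 1 / 8 by norm_num),
    (tendsto_sub_two_mul_log (supPotential s) (5 + 2 * Real.pi * |(s 0 : ℝ)|)).eventually_gt_atTop 0,
    eventually_ge_atTop 1] with t h1 h2 h3
  refine ⟨h1, fun κ hκ => ?_⟩
  have hc : ‖(t : ℂ) + 2 * (Real.pi : ℂ) * Complex.I * (s 0 : ℂ)‖ ≤ t + 2 * Real.pi * |(s 0 : ℝ)| := by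
    refine (norm_add_le _ _).trans (le_of_eq ?_)
    simp [abs_of_pos hpi, abs_of_nonneg (zero_le_one.trans h3)]
  have hn : ‖κ‖ ≤ t + (2 + 2 * Real.pi * |(s 0 : ℝ)|) := by
    rw [mem_closedBall_iff_norm] at hκ
    have := norm_le_norm_add_norm_sub' κ ((t : ℂ) + 2 * (Real.pi : ℂ) * Complex.I * (s 0 : ℂ))
    linarith
  have htail : tailPotential κ s < t := by
    refine (tailPotential_le_of_norm_le hn s).trans_lt ?_
    rw [show t + (2 + 2 * Real.pi * |(s 0 : ℝ)|) + 3 = t + (5 + 2 * Real.pi * |(s 0 : ℝ)|) by ring]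
    linarith
  have hexp : Real.exp (-t) * Real.exp t = 1 := by rw [← Real.exp_add]; simp
  have hle : ‖κ‖ + 3 + 2 * Real.pi * |(s 1 : ℝ)| ≤ (1 + A) * t := by nlinarith
  have hbig : (1 + A) * t ≤ 1 / 2 * Real.exp t := by
    have : (1 + A) * t * (Real.exp (-t) * Real.exp t) ≤ 1 / 12 * Real.exp t := by
      rw [← mul_assoc]
      exact mul_le_mul_of_nonneg_right (by linarith) (Real.exp_pos t).le
    rw [hexp] at this
    linarith [Real.exp_pos t]
  refine ⟨htail, ?_⟩
  have h4 := (inTail_of_tailPotential_le htail.le).norm_tailRay_sub_le hs (hle.trans hbig)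
  rw [show (t : ℂ) + 2 * (Real.pi : ℂ) * Complex.I * (s 0 : ℂ) - κ =
    t - κ + 2 * (Real.pi : ℂ) * Complex.I * (s 0 : ℂ) by ring]
  refine h4.trans ?_
  have := mul_le_mul_of_nonneg_right hle (Real.exp_pos (-t)).le
  linarith

/-- A holomorphic function close to `κ ↦ c - κ` has exactly one zero near `c`, a simple one. -/
theorem exists_unique_zero_of_norm_sub_le {f : ℂ → ℂ} {c : ℂ}
    (hf : DifferentiableOn ℂ f (Metric.closedBall c 2))
    (hb : ∀ κ ∈ Metric.closedBall c 2, ‖f κ - (c - κ)‖ ≤ 1 / 8) :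
    ∃ κ₀ ∈ Metric.ball c 1, f κ₀ = 0 ∧ deriv f κ₀ ≠ 0 ∧
      ∀ κ ∈ Metric.closedBall c 2, f κ = 0 → κ = κ₀ := by
  have hfb : DifferentiableOn ℂ f (Metric.ball c 2) := hf.mono Metric.ball_subset_closedBall
  have hball : Metric.ball c 1 ⊆ Metric.ball c 2 := Metric.ball_subset_ball (by norm_num)
  have hnear : ∀ κ ∈ Metric.closedBall c 2, f κ = 0 → κ ∈ Metric.ball c 1 := fun κ hκ h0 => by
    have := hb κ hκ
    rw [h0, zero_sub, norm_neg, norm_sub_rev] at this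
    rw [mem_ball_iff_norm]
    linarith
  have hderiv : ∀ κ ∈ Metric.ball c 1, ∃ D : ℂ, ‖D‖ ≤ 1 / 8 ∧
      HasDerivAt (fun κ => f κ - (c - κ)) D κ ∧ HasDerivAt f (D - 1) κ := by
    intro κ hκ
    have hd : HasDerivAt f (deriv f κ) κ :=
      (hfb.differentiableAt (Metric.isOpen_ball.mem_nhds (hball hκ))).hasDerivAt
    have hd' : HasDerivAt (fun κ => f κ - (c - κ)) (deriv f κ + 1) κ := by
      have := hd.sub ((hasDerivAt_id κ).const_sub c)
      rwa [sub_neg_eq_add] at this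
    have hsub : Metric.closedBall κ 1 ⊆ Metric.closedBall c 2 :=
      Metric.closedBall_subset_closedBall' (by rw [Metric.mem_ball] at hκ; linarith)
    refine ⟨_, ?_, hd', by simpa using hd⟩
    -- Cauchy's estimate on a circle of radius `1`: the derivative is within `1 / 8` of `-1`, so
    -- zeros are simple and unique.
    have := Complex.norm_deriv_le_of_forall_mem_sphere_norm_le (c := κ) (R := 1) (C := 1 / 8)
      (f := fun κ => f κ - (c - κ)) one_pos
      ((hf.sub (differentiableOn_const c |>.sub differentiableOn_id)).diffContOnCl_ball hsub)
      fun z hz => hb z (hsub (Metric.sphere_subset_closedBall hz))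
    rwa [hd'.deriv, div_one] at this
  have hex : ∃ κ₀ ∈ Metric.closedBall c 1, f κ₀ = 0 := by
    by_contra! hno
    have hsub : Metric.closedBall c 1 ⊆ Metric.closedBall c 2 :=
      Metric.closedBall_subset_closedBall (by norm_num)
    have h1 := le_norm_of_forall_sphere one_pos (show (0 : ℝ) < 7 / 8 by norm_num) (hf.mono hsub) hno
      (fun w hw => by
        have h2 := hb w (hsub (Metric.sphere_subset_closedBall hw))
        rw [mem_sphere_iff_norm, norm_sub_rev] at hw
        have := norm_sub_norm_le (c - w) (f w)
        rw [norm_sub_rev (c - w)] at this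
        linarith) (Metric.mem_closedBall_self zero_le_one)
    have h2 := hb c (Metric.mem_closedBall_self (by norm_num))
    rw [sub_self, sub_zero] at h2
    linarith
  obtain ⟨κ₀, hκ₀, h0⟩ := hex
  have hκ₀b := hnear κ₀ (Metric.closedBall_subset_closedBall (by norm_num) hκ₀) h0
  refine ⟨κ₀, hκ₀b, h0, ?_, fun κ hκ hκ0 => ?_⟩
  · obtain ⟨D, hD, -, hd⟩ := hderiv κ₀ hκ₀b
    rw [hd.deriv, sub_ne_zero]
    rintro rfl
    norm_num at hD
  · choose! D hD hd _ using hderiv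
    have := Convex.norm_image_sub_le_of_norm_hasDerivWithin_le (f := fun κ => f κ - (c - κ))
      (fun κ hκ => (hd κ hκ).hasDerivWithinAt) hD (convex_ball c 1) hκ₀b (hnear κ hκ hκ0)
    simp only [h0, hκ0] at this
    rw [show (0 : ℂ) - (c - κ) - (0 - (c - κ₀)) = κ - κ₀ by ring] at this
    have h1 : ‖κ - κ₀‖ ≤ 0 := by linarith
    exact sub_eq_zero.1 (norm_le_zero_iff.1 h1)

theorem ball_subset_strip (t : ℝ) (j : ℤ) :
    Metric.closedBall ((t : ℂ) + 2 * (Real.pi : ℂ) * Complex.I * (j : ℂ)) 2 ⊆ strip j := by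
  intro κ hκ
  rw [mem_closedBall_iff_norm] at hκ
  have h1 := (Complex.abs_im_le_norm _).trans hκ
  have h2 : (κ - ((t : ℂ) + 2 * (Real.pi : ℂ) * Complex.I * (j : ℂ))).im =
      κ.im - 2 * Real.pi * j := by simp
  rw [h2] at h1
  exact h1.trans_lt (by linarith [Real.pi_gt_three])

theorem eventually_hasUniqueSimpleRoot {s : Address} (hs : ExpBounded s) : ∃ C : ℝ,
    ∀ᶠ t : ℝ in atTop, HasUniqueSimpleRoot s (s 0) t ∧ ∀ κ ∈ strip (s 0), IsRayRoot s t κ →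
      ‖κ - (t + 2 * (Real.pi : ℂ) * Complex.I * (s 0 : ℂ))‖ ≤ C * (t * Real.exp (-t)) := by
  obtain ⟨C, hC⟩ := eventually_norm_tailRay_sub_le hs
  refine ⟨C, ?_⟩
  filter_upwards [hC, eventually_tailPotential_le hs (s 0), eventually_gt_atTop (minPotential s)]
    with t ⟨h1, h2⟩ h3 h4
  set c : ℂ := t + 2 * (Real.pi : ℂ) * Complex.I * (s 0 : ℂ) with hc
  have ha := admissible_of_minPotential_lt hs h4
  have hnear : ∀ κ ∈ strip (s 0), IsRayRoot s t κ → κ ∈ Metric.closedBall c 2 := fun κ hκ hr =>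
    mem_closedBall_iff_norm.2 (hr.norm_sub_le_two ha (h3 κ hκ hr))
  have hpiece : ∀ κ ∈ Metric.closedBall c 2, IsRayPiece κ s t (tailRay κ s) := fun κ hκ =>
    IsRayPiece.of_tail hs (h2 κ hκ).1.le
  have hdyn : EqOn (fun κ => dynamicRay κ s t) (fun κ => tailRay κ s t) (Metric.closedBall c 2) :=
    fun κ hκ => (hpiece κ hκ).dynamicRay_eq ha le_rfl
  obtain ⟨κ₀, hκ₀, h0, hd, huniq⟩ := exists_unique_zero_of_norm_sub_le
    (f := fun κ => tailRay κ s t) (c := c)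
    ((differentiableOn_tailRay hs t).mono fun κ hκ => inTail_of_tailPotential_le (h2 κ hκ).1.le)
    fun κ hκ => (h2 κ hκ).2.trans h1
  have hκ₀' : κ₀ ∈ Metric.closedBall c 2 := Metric.closedBall_subset_closedBall (by norm_num)
    (Metric.ball_subset_closedBall hκ₀)
  refine ⟨⟨κ₀, ball_subset_strip t (s 0) hκ₀', ⟨⟨_, hpiece κ₀ hκ₀'⟩, (hdyn hκ₀').trans h0⟩, ?_,
    fun κ hκ hr => huniq κ (hnear κ hκ hr) (hr.tailRay_eq_zero ha (h3 κ hκ hr))⟩, fun κ hκ hr => ?_⟩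
  · have : (fun κ => dynamicRay κ s t) =ᶠ[𝓝 κ₀] fun κ => tailRay κ s t :=
      hdyn.eventuallyEq_of_mem (mem_of_superset (Metric.isOpen_ball.mem_nhds hκ₀)
        (Metric.ball_subset_closedBall.trans (Metric.closedBall_subset_closedBall (by norm_num))))
    rwa [this.deriv_eq]
  · have := (h2 κ (hnear κ hκ hr)).2
    rwa [hr.tailRay_eq_zero ha (h3 κ hκ hr), zero_sub, norm_neg, norm_sub_rev] at this

/-! ### Parameter rays -/

theorem hasUniqueSimpleRoot {s : Address} (hs : ExpBounded s) {t : ℝ} (ht : minPotential s < t) :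
    HasUniqueSimpleRoot s (s 0) t := by
  obtain ⟨C, hC⟩ := eventually_hasUniqueSimpleRoot hs
  exact forall_of_eventually_atTop (P := HasUniqueSimpleRoot s (s 0))
    (fun t ht h => h.eventually (admissible_of_minPotential_lt hs ht))
    (fun t ht h => eventually_not_hasUniqueSimpleRoot h (admissible_of_minPotential_lt hs ht))
    (hC.mono fun t h => h.1) ht

/-- The same continuation: absence of roots is open by semicontinuity, presence is open by Hurwitz,
and for large `t` there are none in these strips. -/
theorem not_isRayRoot_of_mem_strip {s : Address} (hs : ExpBounded s) {j : ℤ} (hj : j ≠ s 0) {t : ℝ}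
    (ht : minPotential s < t) : ∀ κ ∈ strip j, ¬ IsRayRoot s t κ := by
  refine forall_of_eventually_atTop (P := fun t => ∀ κ ∈ strip j, ¬ IsRayRoot s t κ)
    (fun t ht h => ?_) (fun t ht h => ?_) ?_ ht
  · exact (eventually_isRayRoot_mem (admissible_of_minPotential_lt hs ht) isOpen_empty h).mono
      fun τ h κ hκ hr => h κ hκ hr
  · push Not at h
    obtain ⟨κ, hκ, hr⟩ := h
    filter_upwards [hr.eventually_exists (admissible_of_minPotential_lt hs ht)
      ((isOpen_strip j).mem_nhds hκ)] with τ ⟨κ', hκ', hr'⟩ h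
    exact h κ' hκ' hr'
  · filter_upwards [eventually_tailPotential_le hs j, eventually_gt_atTop (minPotential s)]
      with t h1 h2 κ hκ hr
    exact hj (hr.eq_of_mem_strip (admissible_of_minPotential_lt hs h2) (h1 κ hκ hr) hκ)

theorem IsRayRoot.mem_strip {s : Address} (hs : ExpBounded s) {t : ℝ} (ht : minPotential s < t)
    {κ : ℂ} (hr : IsRayRoot s t κ) : κ ∈ strip (s 0) := by
  obtain ⟨j, hj⟩ := exists_mem_strip
    (hr.mem_escapingParameters (admissible_of_minPotential_lt hs ht))
  by_cases h : j = s 0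
  · rwa [← h]
  · exact absurd hr (not_isRayRoot_of_mem_strip hs h ht κ hj)

theorem exists_isSimpleRayRoot {s : Address} (hs : ExpBounded s) {t : ℝ}
    (ht : minPotential s < t) :
    ∃ κ₀, IsSimpleRayRoot s t κ₀ ∧ ∀ κ, IsRayRoot s t κ → κ = κ₀ := by
  obtain ⟨κ₀, -, hr, hd, huniq⟩ := hasUniqueSimpleRoot hs ht
  obtain ⟨ε, hf, hdom⟩ := isLocalFamily_dynamicRay (admissible_of_minPotential_lt hs ht) hr.1
  have hle : t ≥ t - ε := by linarith [hf.pos]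
  have hball := Metric.ball_mem_nhds κ₀ hf.pos
  exact ⟨κ₀, ⟨hr, mem_of_superset hball fun κ hκ => hdom κ hκ t hle,
    (hf.diff t hle).analyticAt hball, hd⟩, fun κ h => huniq κ (h.mem_strip hs ht) h⟩

open Classical in
/-- The parameter ray at address `s`. -/
noncomputable def parameterRay (s : Address) (t : ℝ) : ℂ :=
  if h : ∃ κ, IsSimpleRayRoot s t κ then h.choose else 0

theorem isSimpleRayRoot_parameterRay {s : Address} (hs : ExpBounded s) {t : ℝ}
    (ht : minPotential s < t) :
    IsSimpleRayRoot s t (parameterRay s t) := by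
  obtain ⟨κ, hκ, -⟩ := exists_isSimpleRayRoot hs ht
  have hex : ∃ κ, IsSimpleRayRoot s t κ := ⟨κ, hκ⟩
  rw [parameterRay, dif_pos hex]
  exact hex.choose_spec

theorem eq_parameterRay {s : Address} (hs : ExpBounded s) {t : ℝ} (ht : minPotential s < t) {κ : ℂ}
    (hκ : IsRayRoot s t κ) :
    κ = parameterRay s t := by
  obtain ⟨κ₀, -, huniq⟩ := exists_isSimpleRayRoot hs ht
  rw [huniq κ hκ, huniq _ (isSimpleRayRoot_parameterRay hs ht).1]

theorem isParameterRay_parameterRay {s : Address} (hs : ExpBounded s) : IsParameterRay s (parameterRay s) := by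
  refine ⟨fun t ht => ContinuousAt.continuousWithinAt ?_, fun t ht =>
    (isSimpleRayRoot_parameterRay hs ht).1.mem_escapingParameters
      (admissible_of_minPotential_lt hs ht), fun t ht => isSimpleRayRoot_parameterRay hs ht⟩
  rw [Metric.continuousAt_iff']
  intro η hη
  -- Since the root is unique, upper semicontinuity of the set of roots is continuity.
  filter_upwards [eventually_isRayRoot_mem (admissible_of_minPotential_lt hs ht)
    (Metric.isOpen_ball (x := parameterRay s t) (ε := η)) (j := s 0) fun κ _ hr => by
      rw [eq_parameterRay hs ht hr]; exact Metric.mem_ball_self hη, Ioi_mem_nhds ht] with τ h1 h2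
  have hr := (isSimpleRayRoot_parameterRay hs h2).1
  exact h1 _ (hr.mem_strip hs h2) hr

theorem parameterRay_isBigO {s : Address} (hs : ExpBounded s) :
    (fun t : ℝ => parameterRay s t - ((t : ℂ) + 2 * (Real.pi : ℂ) * Complex.I * (s 0 : ℂ)))
      =O[atTop] (fun t : ℝ => t * Real.exp (-t)) := by
  obtain ⟨C, hC⟩ := eventually_hasUniqueSimpleRoot hs
  refine IsBigO.of_bound C ?_
  filter_upwards [hC, eventually_gt_atTop (minPotential s), eventually_ge_atTop 0]
    with t ⟨_, h1⟩ h2 h3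
  have hr := (isSimpleRayRoot_parameterRay hs h2).1
  rw [Real.norm_of_nonneg (mul_nonneg h3 (Real.exp_pos _).le)]
  exact h1 _ (hr.mem_strip hs h2) hr

/-- A parameter determines the potential and the address of the parameter ray it is on. -/
theorem IsRayRoot.eq_and_eq {κ : ℂ} {s s' : Address} {t t' : ℝ} (h : IsRayRoot s t κ)
    (h' : IsRayRoot s' t' κ) (ha : Admissible s t) (ha' : Admissible s' t') : t = t' ∧ s = s' := by
  obtain ⟨N₁, hN₁⟩ := ha.exists_tailPotential_le ‖κ‖
  obtain ⟨N₂, hN₂⟩ := ha'.exists_tailPotential_le ‖κ‖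
  have hN : ∀ n ≥ max N₁ N₂, ∀ τ ≥ t, tailPotential κ (shift^[n] s) ≤ F^[n] τ := fun n hn τ hτ =>
    (hN₁ n ((le_max_left _ _).trans hn) τ hτ κ le_rfl).le
  have hN' : ∀ n ≥ max N₁ N₂, ∀ τ ≥ t', tailPotential κ (shift^[n] s') ≤ F^[n] τ :=
    fun n hn τ hτ => (hN₂ n ((le_max_right _ _).trans hn) τ hτ κ le_rfl).le
  obtain ⟨rfl, htl⟩ := eq_of_tailRay_eq (κ := κ) (N := max N₁ N₂) ha.1 ha'.1 ha.pos ha'.pos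
    fun n hn => ⟨inTail_of_tailPotential_le (hN n hn t le_rfl),
      inTail_of_tailPotential_le (hN' n hn t' le_rfl), by
        rw [← h.iterate_E_zero ha (hN n hn t le_rfl), h'.iterate_E_zero ha' (hN' n hn t' le_rfl)]⟩
  refine ⟨rfl, ?_⟩
  have hshift : ∀ n ≥ max N₁ N₂, shift^[n] s = shift^[n] s' := fun n hn => by
    funext k
    rw [shift_iterate_apply, shift_iterate_apply, htl (n + k) (by omega)]
  obtain ⟨γ, hγ, h0⟩ := (isRayRoot_iff ha).1 h
  obtain ⟨γ', hγ', h0'⟩ := (isRayRoot_iff ha').1 h'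
  -- So far the addresses agree only from some entry on. The two curves have the same image under a
  -- high iterate and both start at `0`, so uniqueness of lifts makes them equal.
  have heq : EqOn γ γ' (Ici t) := eqOn_of_iterate_E_eqOn (κ := κ) isPreconnected_Ici (max N₁ N₂)
    hγ.1 hγ'.1 (fun τ hτ => by
      rw [hγ.iterate_E_eq ha.1 hτ (hN _ le_rfl τ hτ), hγ'.iterate_E_eq ha'.1 hτ (hN' _ le_rfl τ hτ),
        hshift _ le_rfl]) self_mem_Ici (h0.trans h0'.symm)
  funext n
  -- The early entries are read off at a potential so large that level `n` already lies on both
  -- tails, where the imaginary part determines the entry.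
  obtain ⟨τ, hτ, h1, h2⟩ : ∃ τ ≥ t, tailPotential κ (shift^[n] s) ≤ F^[n] τ ∧
      tailPotential κ (shift^[n] s') ≤ F^[n] τ := by
    refine ⟨max t (max (tailPotential κ (shift^[n] s)) (tailPotential κ (shift^[n] s'))),
      le_max_left _ _, ?_, ?_⟩ <;> refine le_trans ?_ (le_iterate_F n _)
    · exact (le_max_left _ _).trans (le_max_right _ _)
    · exact (le_max_right _ _).trans (le_max_right _ _)
  have e1 := hγ.iterate_E_eq ha.1 hτ h1
  have e2 := hγ'.iterate_E_eq ha'.1 hτ h2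
  rw [heq hτ, e2] at e1
  have b1 := (inTail_of_tailPotential_le h1).abs_im_tailRay_sub_lt (ha.1.iterate n)
  have b2 := (inTail_of_tailPotential_le h2).abs_im_tailRay_sub_lt (ha'.1.iterate n)
  rw [e1] at b2
  rw [shift_iterate_zero, abs_lt] at b1 b2
  have hpi := Real.pi_pos
  have h3 : (s n : ℝ) - s' n < 1 := by nlinarith
  have h4 : (s' n : ℝ) - s n < 1 := by nlinarith
  have h5 : s n - s' n < 1 := by exact_mod_cast h3
  have h6 : s' n - s n < 1 := by exact_mod_cast h4
  omega

end ExpRays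

theorem theorem3p5 :
    ∃ G : ExpRays.Address → ℝ → ℂ,
      (∀ s : ExpRays.Address, ExpRays.ExpBounded s →
        -- `G s` is a parameter ray, and it is the only one
        ExpRays.IsParameterRay s (G s) ∧
        (∀ H : ℝ → ℂ, ExpRays.IsParameterRay s H →
          Set.EqOn H (G s) (Set.Ioi (ExpRays.minPotential s))) ∧
        -- it contains all the roots
        (∀ t : ℝ, ExpRays.minPotential s < t → ∀ κ : ℂ, ExpRays.IsRayRoot s t κ → κ = G s t) ∧
        -- it is injective
        Set.InjOn (G s) (Set.Ioi (ExpRays.minPotential s)) ∧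
        -- asymptotics
        (fun t : ℝ => G s t - ((t : ℂ) + 2 * (Real.pi : ℂ) * Complex.I * (s 0 : ℂ)))
          =O[Filter.atTop] (fun t : ℝ => t * Real.exp (-t))) ∧
      -- different parameter rays are disjoint
      (∀ s s' : ExpRays.Address, ExpRays.ExpBounded s → ExpRays.ExpBounded s' → s ≠ s' →
        Disjoint (G s '' Set.Ioi (ExpRays.minPotential s))
          (G s' '' Set.Ioi (ExpRays.minPotential s'))) := by
  have key : ∀ {s s' : ExpRays.Address}, ExpRays.ExpBounded s → ExpRays.ExpBounded s' →
      ∀ {t t' : ℝ}, ExpRays.minPotential s < t → ExpRays.minPotential s' < t' →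
      ExpRays.parameterRay s t = ExpRays.parameterRay s' t' → t = t' ∧ s = s' := by
    intro s s' hs hs' t t' ht ht' heq
    exact (ExpRays.isSimpleRayRoot_parameterRay hs ht).1.eq_and_eq
      (heq ▸ (ExpRays.isSimpleRayRoot_parameterRay hs' ht').1)
      (ExpRays.admissible_of_minPotential_lt hs ht) (ExpRays.admissible_of_minPotential_lt hs' ht')
  refine ⟨ExpRays.parameterRay, fun s hs => ⟨ExpRays.isParameterRay_parameterRay hs,
    fun H hH t ht => ExpRays.eq_parameterRay hs ht (hH.2.2 t ht).1,
    fun t ht κ hκ => ExpRays.eq_parameterRay hs ht hκ,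
    fun t ht t' ht' heq => (key hs hs ht ht' heq).1, ExpRays.parameterRay_isBigO hs⟩,
    fun s s' hs hs' hne => ?_⟩
  rw [Set.disjoint_left]
  rintro _ ⟨t, ht, rfl⟩ ⟨t', ht', heq⟩
  exact hne (key hs hs' ht ht' heq.symm).2
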